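/- Let $d\ge 0$ be an integer and $1\le p\le\infty$. For $z=(x,\xi)\in\mathbb R^{2d}$ let $\rho(z)$ be the unitary operator on $L^2(\mathbb R^d)$ given by $\rho(x,\xi)f(t)=e^{-\pi i x\cdot\xi}e^{2\pi i\xi\cdot t}f(t-x)$. Let $\mathcal S^p$ be the Schatten class of bounded operators $T$ on $L^2(\mathbb R^d)$ whose sequence of singular values lies in $\ell^p$, with $\|T\|_{\mathcal S^p}=\|(s_n(T))_n\|_{\ell^p}$ (so $\mathcal S^\infty$ is the space of all bounded operators with the operator norm). For $T\in\mathcal S^1$ put $\mathcal F_W(T)(z)=\operatorname{tr}(T\rho(-z))$, and for $m\in L^\infty(\mathbb R^{2d})$ put $$\mathfrak T_m(T)=\int_{\mathbb R^{2d}}m(z)\,\mathcal F_W(T)(z)\,\rho(z)\,dz,$$ the integral being understood weakly. Let $\mathfrak M_p$ be the set of all $m\in L^\infty(\mathbb R^{2d})$ (modulo null sets) such that $\mathfrak T_m$ extends from $\mathcal S^1$ to a bounded linear operator on $\mathcal S^p$, and let $\|m\|_{\mathfrak M_p}$ be the infimum of the operator norms of such extensions (for $p<\infty$ there is only one, so that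 this is its operator norm). Then $\mathfrak M_p$ is a unital subalgebra of $L^\infty(\mathbb R^{2d})$ under pointwise multiplication, and $\|\cdot\|_{\mathfrak M_p}$ is a complete norm on it with $\|m_1m_2\|_{\mathfrak M_p}\le\|m_1\|_{\mathfrak M_p}\|m_2\|_{\mathfrak M_p}$ and $\|1\|_{\mathfrak M_p}=1$; that is, $\mathfrak M_p$ is a unital Banach algebra. Products of symbols correspond to compositions of operators: there is an isometric homomorphism $\Phi$ of unital algebras from $\mathfrak M_p$ into the bounded linear operators on $\mathcal S^p$ such that $\Phi(m)$ extends $\mathfrak T_m$ for every $m\in\mathfrak M_p$; and if $A_1,A_2$ are any bounded linear operators on $\mathcal S^p$ that extend $\mathfrak T_{m_1},\mathfrak T_{m_2}$, where $m_1,m_2\in\mathfrak M_p$, then $A_1\circ A_2$ extends $\mathfrak T_{m_1m_2}$. -/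

import Mathlib

open MeasureTheory Filter Topology
open scoped ENNReal InnerProductSpace

namespace FourierWigner

/-! ### Singular values and Schatten classes -/

section Schatten

variable {H : Type*} [NormedAddCommGroup H] [InnerProductSpace ℂ H]

/-- The `n`-th singular value `s_n(T)` (indexed from `0`) of a bounded operator on a Hilbert space:
the distance of `T` to the operators of rank at most `n`. See `singularValue_eq_of_hasSum` for the
agreement with the coefficients of a singular value decomposition. -/
noncomputable def singularValue (T : H →L[ℂ] H) (n : ℕ) : ℝ :=
  ⨅ F : {F : H →L[ℂ] H // (F : H →ₗ[ℂ] H).rank ≤ (n : Cardinal)}, ‖T - F.1‖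

theorem singularValue_bddBelow (T : H →L[ℂ] H) (n : ℕ) :
    BddBelow (Set.range fun F : {F : H →L[ℂ] H // (F : H →ₗ[ℂ] H).rank ≤ (n : Cardinal)} =>
      ‖T - F.1‖) :=
  ⟨0, by rintro _ ⟨F, rfl⟩; exact norm_nonneg _⟩

instance (n : ℕ) : Nonempty {F : H →L[ℂ] H // (F : H →ₗ[ℂ] H).rank ≤ (n : Cardinal)} :=
  ⟨⟨0, by simp⟩⟩

theorem singularValue_nonneg (T : H →L[ℂ] H) (n : ℕ) : 0 ≤ singularValue T n :=
  Real.iInf_nonneg fun _ => norm_nonneg _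

theorem singularValue_le {T F : H →L[ℂ] H} {n : ℕ}
    (hF : (F : H →ₗ[ℂ] H).rank ≤ (n : Cardinal)) : singularValue T n ≤ ‖T - F‖ :=
  ciInf_le (singularValue_bddBelow T n) ⟨F, hF⟩

theorem singularValue_antitone (T : H →L[ℂ] H) : Antitone (singularValue T) := by
  intro m n hmn
  refine le_ciInf fun F => singularValue_le (F.2.trans ?_)
  exact_mod_cast hmn

theorem singularValue_le_norm (T : H →L[ℂ] H) (n : ℕ) : singularValue T n ≤ ‖T‖ := by
  simpa using singularValue_le (T := T) (F := 0) (n := n) (by simp)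

theorem singularValue_zero (n : ℕ) : singularValue (0 : H →L[ℂ] H) n = 0 :=
  le_antisymm (by simpa using singularValue_le_norm (0 : H →L[ℂ] H) n) (singularValue_nonneg _ _)

theorem singularValue_add_le (S T : H →L[ℂ] H) (m n : ℕ) :
    singularValue (S + T) (m + n) ≤ singularValue S m + singularValue T n := by
  refine le_ciInf_add_ciInf fun F G => ?_
  have h : ((F.1 + G.1 : H →L[ℂ] H) : H →ₗ[ℂ] H).rank ≤ ((m + n : ℕ) : Cardinal) := by
    push_cast
    exact (LinearMap.rank_add_le _ _).trans (add_le_add F.2 G.2)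
  refine (singularValue_le h).trans ?_
  rw [add_sub_add_comm]
  exact norm_add_le _ _

theorem singularValue_smul_le (c : ℂ) (T : H →L[ℂ] H) (n : ℕ) :
    singularValue (c • T) n ≤ ‖c‖ * singularValue T n := by
  unfold singularValue
  rw [Real.mul_iInf_of_nonneg (norm_nonneg c)]
  refine le_ciInf fun F => ?_
  have h : ((c • F.1 : H →L[ℂ] H) : H →ₗ[ℂ] H).rank ≤ (n : Cardinal) := by
    refine le_trans ?_ F.2
    refine Submodule.rank_mono ?_
    rintro _ ⟨x, rfl⟩
    exact ⟨c • x, by simp⟩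
  refine (singularValue_le h).trans ?_
  rw [← smul_sub, norm_smul]

/-- If `T = ∑ s_n e_n ⊗ η_n` is a singular value decomposition (`e`, `η` orthonormal families and
`s` nonnegative and nonincreasing), then `s_n` is the `n`-th singular value of `T`. -/
theorem singularValue_eq_of_hasSum {T : H →L[ℂ] H} {s : ℕ → ℝ} {e η : ℕ → H} (hs : Antitone s)
    (hs0 : ∀ n, 0 ≤ s n) (he : Orthonormal ℂ e) (hη : Orthonormal ℂ η)
    (hT : ∀ f, HasSum (fun n => ((s n : ℂ) * ⟪η n, f⟫_ℂ) • e n) (T f)) (n : ℕ) :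
    singularValue T n = s n := by
  classical
  have hnorm : ∀ (v : ℕ → H), Orthonormal ℂ v → ∀ (J : Finset ℕ) (c : ℕ → ℂ),
      ‖∑ k ∈ J, c k • v k‖ ^ 2 = ∑ k ∈ J, ‖c k‖ ^ 2 := by
    intro v hv J c
    have h := hv.inner_sum c c J
    rw [inner_self_eq_norm_sq_to_K] at h
    have h2 : ((‖∑ k ∈ J, c k • v k‖ ^ 2 : ℝ) : ℂ) = ((∑ k ∈ J, ‖c k‖ ^ 2 : ℝ) : ℂ) := by
      push_cast
      refine Eq.trans h (Finset.sum_congr rfl fun k _ => ?_)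
      rw [mul_comm, Complex.mul_conj']
    exact_mod_cast h2
  refine le_antisymm ?_ ?_
  · let F : H →L[ℂ] H :=
      ∑ k ∈ Finset.range n, ((s k : ℂ) • (innerSL ℂ (η k)).smulRight (e k))
    have hF : ∀ f, F f = ∑ k ∈ Finset.range n, ((s k : ℂ) * ⟪η k, f⟫_ℂ) • e k := by
      intro f
      simp only [F, sum_apply, smul_apply,
        ContinuousLinearMap.smulRight_apply, innerSL_apply_apply, smul_smul]
    have hrank : (F : H →ₗ[ℂ] H).rank ≤ (n : Cardinal) := by
      have hle : LinearMap.range (F : H →ₗ[ℂ] H) ≤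
          Submodule.span ℂ (((Finset.range n).image e : Finset H) : Set H) := by
        rintro _ ⟨f, rfl⟩
        rw [ContinuousLinearMap.coe_coe, hF]
        refine Submodule.sum_mem _ fun k hk => Submodule.smul_mem _ _ (Submodule.subset_span ?_)
        exact Finset.mem_coe.2 (Finset.mem_image_of_mem e hk)
      refine (Submodule.rank_mono hle).trans ((rank_span_finset_le _).trans ?_)
      exact_mod_cast Finset.card_image_le.trans (Finset.card_range n).le
    refine (singularValue_le hrank).trans (ContinuousLinearMap.opNorm_le_bound _ (hs0 n) ?_)
    intro f
    have hlim : Tendsto (fun N => ∑ k ∈ Finset.range N, ((s k : ℂ) * ⟪η k, f⟫_ℂ) • e k - F f)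
        atTop (𝓝 (T f - F f)) := (hT f).tendsto_sum_nat.sub_const _
    refine le_of_tendsto hlim.norm ?_
    filter_upwards [eventually_ge_atTop n] with N hN
    rw [hF, ← Finset.sum_Ico_eq_sub _ hN]
    refine le_of_sq_le_sq ?_ (mul_nonneg (hs0 n) (norm_nonneg f))
    rw [hnorm e he, mul_pow]
    calc ∑ k ∈ Finset.Ico n N, ‖(s k : ℂ) * ⟪η k, f⟫_ℂ‖ ^ 2
        ≤ ∑ k ∈ Finset.Ico n N, s n ^ 2 * ‖⟪η k, f⟫_ℂ‖ ^ 2 := by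
          refine Finset.sum_le_sum fun k hk => ?_
          rw [norm_mul, mul_pow, Complex.norm_real, Real.norm_of_nonneg (hs0 k)]
          gcongr
          · exact hs0 k
          · exact hs (Finset.mem_Ico.1 hk).1
      _ ≤ s n ^ 2 * ‖f‖ ^ 2 := by
          rw [← Finset.mul_sum]
          gcongr
          exact hη.sum_inner_products_le f
  · refine le_ciInf fun F => ?_
    let L : (Fin (n + 1) → ℂ) →ₗ[ℂ] H := Fintype.linearCombination ℂ (fun i : Fin (n + 1) => η i)
    have hnot : ¬ Function.Injective
        (((F.1 : H →ₗ[ℂ] H).comp L).rangeRestrict) := by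
      intro hinj
      have h1 := LinearMap.lift_rank_le_of_injective _ hinj
      have h2 : ((F.1 : H →ₗ[ℂ] H).comp L).rank ≤ (n : Cardinal) :=
        (LinearMap.rank_comp_le_left _ _).trans F.2
      have h3 := h1.trans (Cardinal.lift_le.2 h2)
      rw [rank_fin_fun, Cardinal.lift_natCast, Cardinal.lift_natCast] at h3
      exact absurd (Nat.cast_le.1 h3) (by omega)
    obtain ⟨c, hc, hc0⟩ : ∃ c, F.1 (L c) = 0 ∧ c ≠ 0 := by
      rw [LinearMap.injective_rangeRestrict_iff, ← LinearMap.ker_eq_bot,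
        Submodule.eq_bot_iff] at hnot
      push Not at hnot
      simpa using hnot
    let c' : ℕ → ℂ := fun k => if h : k < n + 1 then c ⟨k, h⟩ else 0
    have hc'0 : ∀ k, ¬ k < n + 1 → c' k = 0 := fun k hk => dif_neg hk
    have hc'1 : ∀ i : Fin (n + 1), c' i = c i := fun i => dif_pos i.2
    have hLc : L c = ∑ k ∈ Finset.range (n + 1), c' k • η k := by
      rw [Finset.sum_range]
      simp only [L, Fintype.linearCombination_apply, hc'1]
    have hin : ∀ k, ⟪η k, L c⟫_ℂ = c' k := by
      intro k
      rw [hLc]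
      by_cases hk : k ∈ Finset.range (n + 1)
      · exact hη.inner_right_sum c' hk
      · rw [inner_sum, Finset.sum_eq_zero]
        · exact (hc'0 k (by simpa using hk)).symm
        · intro i hi
          rw [inner_smul_right, hη.2 (by rintro rfl; exact hk hi), mul_zero]
    have hTc : T (L c) = ∑ k ∈ Finset.range (n + 1), ((s k : ℂ) * c' k) • e k := by
      refine (hT (L c)).unique ?_
      simp only [hin]
      refine hasSum_sum_of_ne_finset_zero fun k hk => ?_
      rw [hc'0 k (by simpa using hk), mul_zero, zero_smul]
    have hpos : 0 < ‖L c‖ := by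
      refine norm_pos_iff.2 fun h0 => hc0 ?_
      funext i
      have := hin i
      rw [h0, inner_zero_right, hc'1] at this
      exact this.symm
    have hle : s n * ‖L c‖ ≤ ‖T (L c)‖ := by
      refine le_of_sq_le_sq ?_ (norm_nonneg _)
      rw [hTc, hnorm e he, mul_pow, hLc, hnorm η hη, Finset.mul_sum]
      refine Finset.sum_le_sum fun k hk => ?_
      rw [norm_mul, mul_pow, Complex.norm_real, Real.norm_of_nonneg (hs0 k)]
      gcongr
      · exact hs0 n
      · exact hs (Nat.lt_succ_iff.1 (Finset.mem_range.1 hk))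
    have h3 := (T - F.1).le_opNorm (L c)
    rw [sub_apply, hc, sub_zero] at h3
    exact le_of_mul_le_mul_right (hle.trans h3) hpos

/-- The Schatten class `𝒮^p`: bounded operators whose singular values form an `ℓ^p` sequence.
For `p = ∞` these are all bounded operators. -/
noncomputable def schatten (H : Type*) [NormedAddCommGroup H] [InnerProductSpace ℂ H]
    (p : ℝ≥0∞) [Fact (1 ≤ p)] : Submodule ℂ (H →L[ℂ] H) where
  carrier := {T | Memℓp (singularValue T) p}
  zero_mem' := by
    have : singularValue (0 : H →L[ℂ] H) = 0 := funext singularValue_zero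
    simpa [this] using (zero_memℓp : Memℓp (0 : ℕ → ℝ) p)
  add_mem' := by
    intro S T hS hT
    have hp1 : (1 : ℝ≥0∞) ≤ p := Fact.out
    rcases eq_or_ne p ∞ with rfl | hp
    · refine memℓp_infty ⟨‖S + T‖, ?_⟩
      rintro _ ⟨n, rfl⟩
      simpa [abs_of_nonneg (singularValue_nonneg _ _)] using singularValue_le_norm (S + T) n
    · have hp0 : 0 < p.toReal := ENNReal.toReal_pos (by rintro rfl; simp at hp1) hp
      have hs := (hS.add hT).summable hp0
      refine memℓp_gen (Summable.even_add_odd ?_ ?_)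
      all_goals
        refine Summable.of_nonneg_of_le (fun n => by positivity) (fun n => ?_) hs
        refine Real.rpow_le_rpow (norm_nonneg _) ?_ hp0.le
        rw [Real.norm_of_nonneg (singularValue_nonneg _ _)]
        refine le_trans ?_ (Real.le_norm_self _)
        refine le_trans (singularValue_antitone _ (?_ : n + n ≤ _)) (singularValue_add_le S T n n)
        omega
  smul_mem' := by
    intro c T hT
    refine (Memℓp.const_smul hT ‖c‖).mono' fun n => ?_
    rw [Real.norm_of_nonneg (singularValue_nonneg _ _)]
    exact (singularValue_smul_le c T n).trans (Real.le_norm_self _)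

/-- The Schatten norm `‖T‖_{𝒮^p}`: the `ℓ^p` norm of the sequence of singular values. -/
noncomputable def schattenNorm {p : ℝ≥0∞} [Fact (1 ≤ p)] (T : schatten H p) : ℝ :=
  ‖(⟨singularValue T.1, T.2⟩ : lp (fun _ : ℕ => ℝ) p)‖

/-- The trace `∑ ⟨T e_i, e_i⟩` over an orthonormal basis (for trace class `T` the sum converges
absolutely and does not depend on the basis). -/
noncomputable def trace [CompleteSpace H] (T : H →L[ℂ] H) : ℂ :=
  ∑' i, ⟪(exists_hilbertBasis ℂ H).choose_spec.choose i,
    T ((exists_hilbertBasis ℂ H).choose_spec.choose i)⟫_ℂ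

end Schatten

/-! ### Phase space and time-frequency shifts -/

/-- The Hilbert space `L²(ℝ^d)`. -/
abbrev L2 (d : ℕ) : Type := Lp ℂ 2 (volume : Measure (EuclideanSpace ℝ (Fin d)))

/-- Phase space `ℝ^{2d}`, with points `z = (x, ξ)` and Lebesgue measure. -/
abbrev PhaseSpace (d : ℕ) : Type := EuclideanSpace ℝ (Fin d) × EuclideanSpace ℝ (Fin d)

/-- The function `t ↦ e^{-π i x·ξ} e^{2π i ξ·t} f(t - x)`. -/
noncomputable def shiftFun {d : ℕ} (z : PhaseSpace d) (f : EuclideanSpace ℝ (Fin d) → ℂ)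
    (t : EuclideanSpace ℝ (Fin d)) : ℂ :=
  Complex.exp (-(Real.pi * Complex.I * (⟪z.1, z.2⟫_ℝ : ℝ))) *
    Complex.exp (2 * Real.pi * Complex.I * (⟪z.2, t⟫_ℝ : ℝ)) * f (t - z.1)

theorem norm_shiftFun {d : ℕ} (z : PhaseSpace d) (f : EuclideanSpace ℝ (Fin d) → ℂ)
    (t : EuclideanSpace ℝ (Fin d)) : ‖shiftFun z f t‖ = ‖f (t - z.1)‖ := by
  simp [shiftFun, Complex.norm_exp]

theorem memLp_shiftFun {d : ℕ} (z : PhaseSpace d) (f : L2 d) :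
    MemLp (shiftFun z f) 2 (volume : Measure (EuclideanSpace ℝ (Fin d))) := by
  have h := (Lp.memLp f).comp_measurePreserving (measurePreserving_sub_right volume z.1)
  refine h.of_le ?_ (Eventually.of_forall fun t => (norm_shiftFun z f t).le)
  refine AEStronglyMeasurable.mul ?_ h.1
  exact (by fun_prop : Continuous fun t : EuclideanSpace ℝ (Fin d) =>
    Complex.exp (-(Real.pi * Complex.I * (⟪z.1, z.2⟫_ℝ : ℝ))) *
      Complex.exp (2 * Real.pi * Complex.I * (⟪z.2, t⟫_ℝ : ℝ))).aestronglyMeasurable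

/-- The symmetric time-frequency shift
`ρ(x, ξ) f(t) = e^{-π i x·ξ} e^{2π i ξ·t} f(t - x)` as an operator on `L²(ℝ^d)`. -/
noncomputable def rho {d : ℕ} (z : PhaseSpace d) : L2 d →L[ℂ] L2 d :=
  LinearMap.mkContinuous
    { toFun := fun f => (memLp_shiftFun z f).toLp (shiftFun z f)
      map_add' := by
        intro f g
        rw [← MemLp.toLp_add]
        refine MemLp.toLp_congr _ _ ?_
        filter_upwards [(measurePreserving_sub_right volume z.1).quasiMeasurePreserving.ae
          (Lp.coeFn_add f g)] with t ht
        simp only [shiftFun, Pi.add_apply] at ht ⊢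
        rw [ht, mul_add]
      map_smul' := by
        intro c f
        rw [RingHom.id_apply, ← MemLp.toLp_const_smul]
        refine MemLp.toLp_congr _ _ ?_
        filter_upwards [(measurePreserving_sub_right volume z.1).quasiMeasurePreserving.ae
          (Lp.coeFn_smul c f)] with t ht
        simp only [shiftFun, Pi.smul_apply, smul_eq_mul] at ht ⊢
        rw [ht]
        ring }
    1
    (by
      intro f
      have h := (Lp.memLp f).comp_measurePreserving (measurePreserving_sub_right volume z.1)
      have h' : eLpNorm (shiftFun z f) 2 volume = eLpNorm f 2 volume := by
        rw [← eLpNorm_comp_measurePreserving (Lp.memLp f).1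
          (measurePreserving_sub_right volume z.1)]
        exact eLpNorm_congr_norm_ae (Eventually.of_forall fun t => norm_shiftFun z f t)
      rw [one_mul, Lp.norm_def f, ← h']
      exact (Lp.norm_toLp _ (memLp_shiftFun z f)).le)

/-- The Fourier–Wigner transform `𝓕_W(T)(z) = tr(T ρ(-z))` of a trace class operator. -/
noncomputable def fourierWigner {d : ℕ} (T : L2 d →L[ℂ] L2 d) (z : PhaseSpace d) : ℂ :=
  trace (T ∘L rho (-z))

/-- `B = ∫ F(z) ρ(z) dz` as a weak integral: for all `f, g`, the function `F(z) ⟨ρ(z) f, g⟩` is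
integrable with integral `⟨B f, g⟩`. (Mathlib's inner product is linear in the second entry.) -/
def IsWeakIntegral {d : ℕ} (F : PhaseSpace d → ℂ) (B : L2 d →L[ℂ] L2 d) : Prop :=
  ∀ f g : L2 d, Integrable (fun z => F z * ⟪g, rho z f⟫_ℂ) ∧
    ∫ z, F z * ⟪g, rho z f⟫_ℂ = ⟪g, B f⟫_ℂ

/-! ### The algebra of functions on phase space, modulo null sets -/

/-- Classes of measurable functions on phase space with pointwise operations. -/
abbrev Symbols (d : ℕ) : Type := PhaseSpace d →ₘ[(volume : Measure (PhaseSpace d))] ℂ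

noncomputable instance (d : ℕ) : CommRing (Symbols d) :=
  { (inferInstance : AddCommGroup (Symbols d)), (inferInstance : CommMonoid (Symbols d)) with
    left_distrib := fun a b c => by
      refine AEEqFun.induction_on₃ a b c fun f _ g _ h _ => ?_
      simp only [AEEqFun.mk_add_mk, AEEqFun.mk_mul_mk, mul_add]
    right_distrib := fun a b c => by
      refine AEEqFun.induction_on₃ a b c fun f _ g _ h _ => ?_
      simp only [AEEqFun.mk_add_mk, AEEqFun.mk_mul_mk, add_mul]
    zero_mul := fun a => by
      refine AEEqFun.induction_on a fun f _ => ?_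
      simp only [AEEqFun.zero_def, AEEqFun.mk_mul_mk]
      congr 1; funext x; simp
    mul_zero := fun a => by
      refine AEEqFun.induction_on a fun f _ => ?_
      simp only [AEEqFun.zero_def, AEEqFun.mk_mul_mk]
      congr 1; funext x; simp }

noncomputable instance (d : ℕ) : Algebra ℂ (Symbols d) :=
  Algebra.ofModule
    (fun c a b => by
      refine AEEqFun.induction_on₂ a b fun f _ g _ => ?_
      simp only [AEEqFun.smul_mk, AEEqFun.mk_mul_mk, smul_mul_assoc])
    (fun c a b => by
      refine AEEqFun.induction_on₂ a b fun f _ g _ => ?_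
      simp only [AEEqFun.smul_mk, AEEqFun.mk_mul_mk, mul_smul_comm])

/-! ### Fourier–Wigner multipliers -/

section Multiplier

variable {d : ℕ} {p : ℝ≥0∞} [Fact (1 ≤ p)]

/-- The linear map `A` on `𝒮^p` extends `𝔗_m : T ↦ ∫ m(z) 𝓕_W(T)(z) ρ(z) dz`, which is defined on
trace class operators. -/
def ExtendsMultiplier (m : Symbols d) (A : schatten (L2 d) p →ₗ[ℂ] schatten (L2 d) p) : Prop :=
  ∀ T : schatten (L2 d) p, (T : L2 d →L[ℂ] L2 d) ∈ schatten (L2 d) 1 →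
    IsWeakIntegral (fun z => m z * fourierWigner (T : L2 d →L[ℂ] L2 d) z) (A T)

/-- `A` is bounded on `𝒮^p` by the constant `C`. -/
def IsSchattenBound (A : schatten (L2 d) p →ₗ[ℂ] schatten (L2 d) p) (C : ℝ) : Prop :=
  0 ≤ C ∧ ∀ T, schattenNorm (A T) ≤ C * schattenNorm T

variable (p) in
/-- Membership in `𝔐_p`: `m ∈ L^∞` and `𝔗_m` extends to a bounded linear operator on `𝒮^p`. -/
def IsMultiplier (m : Symbols d) : Prop :=
  m ∈ Lp ℂ ∞ (volume : Measure (PhaseSpace d)) ∧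
    ∃ A : schatten (L2 d) p →ₗ[ℂ] schatten (L2 d) p,
      ExtendsMultiplier m A ∧ ∃ C, IsSchattenBound A C

variable (p) in
/-- The multiplier norm `‖m‖_{𝔐_p} = ‖𝔗_m‖_{𝒮^p → 𝒮^p}`: the infimum of the bounds of bounded
extensions of `𝔗_m` to `𝒮^p`. For `p < ∞` trace class operators are dense in `𝒮^p`, so that there
is only one bounded extension and this is its operator norm. -/
noncomputable def multiplierNorm (m : Symbols d) : ℝ :=
  sInf {C | ∃ A : schatten (L2 d) p →ₗ[ℂ] schatten (L2 d) p,
    ExtendsMultiplier m A ∧ IsSchattenBound A C}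

end Multiplier

/-- `N` is a complete submultiplicative norm on the unital algebra `𝓐`, i.e. `(𝓐, N)` is a (unital)
Banach algebra. -/
structure IsBanachAlgebraNorm {𝓐 : Type*} [Ring 𝓐] [Algebra ℂ 𝓐] (N : 𝓐 → ℝ) : Prop where
  nonneg : ∀ a, 0 ≤ N a
  eq_zero_iff : ∀ a, N a = 0 ↔ a = 0
  smul : ∀ (c : ℂ) (a : 𝓐), N (c • a) = ‖c‖ * N a
  add_le : ∀ a b, N (a + b) ≤ N a + N b
  mul_le : ∀ a b, N (a * b) ≤ N a * N b
  one : N 1 = 1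
  complete : ∀ u : ℕ → 𝓐, (∀ ε > 0, ∃ n₀, ∀ j ≥ n₀, ∀ k ≥ n₀, N (u j - u k) < ε) →
    ∃ a, Tendsto (fun j => N (u j - a)) atTop (𝓝 0)

end FourierWigner

open FourierWigner

/-! Everything is transported to `L²` of phase space. The Fourier–Wigner transform of the rank one
operator `rankOne ℂ e η` is the conjugate of the ambiguity function `ambig η e`. Moyal's identity
(`inner_ambigLp`) and the totality of ambiguity functions (`eq_zero_of_forall_inner_ambigLp`) turn
`L²` functions `Ψ` into operators `S` through `⟪g, S f⟫ = ⟪Ψ, ambigLp f g⟫`, and there `𝔗_m` becomes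
multiplication by the conjugate of `m`. By `extendsMultiplier_iff` a bounded map extends `𝔗_m` as
soon as it does so on rank one operators, because singular value decompositions converge.

Multiplication operators compose, but `A₂ (rankOneS p e η)` need not be trace class, so the
hypothesis on `A₁` does not apply to it directly. It is represented by an `L²` function and hence
compact. The partial sums of its singular value decomposition converge in `𝒮^p`, their `L²`
functions converge weakly, and this identifies the composite (`ExtendsMultiplier.comp`).

Composition also yields `|m| ≤ C` almost everywhere for every bound `C` of an extension
(`ExtendsMultiplier.ae_norm_le`). Conjugation by `T ↦ P T* P` shows that the conjugate of `m` has
the same bound, so `|m|^(2n)` is a multiplier with bound `C^(2n)`; testing it on rank one operators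
and letting `n → ∞` gives the claim. Definiteness, `‖1‖ = 1` and the pointwise limit needed for
completeness follow.

For `p = ∞` finite rank operators are not dense and extensions need not be unique. The coefficients
of any bounded extension on rank one operators come from trace class operators
(`exists_normalFunctional`), so there is a normal extension with no larger bound, and it is unique.
Choosing it makes the infimum in the norm a minimum and the assignment `m ↦ Φ m` multiplicative. -/

namespace FourierWigner

open InnerProductSpace (rankOne)

/-! ### Singular value decomposition of compact operators by deflation -/

section SingularValueDecomposition

variable {H : Type*} [NormedAddCommGroup H] [InnerProductSpace ℂ H]

theorem singularValue_index_zero (T : H →L[ℂ] H) : singularValue T 0 = ‖T‖ := by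
  refine le_antisymm (singularValue_le_norm T 0) (le_ciInf fun F => ?_)
  have h' : F.1 = 0 := by
    ext x
    have h : Module.rank ℂ (LinearMap.range (F.1 : H →ₗ[ℂ] H)) = 0 :=
      nonpos_iff_eq_zero.1 (F.2.trans_eq Nat.cast_zero)
    have h2 := rank_zero_iff_forall_zero.1 h ⟨F.1 x, LinearMap.mem_range_self (F.1 : H →ₗ[ℂ] H) x⟩
    exact congrArg Subtype.val h2
  simp [h']

/-- Weyl's inequality with index `0` for the difference: singular values are 1-Lipschitz in the
operator norm. -/
theorem singularValue_le_add_norm_sub (S T : H →L[ℂ] H) (n : ℕ) :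
    singularValue S n ≤ singularValue T n + ‖S - T‖ := by
  have h := singularValue_add_le T (S - T) n 0
  rwa [add_sub_cancel, add_zero, singularValue_index_zero] at h

theorem rank_sum_rankOne_le (e η : ℕ → H) (J : Finset ℕ) :
    ((∑ k ∈ J, rankOne ℂ (e k) (η k) : H →L[ℂ] H) : H →ₗ[ℂ] H).rank ≤ (J.card : Cardinal) := by
  classical
  have hle : LinearMap.range ((∑ k ∈ J, rankOne ℂ (e k) (η k) : H →L[ℂ] H) : H →ₗ[ℂ] H) ≤
      Submodule.span ℂ ((J.image e : Finset H) : Set H) := by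
    rintro _ ⟨f, rfl⟩
    rw [ContinuousLinearMap.coe_coe, sum_apply]
    refine Submodule.sum_mem _ fun k hk => Submodule.smul_mem _ _ (Submodule.subset_span ?_)
    exact Finset.mem_coe.2 (Finset.mem_image_of_mem e hk)
  refine (Submodule.rank_mono hle).trans ((rank_span_finset_le _).trans ?_)
  exact_mod_cast Finset.card_image_le

theorem isCompactOperator_of_finiteDimensional_range {F : H →L[ℂ] H}
    (hF : (F : H →ₗ[ℂ] H).rank < Cardinal.aleph0) : IsCompactOperator F := by
  have : FiniteDimensional ℂ (LinearMap.range (F : H →ₗ[ℂ] H)) :=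
    Module.rank_lt_aleph0_iff.1 hF
  let G : H →L[ℂ] LinearMap.range (F : H →ₗ[ℂ] H) :=
    F.codRestrict _ fun x => LinearMap.mem_range_self _ x
  have hG : IsCompactOperator G := by
    have := FiniteDimensional.proper ℂ (LinearMap.range (F : H →ₗ[ℂ] H))
    exact isCompactOperator_of_locallyCompactSpace_dom G
  exact hG.clm_comp (LinearMap.range (F : H →ₗ[ℂ] H)).subtypeL

theorem isCompactOperator_rankOne (e η : H) : IsCompactOperator (rankOne ℂ e η : H →L[ℂ] H) := by
  refine isCompactOperator_of_finiteDimensional_range ?_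
  have := rank_sum_rankOne_le (fun _ => e) (fun _ => η) {0}
  simp only [Finset.sum_singleton, Finset.card_singleton] at this
  exact this.trans_lt (Cardinal.natCast_lt_aleph0)

/-- The relation `hv` describes an orthonormal family set to zero where `s` vanishes. With it one
`ℕ`-indexed family also serves operators of finite rank. -/
theorem sum_inner_of_inner_eq {s : ℕ → ℝ} {v : ℕ → H}
    (hv : ∀ k l, ⟪v k, v l⟫_ℂ = if k = l ∧ s k ≠ 0 then 1 else 0) (J : Finset ℕ)
    (hJ : ∀ k ∈ J, s k ≠ 0) (c : ℕ → ℂ) :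
    ‖∑ k ∈ J, c k • v k‖ ^ 2 = ∑ k ∈ J, ‖c k‖ ^ 2 := by
  have h2 : ((‖∑ k ∈ J, c k • v k‖ ^ 2 : ℝ) : ℂ) = ((∑ k ∈ J, ‖c k‖ ^ 2 : ℝ) : ℂ) := by
    push_cast
    have := inner_self_eq_norm_sq_to_K (𝕜 := ℂ) (∑ k ∈ J, c k • v k)
    refine Eq.trans this.symm ?_
    rw [sum_inner]
    refine Finset.sum_congr rfl fun k hk => ?_
    rw [inner_sum, Finset.sum_eq_single k]
    · rw [inner_smul_left, inner_smul_right, hv, if_pos ⟨rfl, hJ k hk⟩, mul_one, mul_comm,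
        Complex.mul_conj']
    · intro l _ hl
      rw [inner_smul_left, inner_smul_right, hv, if_neg (fun h => hl h.1.symm), mul_zero, mul_zero]
    · exact fun h => absurd hk h
  exact_mod_cast h2

theorem norm_eq_one_of_inner_self {x : H} (h : ⟪x, x⟫_ℂ = 1) : ‖x‖ = 1 := by
  have h2 : ‖x‖ ^ 2 = 1 := by rw [@norm_sq_eq_re_inner ℂ, h]; simp
  exact (pow_eq_one_iff_of_nonneg (norm_nonneg _) two_ne_zero).1 h2

variable [CompleteSpace H]

theorem isCompactOperator_of_tendsto_singularValue {T : H →L[ℂ] H}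
    (hT : Tendsto (singularValue T) atTop (𝓝 0)) : IsCompactOperator T := by
  have hF : ∀ n : ℕ, ∃ F : H →L[ℂ] H, IsCompactOperator F ∧
      ‖T - F‖ < singularValue T n + 1 / ((n : ℝ) + 1) := by
    intro n
    obtain ⟨F, hF⟩ := exists_lt_of_ciInf_lt
      (show singularValue T n < singularValue T n + 1 / ((n : ℝ) + 1) from
        lt_add_of_pos_right _ (by positivity))
    exact ⟨F.1, isCompactOperator_of_finiteDimensional_range
      (F.2.trans_lt Cardinal.natCast_lt_aleph0), hF⟩
  choose F hFc hFn using hF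
  refine isCompactOperator_of_tendsto (l := atTop) (F := F) ?_ (Eventually.of_forall hFc)
  rw [tendsto_iff_norm_sub_tendsto_zero]
  refine squeeze_zero (fun _ => norm_nonneg _) (fun n => ?_)
    (by simpa only [add_zero] using
      hT.add (tendsto_one_div_add_atTop_nhds_zero_nat (𝕜 := ℝ)))
  rw [norm_sub_rev]
  exact (hFn n).le

/-- A nonzero compact operator attains its norm, at an eigenvector of `T† T`. -/
theorem exists_norm_attained {T : H →L[ℂ] H} (hT : IsCompactOperator T) (h0 : T ≠ 0) :
    ∃ v : H, ‖v‖ = 1 ∧ ContinuousLinearMap.adjoint T (T v) = ((‖T‖ ^ 2 : ℝ) : ℂ) • v := by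
  have : Nontrivial H := by
    by_contra h
    rw [not_nontrivial_iff_subsingleton] at h
    exact h0 (by ext x; exact Subsingleton.elim _ _)
  set S : H →L[ℂ] H := ContinuousLinearMap.adjoint T ∘L T with hS
  have hSc : IsCompactOperator S := hT.clm_comp (ContinuousLinearMap.adjoint T)
  have hSn : ‖S‖ = ‖T‖ ^ 2 := by
    rw [hS, ContinuousLinearMap.norm_adjoint_comp_self, sq]
  have hSpos : 0 < ‖S‖ := by rw [hSn]; exact pow_pos (norm_pos_iff.2 h0) 2
  have hSsa : IsSelfAdjoint S := by
    rw [hS]; exact IsSelfAdjoint.star_mul_self T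
  -- The self-adjoint `S = T† T` has a spectral value of modulus `‖S‖ = ‖T‖²`; it is nonzero, hence
  -- an eigenvalue by compactness.
  obtain ⟨μ, hμ, hμr⟩ := spectrum.exists_nnnorm_eq_spectralRadius S
  rw [S.spectralRadius_eq_nnnorm hSsa, ENNReal.coe_inj] at hμr
  have hμn : ‖μ‖ = ‖S‖ := congrArg NNReal.toReal hμr
  have hμ0 : μ ≠ 0 := by
    rw [← norm_pos_iff, hμn]; exact hSpos
  have hev := (hSc.hasEigenvalue_iff_mem_spectrum hμ0).2 hμ
  obtain ⟨w, hw⟩ := hev.exists_hasEigenvector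
  have hSw : S w = μ • w := hw.apply_eq_smul
  have hw0 : ‖w‖ ≠ 0 := norm_ne_zero_iff.2 hw.2
  -- Pairing with `w` shows that `μ` equals `‖T w‖² / ‖w‖²`, so it is nonnegative and equals its
  -- modulus.
  have hμpos : μ = ((‖T‖ ^ 2 : ℝ) : ℂ) := by
    have h1 : ⟪w, S w⟫_ℂ = ((‖T w‖ ^ 2 : ℝ) : ℂ) := by
      rw [hS, ContinuousLinearMap.comp_apply, ContinuousLinearMap.adjoint_inner_right,
        inner_self_eq_norm_sq_to_K]
      push_cast; rfl
    rw [hSw, inner_smul_right, inner_self_eq_norm_sq_to_K] at h1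
    have h2 : μ = ((‖T w‖ ^ 2 / ‖w‖ ^ 2 : ℝ) : ℂ) := by
      push_cast
      push_cast at h1
      rw [eq_div_iff (by exact_mod_cast pow_ne_zero 2 hw0)]
      exact h1
    have h3 : ‖μ‖ = ‖T w‖ ^ 2 / ‖w‖ ^ 2 := by
      rw [h2, Complex.norm_real, Real.norm_of_nonneg (by positivity)]
    rw [h2, ← h3, hμn, hSn]
  refine ⟨((‖w‖⁻¹ : ℝ) : ℂ) • w, ?_, ?_⟩
  · rw [norm_smul, Complex.norm_real, norm_inv, norm_norm, inv_mul_cancel₀ hw0]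
  · rw [map_smul, map_smul, ← hμpos, smul_comm, ← hSw]
    rfl

open Classical in
/-- A right singular vector for the largest singular value of `T` (zero for `T = 0`). -/
noncomputable def topVec (T : H →L[ℂ] H) : H :=
  if h : T ≠ 0 ∧ ∃ v : H, ‖v‖ = 1 ∧ ContinuousLinearMap.adjoint T (T v) = ((‖T‖ ^ 2 : ℝ) : ℂ) • v
  then h.2.choose else 0

theorem norm_topVec {T : H →L[ℂ] H} (hT : IsCompactOperator T) (h0 : T ≠ 0) : ‖topVec T‖ = 1 := by
  have h : T ≠ 0 ∧ ∃ v : H, ‖v‖ = 1 ∧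
      ContinuousLinearMap.adjoint T (T v) = ((‖T‖ ^ 2 : ℝ) : ℂ) • v :=
    ⟨h0, exists_norm_attained hT h0⟩
  rw [topVec, dif_pos h]
  exact h.2.choose_spec.1

/-- The default value `0` makes the eigenvector equation hold for every `T`, so `inner_apply_topVec`
needs no hypothesis. -/
theorem adjoint_apply_topVec (T : H →L[ℂ] H) :
    ContinuousLinearMap.adjoint T (T (topVec T)) = ((‖T‖ ^ 2 : ℝ) : ℂ) • topVec T := by
  by_cases h : T ≠ 0 ∧ ∃ v : H, ‖v‖ = 1 ∧
      ContinuousLinearMap.adjoint T (T v) = ((‖T‖ ^ 2 : ℝ) : ℂ) • v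
  · rw [topVec, dif_pos h]
    exact h.2.choose_spec.2
  · rw [topVec, dif_neg h]
    simp

theorem topVec_zero : topVec (0 : H →L[ℂ] H) = 0 := by
  rw [topVec, dif_neg (by simp)]

theorem inner_apply_topVec (T : H →L[ℂ] H) (x : H) :
    ⟪T (topVec T), T x⟫_ℂ = ((‖T‖ ^ 2 : ℝ) : ℂ) * ⟪topVec T, x⟫_ℂ := by
  rw [← ContinuousLinearMap.adjoint_inner_left, adjoint_apply_topVec, inner_smul_left,
    Complex.conj_ofReal]

/-- Subtraction of the leading term of the singular value decomposition. -/
noncomputable def deflate (T : H →L[ℂ] H) : H →L[ℂ] H :=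
  T - rankOne ℂ (T (topVec T)) (topVec T)

theorem deflate_apply (T : H →L[ℂ] H) (x : H) :
    deflate T x = T (x - ⟪topVec T, x⟫_ℂ • topVec T) := by
  simp [deflate]

/-- `deflate T` is `T` preceded by the orthogonal projection away from `topVec T`, a contraction by
Pythagoras. -/
theorem norm_deflate_le {T : H →L[ℂ] H} (hT : IsCompactOperator T) : ‖deflate T‖ ≤ ‖T‖ := by
  refine ContinuousLinearMap.opNorm_le_bound _ (norm_nonneg _) fun x => ?_
  rw [deflate_apply]
  refine (T.le_opNorm _).trans (mul_le_mul_of_nonneg_left ?_ (norm_nonneg _))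
  by_cases h0 : T = 0
  · simp [h0, topVec_zero]
  refine le_of_sq_le_sq ?_ (norm_nonneg x)
  have h1 : ⟪topVec T, x - ⟪topVec T, x⟫_ℂ • topVec T⟫_ℂ = 0 := by
    rw [inner_sub_right, inner_smul_right, inner_self_eq_norm_sq_to_K, norm_topVec hT h0]
    simp
  have h2 := norm_add_sq (𝕜 := ℂ) (x - ⟪topVec T, x⟫_ℂ • topVec T) (⟪topVec T, x⟫_ℂ • topVec T)
  rw [sub_add_cancel, inner_smul_right, inner_eq_zero_symm.1 h1, mul_zero, map_zero, mul_zero,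
    add_zero] at h2
  rw [h2]
  exact le_add_of_nonneg_right (by positivity)

/-- The remainder after `n` terms of the singular value decomposition. -/
noncomputable def remainder (T : H →L[ℂ] H) (n : ℕ) : H →L[ℂ] H := deflate^[n] T

theorem remainder_zero (T : H →L[ℂ] H) : remainder T 0 = T := rfl

theorem remainder_succ (T : H →L[ℂ] H) (n : ℕ) :
    remainder T (n + 1) = deflate (remainder T n) :=
  Function.iterate_succ_apply' _ _ _

theorem isCompactOperator_remainder {T : H →L[ℂ] H} (hT : IsCompactOperator T) (n : ℕ) :
    IsCompactOperator (remainder T n) := by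
  induction n with
  | zero => exact hT
  | succ n ih =>
    rw [remainder_succ]
    exact ih.sub (isCompactOperator_rankOne _ _)

theorem antitone_norm_remainder {T : H →L[ℂ] H} (hT : IsCompactOperator T) :
    Antitone fun n => ‖remainder T n‖ := by
  refine antitone_nat_of_succ_le fun n => ?_
  rw [remainder_succ]
  exact norm_deflate_le (isCompactOperator_remainder hT n)

theorem remainder_sub (T : H →L[ℂ] H) (m n : ℕ) :
    remainder T m - remainder T (m + n) = ∑ k ∈ Finset.range n,
      rankOne ℂ (remainder T (m + k) (topVec (remainder T (m + k))))
        (topVec (remainder T (m + k))) := by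
  induction n with
  | zero => simp
  | succ n ih =>
    rw [Finset.sum_range_succ, ← ih, ← add_assoc, remainder_succ, deflate]
    abel

theorem rank_remainder_sub_le (T : H →L[ℂ] H) (m n : ℕ) :
    ((remainder T m - remainder T (m + n) : H →L[ℂ] H) : H →ₗ[ℂ] H).rank ≤ (n : Cardinal) := by
  rw [remainder_sub]
  exact (rank_sum_rankOne_le _ _ _).trans (by simp)

/-- The `n` terms between the two remainders form an operator of rank at most `n`, which competes in
the infimum. -/
theorem singularValue_remainder_le (T : H →L[ℂ] H) (m n : ℕ) :
    singularValue (remainder T m) n ≤ ‖remainder T (m + n)‖ := by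
  have h := singularValue_le (T := remainder T m) (rank_remainder_sub_le T m n)
  rwa [sub_sub_cancel] at h

/-- Induction on `n`, with `R` the `n`-th remainder and `v` its top vector. Once `R` kills an
earlier vector `w`, the identity `⟪R v, R w⟫ = ‖R‖² ⟪v, w⟫` gives `v ⊥ w`, so the next deflation
leaves the value at `w` unchanged. -/
theorem remainder_apply_topVec {T : H →L[ℂ] H} (hT : IsCompactOperator T) {k n : ℕ} (hkn : k < n) :
    remainder T n (topVec (remainder T k)) = 0 := by
  induction n with
  | zero => omega
  | succ n ih =>
    rw [remainder_succ]
    by_cases h0 : remainder T n = 0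
    · simp [deflate_apply, h0]
    rcases (Nat.lt_succ_iff_lt_or_eq.1 hkn) with h | rfl
    · have h1 := inner_apply_topVec (remainder T n) (topVec (remainder T k))
      rw [ih h, inner_zero_right, zero_eq_mul] at h1
      rcases h1 with h1 | h1
      · exact absurd (by exact_mod_cast h1) (pow_ne_zero 2 (norm_ne_zero_iff.2 h0))
      · rw [deflate_apply, h1, zero_smul, sub_zero, ih h]
    · rw [deflate_apply, inner_self_eq_norm_sq_to_K,
        norm_topVec (isCompactOperator_remainder hT k) h0]
      simp

theorem inner_topVec_remainder {T : H →L[ℂ] H} (hT : IsCompactOperator T) {k n : ℕ}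
    (hkn : k < n) : ⟪topVec (remainder T n), topVec (remainder T k)⟫_ℂ = 0 := by
  by_cases h0 : remainder T n = 0
  · rw [h0, topVec_zero, inner_zero_left]
  have h1 := inner_apply_topVec (remainder T n) (topVec (remainder T k))
  rw [remainder_apply_topVec hT hkn, inner_zero_right, zero_eq_mul] at h1
  rcases h1 with h1 | h1
  · exact absurd (by exact_mod_cast h1) (pow_ne_zero 2 (norm_ne_zero_iff.2 h0))
  · exact h1

/-- For `R` with top vector `v`, `⟪R v, R (x - ⟪v, x⟫ v)⟫ = ‖R‖² (⟪v, x⟫ - ⟪v, x⟫ ‖v‖²) = 0`. Later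
remainders only change the argument of `R`, so orthogonality persists. -/
theorem inner_remainder_apply {T : H →L[ℂ] H} (hT : IsCompactOperator T) {k n : ℕ} (hkn : k < n)
    (x : H) : ⟪remainder T k (topVec (remainder T k)), remainder T n x⟫_ℂ = 0 := by
  induction n generalizing x with
  | zero => omega
  | succ n ih =>
    rw [remainder_succ, deflate_apply]
    rcases (Nat.lt_succ_iff_lt_or_eq.1 hkn) with h | rfl
    · exact ih h _
    · rw [inner_apply_topVec, inner_sub_right, inner_smul_right, inner_self_eq_norm_sq_to_K]
      by_cases h0 : remainder T k = 0
      · simp [h0]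
      · rw [norm_topVec (isCompactOperator_remainder hT k) h0]
        simp

/-- The left singular vectors. -/
noncomputable def leftVec (T : H →L[ℂ] H) (n : ℕ) : H :=
  ((‖remainder T n‖⁻¹ : ℝ) : ℂ) • remainder T n (topVec (remainder T n))

theorem norm_smul_leftVec (T : H →L[ℂ] H) (n : ℕ) :
    (‖remainder T n‖ : ℂ) • leftVec T n = remainder T n (topVec (remainder T n)) := by
  by_cases h0 : remainder T n = 0
  · simp [h0]
  · rw [leftVec, smul_smul, ← Complex.ofReal_mul, mul_inv_cancel₀ (norm_ne_zero_iff.2 h0)]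
    simp

theorem inner_leftVec {T : H →L[ℂ] H} (hT : IsCompactOperator T) (k l : ℕ) :
    ⟪leftVec T k, leftVec T l⟫_ℂ = if k = l ∧ ‖remainder T k‖ ≠ 0 then 1 else 0 := by
  have hlt : ∀ k l, k < l → ⟪leftVec T k, leftVec T l⟫_ℂ = 0 := by
    intro k l h
    rw [leftVec, leftVec, inner_smul_left, inner_smul_right, inner_remainder_apply hT h]
    simp
  rcases lt_trichotomy k l with h | rfl | h
  · rw [hlt k l h, if_neg (by omega)]
  · by_cases h0 : remainder T k = 0
    · simp [leftVec, h0]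
    · rw [if_pos ⟨rfl, norm_ne_zero_iff.2 h0⟩, leftVec, inner_smul_left, inner_smul_right,
        inner_apply_topVec, inner_self_eq_norm_sq_to_K,
        norm_topVec (isCompactOperator_remainder hT k) h0]
      have : (‖remainder T k‖ : ℂ) ≠ 0 := by exact_mod_cast norm_ne_zero_iff.2 h0
      simp
      field_simp
  · rw [← inner_conj_symm, hlt l k h, if_neg (by omega), map_zero]

theorem inner_topVec {T : H →L[ℂ] H} (hT : IsCompactOperator T) (k l : ℕ) :
    ⟪topVec (remainder T k), topVec (remainder T l)⟫_ℂ =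
      if k = l ∧ ‖remainder T k‖ ≠ 0 then 1 else 0 := by
  rcases lt_trichotomy k l with h | rfl | h
  · rw [← inner_conj_symm, inner_topVec_remainder hT h, if_neg (by omega), map_zero]
  · by_cases h0 : remainder T k = 0
    · simp [topVec_zero, h0]
    · rw [if_pos ⟨rfl, norm_ne_zero_iff.2 h0⟩, inner_self_eq_norm_sq_to_K,
        norm_topVec (isCompactOperator_remainder hT k) h0]
      simp
  · rw [inner_topVec_remainder hT h, if_neg (by omega)]

/-- The terms split off before stage `k` vanish on this vector, so `T` agrees there with the `k`-th
remainder. -/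
theorem apply_topVec_remainder {T : H →L[ℂ] H} (hT : IsCompactOperator T) (k : ℕ) :
    T (topVec (remainder T k)) = (‖remainder T k‖ : ℂ) • leftVec T k := by
  have h := remainder_sub T 0 k
  rw [remainder_zero, zero_add] at h
  have h2 := DFunLike.congr_fun h (topVec (remainder T k))
  rw [sub_apply, sum_apply, Finset.sum_eq_zero] at h2
  · rw [norm_smul_leftVec, ← sub_eq_zero, h2]
  · intro j hj
    rw [zero_add, InnerProductSpace.rankOne_apply, inner_topVec hT,
      if_neg (by simp at hj; omega), zero_smul]

/-- The lower bound is the min-max argument: an operator of rank at most `n` kills a nonzero vector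
in the span of the first `n + 1` right vectors, and on that span `T` stretches lengths by at least
the `n`-th remainder norm. -/
theorem singularValue_eq_norm_remainder {T : H →L[ℂ] H} (hT : IsCompactOperator T) (n : ℕ) :
    singularValue T n = ‖remainder T n‖ := by
  refine le_antisymm (by simpa [remainder_zero] using singularValue_remainder_le T 0 n) (le_ciInf fun F => ?_)
  set s : ℕ → ℝ := fun k => ‖remainder T k‖ with hs
  set η : ℕ → H := fun k => topVec (remainder T k) with hη
  -- If `s n ≠ 0`, monotonicity makes `s 0, …, s n` nonzero, so that the vectors in use are
  -- genuinely orthonormal.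
  by_cases hsn : s n = 0
  · exact hsn.le.trans (norm_nonneg _)
  have hpos : ∀ k ∈ Finset.range (n + 1), s k ≠ 0 := by
    intro k hk h
    have h1 := antitone_norm_remainder hT (Nat.lt_succ_iff.1 (Finset.mem_range.1 hk))
    refine hsn (le_antisymm (h1.trans h.le) (norm_nonneg _))
  let L : (Fin (n + 1) → ℂ) →ₗ[ℂ] H := Fintype.linearCombination ℂ (fun i : Fin (n + 1) => η i)
  have hnot : ¬ Function.Injective (((F.1 : H →ₗ[ℂ] H).comp L).rangeRestrict) := by
    intro hinj
    have h1 := LinearMap.lift_rank_le_of_injective _ hinj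
    have h2 : ((F.1 : H →ₗ[ℂ] H).comp L).rank ≤ (n : Cardinal) :=
      (LinearMap.rank_comp_le_left _ _).trans F.2
    have h3 := h1.trans (Cardinal.lift_le.2 h2)
    rw [rank_fin_fun, Cardinal.lift_natCast, Cardinal.lift_natCast] at h3
    exact absurd (Nat.cast_le.1 h3) (by omega)
  obtain ⟨c, hc, hc0⟩ : ∃ c, F.1 (L c) = 0 ∧ c ≠ 0 := by
    rw [LinearMap.injective_rangeRestrict_iff, ← LinearMap.ker_eq_bot,
      Submodule.eq_bot_iff] at hnot
    push Not at hnot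
    simpa using hnot
  let c' : ℕ → ℂ := fun k => if h : k < n + 1 then c ⟨k, h⟩ else 0
  have hc'1 : ∀ i : Fin (n + 1), c' i = c i := fun i => dif_pos i.2
  have hLc : L c = ∑ k ∈ Finset.range (n + 1), c' k • η k := by
    rw [Finset.sum_range]
    simp only [L, Fintype.linearCombination_apply, hc'1]
  have hTc : T (L c) = ∑ k ∈ Finset.range (n + 1), (c' k * (s k : ℂ)) • leftVec T k := by
    rw [hLc, map_sum]
    refine Finset.sum_congr rfl fun k _ => ?_
    rw [map_smul, apply_topVec_remainder hT, smul_smul]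
  have hLcn : ‖L c‖ ^ 2 = ∑ k ∈ Finset.range (n + 1), ‖c' k‖ ^ 2 := by
    rw [hLc]
    exact sum_inner_of_inner_eq (s := s) (inner_topVec hT) _ hpos c'
  have hLpos : 0 < ‖L c‖ := by
    refine lt_of_le_of_ne (norm_nonneg _) fun h0 => hc0 ?_
    rw [← h0, zero_pow two_ne_zero, eq_comm,
      Finset.sum_eq_zero_iff_of_nonneg (fun _ _ => by positivity)] at hLcn
    funext i
    have := hLcn i (Finset.mem_range.2 i.2)
    rw [hc'1] at this
    simpa using this
  have hle : s n * ‖L c‖ ≤ ‖T (L c)‖ := by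
    refine le_of_sq_le_sq ?_ (norm_nonneg _)
    rw [hTc, sum_inner_of_inner_eq (s := s) (inner_leftVec hT) _ hpos, mul_pow, hLcn,
      Finset.mul_sum]
    refine Finset.sum_le_sum fun k hk => ?_
    rw [norm_mul, mul_pow, Complex.norm_real, norm_norm, mul_comm]
    gcongr
    exact antitone_norm_remainder hT (Nat.lt_succ_iff.1 (Finset.mem_range.1 hk))
  have h3 := (T - F.1).le_opNorm (L c)
  rw [sub_apply, hc, sub_zero] at h3
  exact le_of_mul_le_mul_right (hle.trans h3) hLpos

/-- Singular value decomposition of a compact operator. Vectors for vanishing singular values are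
zero. -/
theorem exists_svd {T : H →L[ℂ] H} (hT : IsCompactOperator T) : ∃ e η : ℕ → H,
    (∀ k l, ⟪e k, e l⟫_ℂ = if k = l ∧ singularValue T k ≠ 0 then 1 else 0) ∧
    (∀ k l, ⟪η k, η l⟫_ℂ = if k = l ∧ singularValue T k ≠ 0 then 1 else 0) ∧
    (∀ k, T (η k) = (singularValue T k : ℂ) • e k) ∧
    ∀ N m, singularValue
      (T - ∑ k ∈ Finset.range N, (singularValue T k : ℂ) • rankOne ℂ (e k) (η k)) m ≤
        singularValue T (N + m) := by
  refine ⟨leftVec T, fun k => topVec (remainder T k), ?_, ?_, ?_, ?_⟩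
  · simpa only [singularValue_eq_norm_remainder hT] using inner_leftVec hT
  · simpa only [singularValue_eq_norm_remainder hT] using inner_topVec hT
  · simpa only [singularValue_eq_norm_remainder hT] using apply_topVec_remainder hT
  · intro N m
    have h : T - ∑ k ∈ Finset.range N, (singularValue T k : ℂ) •
        rankOne ℂ (leftVec T k) (topVec (remainder T k)) = remainder T N := by
      have h := remainder_sub T 0 N
      rw [remainder_zero, zero_add] at h
      rw [sub_eq_iff_eq_add, add_comm, ← sub_eq_iff_eq_add, h]
      refine Finset.sum_congr rfl fun k _ => ?_
      rw [zero_add, ← norm_smul_leftVec, singularValue_eq_norm_remainder hT, map_smul,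
        smul_apply]
    rw [h, singularValue_eq_norm_remainder hT]
    exact singularValue_remainder_le T N m

/-- If all singular values were at least `L > 0`, the vectors `T (η k) = s_k e k` would be
orthogonal of norm at least `L`, so the images of unit vectors would have no convergent subsequence.
-/
theorem tendsto_singularValue {T : H →L[ℂ] H} (hT : IsCompactOperator T) :
    Tendsto (singularValue T) atTop (𝓝 0) := by
  have hlim := tendsto_atTop_ciInf (singularValue_antitone T)
    ⟨0, by rintro _ ⟨n, rfl⟩; exact singularValue_nonneg T n⟩
  set L := ⨅ n, singularValue T n with hL
  have hLle : ∀ n, L ≤ singularValue T n := fun n =>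
    ciInf_le ⟨0, by rintro _ ⟨n, rfl⟩; exact singularValue_nonneg T n⟩ n
  have hL0 : 0 ≤ L := le_ciInf fun n => singularValue_nonneg T n
  rcases hL0.eq_or_lt with h0 | hpos
  · rwa [← h0] at hlim
  exfalso
  obtain ⟨e, η, he, hη, hT', -⟩ := exists_svd hT
  have hs : ∀ k, singularValue T k ≠ 0 := fun k => (hpos.trans_le (hLle k)).ne'
  have hnorm : ∀ k, ‖η k‖ = 1 := fun k =>
    norm_eq_one_of_inner_self ((hη k k).trans (if_pos ⟨rfl, hs k⟩))
  have hcomp := hT.isCompact_closure_image_closedBall (𝕜₁ := ℂ) (f := (T : H →ₗ[ℂ] H)) 1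
  obtain ⟨a, -, φ, hφ, hlim2⟩ := hcomp.tendsto_subseq (x := fun k => T (η k)) fun k =>
    subset_closure ⟨η k, by simp [hnorm], rfl⟩
  have hcau := hlim2.cauchySeq
  rw [Metric.cauchySeq_iff'] at hcau
  obtain ⟨N, hN⟩ := hcau L hpos
  have h1 := hN (N + 1) (by omega)
  have hne : φ (N + 1) ≠ φ N := fun h => by
    have := hφ.injective h
    omega
  rw [dist_eq_norm] at h1
  have h2 : ‖T (η (φ (N + 1))) - T (η (φ N))‖ ^ 2 =
      singularValue T (φ (N + 1)) ^ 2 + singularValue T (φ N) ^ 2 := by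
    have hen : ∀ k, ‖e k‖ = 1 := fun k =>
      norm_eq_one_of_inner_self ((he k k).trans (if_pos ⟨rfl, hs k⟩))
    rw [@norm_sub_sq ℂ, hT', hT', inner_smul_left, inner_smul_right, he,
      if_neg (fun h => hne h.1), norm_smul, norm_smul, hen, hen]
    simp
  have h3 : L ^ 2 ≤ singularValue T (φ (N + 1)) ^ 2 := by
    gcongr
    exact hLle _
  have h4 : ‖T (η (φ (N + 1))) - T (η (φ N))‖ ^ 2 < L ^ 2 := by
    gcongr
    exact h1
  nlinarith [sq_nonneg (singularValue T (φ N))]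

end SingularValueDecomposition

/-! ### Schatten norms: monotonicity, semicontinuity, triangle inequality -/

section SchattenNorm

variable {H : Type*} [NormedAddCommGroup H] [InnerProductSpace ℂ H]

theorem singularValue_comp_le (B T C : H →L[ℂ] H) (n : ℕ) :
    singularValue (B ∘L T ∘L C) n ≤ ‖B‖ * ‖C‖ * singularValue T n := by
  unfold singularValue
  rw [Real.mul_iInf_of_nonneg (by positivity)]
  refine le_ciInf fun F => ?_
  have h : ((B ∘L F.1 ∘L C : H →L[ℂ] H) : H →ₗ[ℂ] H).rank ≤ (n : Cardinal) := by
    refine le_trans ?_ F.2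
    rw [ContinuousLinearMap.toLinearMap_comp, ContinuousLinearMap.toLinearMap_comp]
    exact (LinearMap.rank_comp_le_right _ _).trans (LinearMap.rank_comp_le_left _ _)
  refine (singularValue_le h).trans ?_
  have h2 : B ∘L T ∘L C - B ∘L F.1 ∘L C = B ∘L (T - F.1) ∘L C := by
    ext x; simp
  rw [h2]
  calc ‖B ∘L (T - F.1) ∘L C‖ ≤ ‖B‖ * (‖T - F.1‖ * ‖C‖) :=
        (ContinuousLinearMap.opNorm_comp_le _ _).trans
          (mul_le_mul_of_nonneg_left (ContinuousLinearMap.opNorm_comp_le _ _) (norm_nonneg _))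
    _ = ‖B‖ * ‖C‖ * ‖T - F.1‖ := by ring

theorem singularValue_comp_le_of_norm_le_one {B T C : H →L[ℂ] H} (hB : ‖B‖ ≤ 1) (hC : ‖C‖ ≤ 1)
    (n : ℕ) : singularValue (B ∘L T ∘L C) n ≤ singularValue T n := by
  refine (singularValue_comp_le B T C n).trans ?_
  refine mul_le_of_le_one_left (singularValue_nonneg _ _) ?_
  exact mul_le_one₀ hB (norm_nonneg _) hC

/-- With `P` the projection onto the range of `F`, `F = P F` gives `F† = F† P`, whose rank is at
most that of `P`. -/
theorem rank_adjoint_le [CompleteSpace H] {F : H →L[ℂ] H} {n : ℕ}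
    (hF : (F : H →ₗ[ℂ] H).rank ≤ (n : Cardinal)) :
    ((ContinuousLinearMap.adjoint F : H →L[ℂ] H) : H →ₗ[ℂ] H).rank ≤ (n : Cardinal) := by
  set K := LinearMap.range (F : H →ₗ[ℂ] H) with hK
  have : FiniteDimensional ℂ K := Module.rank_lt_aleph0_iff.1 (hF.trans_lt Cardinal.natCast_lt_aleph0)
  have h1 : K.starProjection ∘L F = F := by
    ext x
    exact K.starProjection_eq_self_iff.2 (LinearMap.mem_range_self (F : H →ₗ[ℂ] H) x)
  have h2 : ContinuousLinearMap.adjoint F =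
      ContinuousLinearMap.adjoint F ∘L K.starProjection := by
    conv_lhs => rw [← h1, ContinuousLinearMap.adjoint_comp]
    congr 1
    exact isSelfAdjoint_starProjection K
  rw [h2, ContinuousLinearMap.toLinearMap_comp]
  refine (LinearMap.rank_comp_le_right _ _).trans (le_trans (Submodule.rank_mono ?_) hF)
  rintro _ ⟨x, rfl⟩
  exact K.starProjection_apply_mem x

theorem singularValue_adjoint_le [CompleteSpace H] (T : H →L[ℂ] H) (n : ℕ) :
    singularValue (ContinuousLinearMap.adjoint T) n ≤ singularValue T n := by
  refine le_ciInf fun F => (singularValue_le (rank_adjoint_le F.2)).trans ?_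
  rw [← map_sub, LinearIsometryEquiv.norm_map]

variable {p : ℝ≥0∞} [Fact (1 ≤ p)]

theorem toReal_pos_of_one_le (hp : p ≠ ∞) : 0 < p.toReal :=
  ENNReal.toReal_pos (zero_lt_one.trans_le Fact.out).ne' hp

theorem schattenNorm_nonneg (T : schatten H p) : 0 ≤ schattenNorm T := norm_nonneg _

theorem mem_schatten {T : H →L[ℂ] H} : T ∈ schatten H p ↔ Memℓp (singularValue T) p := Iff.rfl

theorem mem_schatten_of_singularValue_le {S T : H →L[ℂ] H} (hT : T ∈ schatten H p)
    (h : ∀ n, singularValue S n ≤ singularValue T n) : S ∈ schatten H p :=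
  Memℓp.mono' (mem_schatten.1 hT) fun n => by
    rw [Real.norm_of_nonneg (singularValue_nonneg _ _),
      Real.norm_of_nonneg (singularValue_nonneg _ _)]
    exact h n

theorem schattenNorm_le_of_singularValue_le {S T : schatten H p}
    (h : ∀ n, singularValue S.1 n ≤ singularValue T.1 n) : schattenNorm S ≤ schattenNorm T :=
  lp.norm_mono (zero_lt_one.trans_le Fact.out).ne' fun n => by
    simp only [Real.norm_of_nonneg (singularValue_nonneg _ _)]
    exact h n

theorem singularValue_le_schattenNorm (T : schatten H p) (n : ℕ) :
    singularValue T.1 n ≤ schattenNorm T := by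
  have h := lp.norm_apply_le_norm (zero_lt_one.trans_le (Fact.out : 1 ≤ p)).ne'
    (⟨singularValue T.1, T.2⟩ : lp (fun _ : ℕ => ℝ) p) n
  exact (Real.le_norm_self _).trans h

theorem norm_le_schattenNorm (T : schatten H p) : ‖T.1‖ ≤ schattenNorm T := by
  rw [← singularValue_index_zero]
  exact singularValue_le_schattenNorm T 0

theorem mem_schatten_top (T : H →L[ℂ] H) : T ∈ schatten H ∞ :=
  memℓp_infty ⟨‖T‖, by
    rintro _ ⟨n, rfl⟩
    simpa [abs_of_nonneg (singularValue_nonneg _ _)] using singularValue_le_norm T n⟩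

theorem schattenNorm_top (T : schatten H ∞) : schattenNorm T = ‖T.1‖ :=
  le_antisymm (lp.norm_le_of_forall_le (norm_nonneg _) fun n => by
    simpa [abs_of_nonneg (singularValue_nonneg _ _)] using singularValue_le_norm T.1 n)
    (norm_le_schattenNorm T)

theorem mem_schatten_of_rank_le {T : H →L[ℂ] H} {n : ℕ}
    (hT : (T : H →ₗ[ℂ] H).rank ≤ (n : Cardinal)) : T ∈ schatten H p := by
  refine Memℓp.of_exponent_ge (memℓp_zero ((Set.finite_lt_nat n).subset fun k hk => ?_))
    zero_le
  by_contra hkn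
  refine hk (le_antisymm ?_ (singularValue_nonneg _ _))
  have h := singularValue_le (T := T) (hT.trans (Nat.cast_le.2 (not_lt.1 hkn)))
  simpa using h

theorem rankOne_mem_schatten (e η : H) : (rankOne ℂ e η : H →L[ℂ] H) ∈ schatten H p := by
  refine mem_schatten_of_rank_le (n := 1) ?_
  simpa using rank_sum_rankOne_le (fun _ => e) (fun _ => η) {0}

theorem schattenNorm_smul (c : ℂ) (T : schatten H p) :
    schattenNorm (c • T) = ‖c‖ * schattenNorm T := by
  have hle : ∀ (c : ℂ) (T : schatten H p), schattenNorm (c • T) ≤ ‖c‖ * schattenNorm T := by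
    intro c T
    have h : ‖‖c‖ • (⟨singularValue T.1, T.2⟩ : lp (fun _ : ℕ => ℝ) p)‖ = ‖c‖ * schattenNorm T := by
      rw [norm_smul, norm_norm]; rfl
    rw [← h]
    refine lp.norm_mono (zero_lt_one.trans_le Fact.out).ne' fun n => ?_
    refine le_trans ?_ (Real.le_norm_self _)
    rw [Real.norm_of_nonneg (singularValue_nonneg _ _)]
    exact singularValue_smul_le c T.1 n
  refine le_antisymm (hle c T) ?_
  by_cases hc : c = 0
  · simp [hc, schattenNorm_nonneg]
  · have h := hle c⁻¹ (c • T)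
    rw [inv_smul_smul₀ hc, norm_inv] at h
    rwa [← le_inv_mul_iff₀ (norm_pos_iff.2 hc)]

theorem tendsto_singularValue_of_mem_schatten (hp : p ≠ ∞) {T : H →L[ℂ] H}
    (hT : T ∈ schatten H p) : Tendsto (singularValue T) atTop (𝓝 0) := by
  have hp0 := toReal_pos_of_one_le hp
  have h := ((mem_schatten.1 hT).summable hp0).tendsto_atTop_zero
  have h2 := h.rpow_const (p := p.toReal⁻¹) (Or.inr (inv_nonneg.2 hp0.le))
  rw [Real.zero_rpow (inv_pos.2 hp0).ne'] at h2
  refine h2.congr fun n => ?_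
  rw [← Real.rpow_mul (norm_nonneg _), mul_inv_cancel₀ hp0.ne', Real.rpow_one,
    Real.norm_of_nonneg (singularValue_nonneg _ _)]

theorem schattenNorm_rpow (hp : p ≠ ∞) (T : schatten H p) :
    HasSum (fun n => singularValue T.1 n ^ p.toReal) (schattenNorm T ^ p.toReal) := by
  have h := lp.hasSum_norm (toReal_pos_of_one_le hp)
    (⟨singularValue T.1, T.2⟩ : lp (fun _ : ℕ => ℝ) p)
  refine h.congr_fun fun n => ?_
  simp only [Real.norm_of_nonneg (singularValue_nonneg _ _)]

/-- Lower semicontinuity of the Schatten norm under operator norm limits: singular values converge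
index by index, and balls of `ℓ^p` are closed under such limits. -/
theorem mem_schatten_and_norm_le_of_tendsto {T : ℕ → schatten H p} {S : H →L[ℂ] H} {c : ℝ}
    (hT : ∀ n, schattenNorm (T n) ≤ c) (hlim : Tendsto (fun n => (T n : H →L[ℂ] H)) atTop (𝓝 S)) :
    ∃ h : S ∈ schatten H p, schattenNorm (⟨S, h⟩ : schatten H p) ≤ c := by
  have hs : Tendsto (fun n => singularValue (T n).1) atTop (𝓝 (singularValue S)) := by
    rw [tendsto_pi_nhds]
    intro k
    rw [tendsto_iff_norm_sub_tendsto_zero] at hlim ⊢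
    refine squeeze_zero (fun _ => norm_nonneg _) (fun n => ?_) hlim
    rw [Real.norm_eq_abs, abs_le]
    have h1 := singularValue_le_add_norm_sub (T n).1 S k
    have h2 := singularValue_le_add_norm_sub S (T n).1 k
    rw [norm_sub_rev] at h2
    constructor <;> linarith
  have hmem : S ∈ schatten H p :=
    lp.memℓp_of_tendsto (F := fun n => (⟨singularValue (T n).1, (T n).2⟩ : lp (fun _ : ℕ => ℝ) p))
      (isBounded_iff_forall_norm_le.2 ⟨c, by rintro _ ⟨n, rfl⟩; exact hT n⟩) hs
  exact ⟨hmem, lp.norm_le_of_tendsto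
    (F := fun n => (⟨singularValue (T n).1, (T n).2⟩ : lp (fun _ : ℕ => ℝ) p))
    (f := ⟨singularValue S, hmem⟩) (Eventually.of_forall hT) hs⟩

/-- Bessel's inequality on the indices with `s k ≠ 0`; the other vectors are zero. -/
theorem sum_norm_inner_sq_le {s : ℕ → ℝ} {v : ℕ → H}
    (hv : ∀ k l, ⟪v k, v l⟫_ℂ = if k = l ∧ s k ≠ 0 then 1 else 0) (J : Finset ℕ) (x : H) :
    ∑ k ∈ J, ‖⟪v k, x⟫_ℂ‖ ^ 2 ≤ ‖x‖ ^ 2 := by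
  classical
  have ho : Orthonormal ℂ (fun k : {k // s k ≠ 0} => v k) := by
    rw [orthonormal_iff_ite]
    intro k l
    rw [hv]
    simp [k.2, Subtype.ext_iff]
  have h := ho.sum_inner_products_le x (s := J.subtype fun k => s k ≠ 0)
  refine le_trans (le_of_eq ?_) h
  rw [Finset.sum_subtype_eq_sum_filter (f := fun k => ‖⟪v k, x⟫_ℂ‖ ^ 2), Finset.sum_filter]
  refine Finset.sum_congr rfl fun k _ => ?_
  split_ifs with hk
  · rfl
  · have : v k = 0 := by
      rw [← inner_self_eq_zero (𝕜 := ℂ), hv, if_neg (fun h => hk h.2)]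
    simp [this]

theorem norm_le_one_of_inner {s : ℕ → ℝ} {v : ℕ → H}
    (hv : ∀ k l, ⟪v k, v l⟫_ℂ = if k = l ∧ s k ≠ 0 then 1 else 0) (k : ℕ) : ‖v k‖ ≤ 1 := by
  by_cases hk : s k = 0
  · have : v k = 0 := by
      rw [← inner_self_eq_zero (𝕜 := ℂ), hv, if_neg (fun h => h.2 hk)]
    simp [this]
  · exact (norm_eq_one_of_inner_self ((hv k k).trans (if_pos ⟨rfl, hk⟩))).le

/-- The partial sums of a singular value decomposition. -/
noncomputable def svdSum (s : ℕ → ℝ) (e η : ℕ → H) (N : ℕ) : H →L[ℂ] H :=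
  ∑ k ∈ Finset.range N, (s k : ℂ) • rankOne ℂ (e k) (η k)

theorem svdSum_apply (s : ℕ → ℝ) (e η : ℕ → H) (N : ℕ) (x : H) :
    svdSum s e η N x = ∑ k ∈ Finset.range N, ((s k : ℂ) * ⟪η k, x⟫_ℂ) • e k := by
  simp only [svdSum, sum_apply, smul_apply, InnerProductSpace.rankOne_apply, smul_smul]

theorem rank_svdSum_le (s : ℕ → ℝ) (e η : ℕ → H) (N : ℕ) :
    ((svdSum s e η N : H →L[ℂ] H) : H →ₗ[ℂ] H).rank ≤ (N : Cardinal) := by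
  have h := rank_sum_rankOne_le (fun k => (s k : ℂ) • e k) η (Finset.range N)
  simpa [svdSum] using h

theorem svdSum_mem_schatten (s : ℕ → ℝ) (e η : ℕ → H) (N : ℕ) :
    svdSum s e η N ∈ schatten H p := mem_schatten_of_rank_le (rank_svdSum_le s e η N)

theorem tendsto_schattenNorm_svdSum (hp : p ≠ ∞) (T : schatten H p) {e η : ℕ → H}
    (h : ∀ N m, singularValue (T.1 - svdSum (singularValue T.1) e η N) m ≤
      singularValue T.1 (N + m)) :
    Tendsto (fun N => schattenNorm
      (T - ⟨svdSum (singularValue T.1) e η N, svdSum_mem_schatten _ e η N⟩ : schatten H p))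
      atTop (𝓝 0) := by
  have hp0 := toReal_pos_of_one_le hp
  have hsum := schattenNorm_rpow hp T
  have h1 : Tendsto (fun N => ∑' m, singularValue T.1 (m + N) ^ p.toReal) atTop (𝓝 0) :=
    tendsto_sum_nat_add fun n => singularValue T.1 n ^ p.toReal
  have h2 := h1.rpow_const (p := p.toReal⁻¹) (Or.inr (inv_nonneg.2 hp0.le))
  rw [Real.zero_rpow (inv_pos.2 hp0).ne'] at h2
  refine squeeze_zero (fun _ => schattenNorm_nonneg _) (fun N => ?_) h2
  rw [Real.le_rpow_inv_iff_of_pos (schattenNorm_nonneg _)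
    (tsum_nonneg fun m => Real.rpow_nonneg (singularValue_nonneg _ _) _) hp0,
    ← (schattenNorm_rpow hp _).tsum_eq]
  refine Summable.tsum_le_tsum (fun m => ?_) (schattenNorm_rpow hp _).summable
    ((summable_nat_add_iff N).2 hsum.summable)
  refine Real.rpow_le_rpow (singularValue_nonneg _ _) ?_ hp0.le
  rw [add_comm m N]
  exact h N m

variable [CompleteSpace H]

theorem tendsto_svdSum {T : H →L[ℂ] H} (hT : IsCompactOperator T) {e η : ℕ → H}
    (h : ∀ N m, singularValue (T - svdSum (singularValue T) e η N) m ≤ singularValue T (N + m)) :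
    Tendsto (svdSum (singularValue T) e η) atTop (𝓝 T) := by
  rw [tendsto_iff_norm_sub_tendsto_zero]
  refine squeeze_zero (fun _ => norm_nonneg _) (fun N => ?_) (tendsto_singularValue hT)
  rw [norm_sub_rev, ← singularValue_index_zero]
  exact h N 0

/-- The diagonal of an operator with respect to two orthonormal families is dominated in `ℓ^p` by
its singular values. -/
theorem sum_norm_inner_rpow_le (hp : p ≠ ∞) (T : schatten H p) {s t : ℕ → ℝ} {f g : ℕ → H}
    (hf : ∀ k l, ⟪f k, f l⟫_ℂ = if k = l ∧ s k ≠ 0 then 1 else 0)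
    (hg : ∀ k l, ⟪g k, g l⟫_ℂ = if k = l ∧ t k ≠ 0 then 1 else 0) (J : Finset ℕ) :
    ∑ n ∈ J, ‖⟪f n, T.1 (g n)⟫_ℂ‖ ^ p.toReal ≤ schattenNorm T ^ p.toReal := by
  have hp0 := toReal_pos_of_one_le hp
  have hp1 : 1 ≤ p.toReal := by
    rw [← ENNReal.toReal_one]
    exact (ENNReal.toReal_le_toReal ENNReal.one_ne_top hp).2 Fact.out
  have hc := isCompactOperator_of_tendsto_singularValue
    (tendsto_singularValue_of_mem_schatten hp T.2)
  obtain ⟨e, η, he, hη, -, hrem⟩ := exists_svd hc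
  -- It suffices to bound the partial sums of the decomposition, uniformly in `N`.
  have hlim : Tendsto (fun N => ∑ n ∈ J,
      ‖⟪f n, svdSum (singularValue T.1) e η N (g n)⟫_ℂ‖ ^ p.toReal) atTop
      (𝓝 (∑ n ∈ J, ‖⟪f n, T.1 (g n)⟫_ℂ‖ ^ p.toReal)) := by
    refine tendsto_finsetSum _ fun n _ => Tendsto.rpow_const ?_ (Or.inr hp0.le)
    refine Tendsto.norm ((continuous_const.inner continuous_id).tendsto _ |>.comp ?_)
    exact ((ContinuousLinearMap.apply ℂ H (g n)).continuous.tendsto T.1).comp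
      (tendsto_svdSum hc hrem)
  refine le_of_tendsto' hlim fun N => ?_
  set σ := singularValue T.1 with hσ
  -- By AM–GM, `b n k` dominates the modulus of the coefficient of `σ k` in the `n`-th diagonal
  -- entry. By Bessel it is doubly substochastic: the row sums allow the convexity inequality for
  -- the power `p`, the column sums absorb the sum over `n`.
  let b : ℕ → ℕ → ℝ := fun n k => (‖⟪e k, f n⟫_ℂ‖ ^ 2 + ‖⟪η k, g n⟫_ℂ‖ ^ 2) / 2
  have hb0 : ∀ n k, 0 ≤ b n k := fun n k => by positivity
  have hb1 : ∀ n, ∑ k ∈ Finset.range N, b n k ≤ 1 := by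
    intro n
    have h1 := sum_norm_inner_sq_le he (Finset.range N) (f n)
    have h2 := sum_norm_inner_sq_le hη (Finset.range N) (g n)
    have h3 : ‖f n‖ ^ 2 ≤ 1 := pow_le_one₀ (norm_nonneg _) (norm_le_one_of_inner hf n)
    have h4 : ‖g n‖ ^ 2 ≤ 1 := pow_le_one₀ (norm_nonneg _) (norm_le_one_of_inner hg n)
    rw [← Finset.sum_div, Finset.sum_add_distrib]
    linarith
  have hb2 : ∀ k, ∑ n ∈ J, b n k ≤ 1 := by
    intro k
    have h1 := sum_norm_inner_sq_le hf J (e k)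
    have h2 := sum_norm_inner_sq_le hg J (η k)
    have h3 : ‖e k‖ ^ 2 ≤ 1 := pow_le_one₀ (norm_nonneg _) (norm_le_one_of_inner he k)
    have h4 : ‖η k‖ ^ 2 ≤ 1 := pow_le_one₀ (norm_nonneg _) (norm_le_one_of_inner hη k)
    rw [← Finset.sum_div, Finset.sum_add_distrib]
    simp only [fun n => norm_inner_symm (𝕜 := ℂ) (e k) (f n),
      fun n => norm_inner_symm (𝕜 := ℂ) (η k) (g n)]
    linarith
  have hn : ∀ n, ‖⟪f n, svdSum σ e η N (g n)⟫_ℂ‖ ^ p.toReal ≤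
      ∑ k ∈ Finset.range N, b n k * σ k ^ p.toReal := by
    intro n
    have h1 : ‖⟪f n, svdSum σ e η N (g n)⟫_ℂ‖ ≤ ∑ k ∈ Finset.range N, b n k * σ k := by
      rw [svdSum_apply, inner_sum]
      refine (norm_sum_le _ _).trans (Finset.sum_le_sum fun k _ => ?_)
      rw [inner_smul_right, norm_mul, norm_mul, Complex.norm_real,
        Real.norm_of_nonneg (singularValue_nonneg _ _), norm_inner_symm (f n) (e k)]
      have := two_mul_le_add_sq ‖⟪e k, f n⟫_ℂ‖ ‖⟪η k, g n⟫_ℂ‖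
      have h0 := singularValue_nonneg T.1 k
      simp only [b, ← hσ]
      calc σ k * ‖⟪η k, g n⟫_ℂ‖ * ‖⟪e k, f n⟫_ℂ‖
          = (2 * ‖⟪e k, f n⟫_ℂ‖ * ‖⟪η k, g n⟫_ℂ‖) / 2 * σ k := by ring
        _ ≤ _ := by gcongr
    have h2 := Real.inner_le_weight_mul_Lp_of_nonneg (Finset.range N) hp1 (b n) σ (hb0 n)
      (singularValue_nonneg T.1)
    have h3 : 0 ≤ ∑ k ∈ Finset.range N, b n k * σ k ^ p.toReal :=
      Finset.sum_nonneg fun k _ => mul_nonneg (hb0 n k)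
        (Real.rpow_nonneg (singularValue_nonneg _ _) _)
    have h4 : (∑ k ∈ Finset.range N, b n k) ^ (1 - p.toReal⁻¹) ≤ 1 :=
      Real.rpow_le_one (Finset.sum_nonneg fun k _ => hb0 n k) (hb1 n)
        (sub_nonneg.2 (inv_le_one_of_one_le₀ hp1))
    rw [← Real.le_rpow_inv_iff_of_pos (norm_nonneg _) h3 hp0]
    exact h1.trans (h2.trans (mul_le_of_le_one_left (Real.rpow_nonneg h3 _) h4))
  calc ∑ n ∈ J, ‖⟪f n, svdSum σ e η N (g n)⟫_ℂ‖ ^ p.toReal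
      ≤ ∑ n ∈ J, ∑ k ∈ Finset.range N, b n k * σ k ^ p.toReal := Finset.sum_le_sum fun n _ => hn n
    _ = ∑ k ∈ Finset.range N, (∑ n ∈ J, b n k) * σ k ^ p.toReal := by
        rw [Finset.sum_comm]
        exact Finset.sum_congr rfl fun k _ => (Finset.sum_mul _ _ _).symm
    _ ≤ ∑ k ∈ Finset.range N, σ k ^ p.toReal := Finset.sum_le_sum fun k _ =>
        mul_le_of_le_one_left (Real.rpow_nonneg (singularValue_nonneg _ _) _) (hb2 k)
    _ ≤ schattenNorm T ^ p.toReal := sum_le_hasSum _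
        (fun k _ => Real.rpow_nonneg (singularValue_nonneg _ _) _) (schattenNorm_rpow hp T)

/-- The singular values of `S + T` are its diagonal entries in its own singular vectors. These
entries split additively, and the `ℓ^p` norm of each part is controlled by `sum_norm_inner_rpow_le`.
-/
theorem schattenNorm_add_le (S T : schatten H p) :
    schattenNorm (S + T) ≤ schattenNorm S + schattenNorm T := by
  rcases eq_or_ne p ∞ with rfl | hp
  · simp only [schattenNorm_top]
    exact norm_add_le _ _
  have hp0 := toReal_pos_of_one_le hp
  have hc := isCompactOperator_of_tendsto_singularValue
    (tendsto_singularValue_of_mem_schatten hp (S + T).2)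
  obtain ⟨e, η, he, hη, hTη, -⟩ := exists_svd hc
  have hmem : ∀ R : schatten H p, ∃ h : Memℓp (fun k => ‖⟪e k, R.1 (η k)⟫_ℂ‖) p,
      ‖(⟨_, h⟩ : lp (fun _ : ℕ => ℝ) p)‖ ≤ schattenNorm R := by
    intro R
    have h := sum_norm_inner_rpow_le hp R he hη
    have h' : ∀ J : Finset ℕ, ∑ k ∈ J, ‖‖⟪e k, R.1 (η k)⟫_ℂ‖‖ ^ p.toReal ≤
        schattenNorm R ^ p.toReal := by simpa only [norm_norm] using h
    exact ⟨memℓp_gen' h', lp.norm_le_of_forall_sum_le hp0 (schattenNorm_nonneg R) h'⟩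
  obtain ⟨hS, hS'⟩ := hmem S
  obtain ⟨hT, hT'⟩ := hmem T
  refine le_trans ?_ ((norm_add_le (⟨_, hS⟩ : lp (fun _ : ℕ => ℝ) p) ⟨_, hT⟩).trans
    (add_le_add hS' hT'))
  refine lp.norm_mono (zero_lt_one.trans_le Fact.out).ne' fun k => ?_
  refine le_trans ?_ (Real.le_norm_self _)
  change ‖singularValue (S + T).1 k‖ ≤ ‖⟪e k, S.1 (η k)⟫_ℂ‖ + ‖⟪e k, T.1 (η k)⟫_ℂ‖
  have h1 : ⟪e k, (S + T).1 (η k)⟫_ℂ = singularValue (S + T).1 k := by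
    rw [hTη, inner_smul_right, he]
    by_cases hk : singularValue (S + T).1 k = 0
    · rw [if_neg fun h => h.2 hk, mul_zero, hk, Complex.ofReal_zero]
    · rw [if_pos ⟨rfl, hk⟩, mul_one]
  rw [← Complex.norm_real, ← h1]
  refine le_trans (le_of_eq ?_) (norm_add_le _ _)
  rw [← inner_add_right]
  rfl

end SchattenNorm

/-! ### The trace through a singular value decomposition -/

section Trace

variable {H : Type*} [NormedAddCommGroup H] [InnerProductSpace ℂ H] [CompleteSpace H]

theorem tendsto_svdSum_apply {T : H →L[ℂ] H} (hT : IsCompactOperator T) {e η : ℕ → H}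
    (h : ∀ N m, singularValue (T - svdSum (singularValue T) e η N) m ≤ singularValue T (N + m))
    (x : H) : Tendsto (fun N => svdSum (singularValue T) e η N x) atTop (𝓝 (T x)) :=
  ((ContinuousLinearMap.apply ℂ H x).continuous.tendsto T).comp (tendsto_svdSum hT h)

/-- The trace of `T B` for `T = ∑ s_k e_k ⊗ η_k` of trace class. -/
theorem trace_comp_eq_tsum {T : H →L[ℂ] H} {s : ℕ → ℝ} {e η : ℕ → H} (hs : Summable s)
    (hs0 : ∀ k, 0 ≤ s k) (he : ∀ k, ‖e k‖ ≤ 1) (hη : ∀ k, ‖η k‖ ≤ 1)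
    (hT : ∀ x, Tendsto (fun N => svdSum s e η N x) atTop (𝓝 (T x))) (B : H →L[ℂ] H) :
    trace (T ∘L B) = ∑' k, (s k : ℂ) * ⟪η k, B (e k)⟫_ℂ := by
  obtain ⟨w, hw⟩ : ∃ w : Set H, ∃ b : HilbertBasis w ℂ H,
      trace (T ∘L B) = ∑' i, ⟪b i, (T ∘L B) (b i)⟫_ℂ := ⟨_, _, rfl⟩
  obtain ⟨b, hb⟩ := hw
  rw [hb]
  have hsum : ∀ x, HasSum (fun k => ((s k : ℂ) * ⟪η k, x⟫_ℂ) • e k) (T x) := by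
    intro x
    have hsm : Summable fun k => ((s k : ℂ) * ⟪η k, x⟫_ℂ) • e k := by
      refine Summable.of_norm_bounded (hs.mul_right ‖x‖) fun k => ?_
      rw [norm_smul, norm_mul, Complex.norm_real, Real.norm_of_nonneg (hs0 k)]
      have h1 : ‖⟪η k, x⟫_ℂ‖ ≤ ‖x‖ := (norm_inner_le_norm _ _).trans
        (mul_le_of_le_one_left (norm_nonneg _) (hη k))
      calc s k * ‖⟪η k, x⟫_ℂ‖ * ‖e k‖ ≤ s k * ‖x‖ * 1 := by
            gcongr
            · exact mul_nonneg (hs0 k) (norm_nonneg _)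
            · exact hs0 k
            · exact he k
        _ = s k * ‖x‖ := mul_one _
    have h2 := hsm.hasSum.tendsto_sum_nat
    have h3 := hT x
    simp only [svdSum_apply] at h3
    have h4 := hsm.hasSum
    rwa [tendsto_nhds_unique h2 h3] at h4
  have h1 : ∀ i, ⟪b i, (T ∘L B) (b i)⟫_ℂ =
      ∑' k, (s k : ℂ) * (⟪ContinuousLinearMap.adjoint B (η k), b i⟫_ℂ * ⟪b i, e k⟫_ℂ) := by
    intro i
    refine ((innerSL ℂ (b i)).hasSum (hsum (B (b i)))).tsum_eq.symm.trans (tsum_congr fun k => ?_)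
    rw [innerSL_apply_apply, inner_smul_right, ContinuousLinearMap.adjoint_inner_left, mul_assoc]
  simp only [h1]
  -- AM–GM and Bessel bound the sums over the basis uniformly in `k`. Hence the double series
  -- converges absolutely, the sums can be exchanged, and Parseval evaluates the one over the basis.
  have hbes : ∀ x y : H, Summable (fun i => ‖⟪x, b i⟫_ℂ * ⟪b i, y⟫_ℂ‖) ∧
      ∑' i, ‖⟪x, b i⟫_ℂ * ⟪b i, y⟫_ℂ‖ ≤ (‖x‖ ^ 2 + ‖y‖ ^ 2) / 2 := by
    intro x y
    have hx := b.orthonormal.inner_products_summable x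
    have hy := b.orthonormal.inner_products_summable y
    have hle : ∀ i, ‖⟪x, b i⟫_ℂ * ⟪b i, y⟫_ℂ‖ ≤ (‖⟪b i, x⟫_ℂ‖ ^ 2 + ‖⟪b i, y⟫_ℂ‖ ^ 2) / 2 := by
      intro i
      rw [norm_mul, norm_inner_symm x]
      linarith [two_mul_le_add_sq ‖⟪b i, x⟫_ℂ‖ ‖⟪b i, y⟫_ℂ‖]
    have hs2 := (hx.add hy).div_const 2
    have hs1 := Summable.of_nonneg_of_le (fun i => norm_nonneg _) hle hs2
    refine ⟨hs1, (Summable.tsum_le_tsum hle hs1 hs2).trans ?_⟩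
    rw [tsum_div_const, hx.tsum_add hy]
    have := b.orthonormal.tsum_inner_products_le x
    have := b.orthonormal.tsum_inner_products_le y
    linarith
  have hsw : Summable (Function.uncurry fun k i =>
      (s k : ℂ) * (⟪ContinuousLinearMap.adjoint B (η k), b i⟫_ℂ * ⟪b i, e k⟫_ℂ)) := by
    refine Summable.of_norm ((summable_prod_of_nonneg fun _ => norm_nonneg _).2 ⟨fun k => ?_, ?_⟩)
    · simp only [Function.uncurry_apply_pair, norm_mul (s k : ℂ)]
      exact (hbes _ _).1.mul_left _
    · refine Summable.of_nonneg_of_le (fun k => tsum_nonneg fun _ => norm_nonneg _) (fun k => ?_)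
        (hs.mul_right ((‖ContinuousLinearMap.adjoint B‖ ^ 2 + 1 ^ 2) / 2))
      simp only [Function.uncurry_apply_pair, norm_mul (s k : ℂ), tsum_mul_left,
        Complex.norm_real, Real.norm_of_nonneg (hs0 k)]
      refine mul_le_mul_of_nonneg_left ((hbes _ _).2.trans ?_) (hs0 k)
      gcongr
      · exact ((ContinuousLinearMap.adjoint B).le_opNorm _).trans
          (mul_le_of_le_one_right (norm_nonneg _) (hη k))
      · exact he k
  rw [hsw.tsum_comm]
  refine tsum_congr fun k => ?_
  rw [tsum_mul_left, b.tsum_inner_mul_inner, ContinuousLinearMap.adjoint_inner_left]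

end Trace

/-! ### Time-frequency shifts, ambiguity functions and Moyal's identity -/

section TimeFrequencyShifts

variable {d : ℕ}

theorem coeFn_rho (z : PhaseSpace d) (f : L2 d) : rho z f =ᵐ[volume] shiftFun z f :=
  (memLp_shiftFun z f).coeFn_toLp

theorem shiftFun_congr_ae (z : PhaseSpace d) {f g : EuclideanSpace ℝ (Fin d) → ℂ}
    (h : f =ᵐ[volume] g) : shiftFun z f =ᵐ[volume] shiftFun z g := by
  filter_upwards [(measurePreserving_sub_right volume z.1).quasiMeasurePreserving.ae h] with t ht
  rw [shiftFun, shiftFun, ht]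

theorem coeFn_rho_rho (z w : PhaseSpace d) (f : L2 d) :
    rho z (rho w f) =ᵐ[volume] shiftFun z (shiftFun w f) :=
  (coeFn_rho z _).trans (shiftFun_congr_ae z (coeFn_rho w f))

theorem norm_rho (z : PhaseSpace d) (f : L2 d) : ‖rho z f‖ = ‖f‖ := by
  rw [Lp.norm_def, Lp.norm_def, eLpNorm_congr_ae (coeFn_rho z f),
    ← eLpNorm_comp_measurePreserving (Lp.memLp f).1 (measurePreserving_sub_right volume z.1)]
  congr 1
  exact eLpNorm_congr_norm_ae (Eventually.of_forall fun t => norm_shiftFun z f t)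

theorem inner_rho_rho (z : PhaseSpace d) (f g : L2 d) : ⟪rho z f, rho z g⟫_ℂ = ⟪f, g⟫_ℂ :=
  LinearIsometry.inner_map_map ⟨(rho z : L2 d →ₗ[ℂ] L2 d), norm_rho z⟩ f g

theorem rho_rho_neg (z : PhaseSpace d) (f : L2 d) : rho z (rho (-z) f) = f := by
  refine Lp.ext ((coeFn_rho_rho z (-z) f).trans (Eventually.of_forall fun t => ?_))
  simp only [shiftFun, Prod.fst_neg, Prod.snd_neg, inner_neg_right, sub_neg_eq_add, sub_add_cancel,
    inner_neg_left, inner_sub_right]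
  rw [← mul_assoc, ← mul_assoc, ← Complex.exp_add, ← Complex.exp_add, ← Complex.exp_add]
  convert one_mul _
  rw [← Complex.exp_zero, real_inner_comm z.1 z.2]
  congr 1
  push_cast
  ring

theorem inner_rho_neg (z : PhaseSpace d) (f g : L2 d) : ⟪g, rho (-z) f⟫_ℂ = ⟪rho z g, f⟫_ℂ := by
  rw [← inner_rho_rho z, rho_rho_neg]

/-- The symplectic form `σ(z, w) = ξ_z · x_w - x_z · ξ_w` on phase space. -/
noncomputable def symplectic : PhaseSpace d →ₗ[ℝ] PhaseSpace d →ₗ[ℝ] ℝ :=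
  LinearMap.mk₂ ℝ (fun z w => ⟪z.2, w.1⟫_ℝ - ⟪z.1, w.2⟫_ℝ)
    (fun a b c => by simp only [Prod.fst_add, Prod.snd_add, inner_add_left]; ring)
    (fun c a b => by
      simp only [Prod.smul_fst, Prod.smul_snd, real_inner_smul_left, smul_eq_mul]; ring)
    (fun a b c => by simp only [Prod.fst_add, Prod.snd_add, inner_add_right]; ring)
    (fun c a b => by
      simp only [Prod.smul_fst, Prod.smul_snd, real_inner_smul_right, smul_eq_mul]; ring)

theorem symplectic_apply (z w : PhaseSpace d) :
    symplectic z w = ⟪z.2, w.1⟫_ℝ - ⟪z.1, w.2⟫_ℝ := rfl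

theorem continuous_symplectic :
    Continuous fun q : PhaseSpace d × PhaseSpace d => symplectic q.1 q.2 := by
  simp only [symplectic_apply]
  fun_prop

theorem symplectic_ne_zero {z : PhaseSpace d} (hz : z ≠ 0) : symplectic z ≠ 0 := by
  intro h
  -- Against this partner the form takes the value `‖ξ‖² + ‖x‖²`.
  have h1 : symplectic z (z.2, -z.1) = 0 := by rw [h]; rfl
  simp only [symplectic_apply, inner_neg_right, sub_neg_eq_add] at h1
  have h2 := (add_eq_zero_iff_of_nonneg real_inner_self_nonneg real_inner_self_nonneg).1 h1
  exact hz (Prod.ext (inner_self_eq_zero.1 h2.2) (inner_self_eq_zero.1 h2.1))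

theorem rho_rho_comm (z w : PhaseSpace d) (f : L2 d) :
    rho z (rho w f) = Complex.exp (2 * Real.pi * Complex.I * (symplectic z w : ℝ)) •
      rho w (rho z f) := by
  refine Lp.ext ((coeFn_rho_rho z w f).trans ?_)
  filter_upwards [Lp.coeFn_smul (Complex.exp (2 * Real.pi * Complex.I * (symplectic z w : ℝ)))
    (rho w (rho z f)), coeFn_rho_rho w z f] with t h1 h2
  rw [h1, Pi.smul_apply, h2, smul_eq_mul]
  simp only [shiftFun, symplectic_apply, sub_right_comm t w.1 z.1, inner_sub_right]
  simp only [← mul_assoc, ← Complex.exp_add]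
  congr 2
  rw [real_inner_comm w.2 z.1]
  push_cast
  ring

/-- The (cross-)ambiguity function `z ↦ ⟨ρ(z) f, g⟩`. -/
noncomputable def ambig (f g : L2 d) (z : PhaseSpace d) : ℂ := ⟪g, rho z f⟫_ℂ

theorem ambig_eq_integral (f g : L2 d) (z : PhaseSpace d) :
    ambig f g z = ∫ t, ⟪g t, shiftFun z f t⟫_ℂ := by
  rw [ambig, L2.inner_def]
  refine integral_congr_ae ?_
  filter_upwards [coeFn_rho z f] with t ht
  rw [ht]

theorem norm_ambig_le (f g : L2 d) (z : PhaseSpace d) : ‖ambig f g z‖ ≤ ‖f‖ * ‖g‖ := by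
  refine (norm_inner_le_norm _ _).trans ?_
  rw [norm_rho, mul_comm]

theorem stronglyMeasurable_ambig (f g : L2 d) : StronglyMeasurable (ambig f g) := by
  have hf := Lp.stronglyMeasurable f
  have hg := Lp.stronglyMeasurable g
  have h : StronglyMeasurable (Function.uncurry fun (z : PhaseSpace d)
      (t : EuclideanSpace ℝ (Fin d)) => ⟪g t, shiftFun z f t⟫_ℂ) := by
    refine StronglyMeasurable.inner (hg.comp_measurable measurable_snd) ?_
    refine StronglyMeasurable.mul ?_ (hf.comp_measurable (by fun_prop))
    refine Continuous.stronglyMeasurable ?_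
    fun_prop
  have h2 := h.integral_prod_right (ν := (volume : Measure (EuclideanSpace ℝ (Fin d))))
  refine (funext fun z => ambig_eq_integral f g z) ▸ h2

open SchwartzMap FourierTransform in
/-- The function `t ↦ conj (g t) f (t - x)`. -/
noncomputable def tensorSlice (f g : 𝓢(EuclideanSpace ℝ (Fin d), ℂ))
    (x : EuclideanSpace ℝ (Fin d)) : 𝓢(EuclideanSpace ℝ (Fin d), ℂ) :=
  SchwartzMap.bilinLeftCLM (ContinuousLinearMap.mul ℝ ℂ)
    (SchwartzMap.hasTemperateGrowth (SchwartzMap.postcompCLM (𝕜 := ℝ)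
      (Complex.conjCLE : ℂ →L[ℝ] ℂ) g))
    (f.compSubConstCLM ℝ x)

open SchwartzMap FourierTransform

theorem tensorSlice_apply (f g : 𝓢(EuclideanSpace ℝ (Fin d), ℂ))
    (x t : EuclideanSpace ℝ (Fin d)) :
    tensorSlice f g x t = f (t - x) * (starRingEnd ℂ) (g t) := by
  simp [tensorSlice]

/-- For fixed `x` the ambiguity function is, up to a unimodular phase, the inverse Fourier transform
in `ξ` of a Schwartz function. -/
theorem enorm_ambig_schwartz (f g : 𝓢(EuclideanSpace ℝ (Fin d), ℂ)) (x ξ) :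
    ‖ambig (f.toLp 2 volume) (g.toLp 2 volume) (x, ξ)‖ₑ = ‖𝓕⁻ (tensorSlice f g x) ξ‖ₑ := by
  have h1 : ambig (f.toLp 2 volume) (g.toLp 2 volume) (x, ξ) =
      ∫ t, Complex.exp (-(Real.pi * Complex.I * (⟪x, ξ⟫_ℝ : ℝ))) *
        (Complex.exp (((2 * Real.pi * ⟪t, ξ⟫_ℝ : ℝ) : ℂ) * Complex.I) • tensorSlice f g x t) := by
    rw [ambig_eq_integral]
    refine integral_congr_ae ?_
    filter_upwards [g.coeFn_toLp 2 volume, shiftFun_congr_ae (x, ξ) (f.coeFn_toLp 2 volume)] with t h1 h2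
    rw [h1, h2, tensorSlice_apply, shiftFun, RCLike.inner_apply, smul_eq_mul, real_inner_comm ξ t]
    push_cast
    ring_nf
  rw [h1, integral_const_mul, enorm_mul, SchwartzMap.fourierInv_coe, Real.fourierInv_eq']
  have : ‖Complex.exp (-(Real.pi * Complex.I * (⟪x, ξ⟫_ℝ : ℝ)))‖ₑ = 1 := by
    rw [← ofReal_norm, Complex.norm_exp]
    simp
  rw [this, one_mul]

theorem eLpNorm_two_sq {α : Type*} [MeasurableSpace α] {μ : Measure α} (f : α → ℂ) :
    eLpNorm f 2 μ ^ 2 = ∫⁻ x, ‖f x‖ₑ ^ 2 ∂μ := by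
  have h := eLpNorm_nnreal_pow_eq_lintegral (f := f) (μ := μ) (p := 2) two_ne_zero
  simpa using h

theorem lintegral_fourierInv (h : 𝓢(EuclideanSpace ℝ (Fin d), ℂ)) :
    ∫⁻ ξ, ‖𝓕⁻ h ξ‖ₑ ^ 2 = ∫⁻ t, ‖h t‖ₑ ^ 2 := by
  have h1 := SchwartzMap.norm_fourier_toL2_eq (𝓕⁻ h)
  rw [← eLpNorm_two_sq, ← eLpNorm_two_sq]
  congr 1
  rw [FourierTransform.fourier_fourierInv_eq, SchwartzMap.norm_toLp, SchwartzMap.norm_toLp,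
    ENNReal.toReal_eq_toReal_iff' (h.memLp 2 volume).2.ne ((𝓕⁻ h).memLp 2 volume).2.ne] at h1
  exact h1.symm

/-- Plancherel in `ξ` for each `x`, then Tonelli and translation invariance in `x`. -/
theorem eLpNorm_ambig_schwartz (f g : 𝓢(EuclideanSpace ℝ (Fin d), ℂ)) :
    eLpNorm (ambig (f.toLp 2 volume) (g.toLp 2 volume)) 2 volume =
      eLpNorm f 2 volume * eLpNorm g 2 volume := by
  have hsq : eLpNorm (ambig (f.toLp 2 volume) (g.toLp 2 volume)) 2 volume ^ 2 =
      (eLpNorm f 2 volume * eLpNorm g 2 volume) ^ 2 := by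
    have hmeas : AEMeasurable (fun z => ‖ambig (f.toLp 2 volume) (g.toLp 2 volume) z‖ₑ ^ 2)
        ((volume : Measure (EuclideanSpace ℝ (Fin d))).prod volume) :=
      (stronglyMeasurable_ambig _ _).measurable.enorm.pow_const 2 |>.aemeasurable
    have hm2 : AEMeasurable (Function.uncurry fun x t : EuclideanSpace ℝ (Fin d) =>
        ‖f (t - x)‖ₑ ^ 2 * ‖g t‖ₑ ^ 2)
        ((volume : Measure (EuclideanSpace ℝ (Fin d))).prod volume) := by
      have hf := f.continuous
      have hg := g.continuous
      refine Measurable.aemeasurable ?_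
      simp only [Function.uncurry_def]
      fun_prop
    rw [eLpNorm_two_sq, Measure.volume_eq_prod, lintegral_prod _ hmeas]
    simp only [enorm_ambig_schwartz, lintegral_fourierInv, tensorSlice_apply, enorm_mul, mul_pow, RCLike.enorm_conj]
    rw [lintegral_lintegral_swap hm2, eLpNorm_two_sq, eLpNorm_two_sq, ← lintegral_const_mul'' _ (by
      exact (g.continuous.measurable.enorm.pow_const 2).aemeasurable)]
    refine lintegral_congr fun t => ?_
    have hft : Measurable fun x => ‖f (t - x)‖ₑ ^ 2 :=
      (f.continuous.comp (continuous_sub_left t)).measurable.enorm.pow_const 2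
    rw [lintegral_mul_const _ hft]
    congr 1
    exact lintegral_sub_left_eq_self (fun x => ‖f x‖ₑ ^ 2) t
  exact (ENNReal.pow_right_strictMono two_ne_zero).injective hsq

theorem exists_schwartz_seq (f : L2 d) : ∃ u : ℕ → 𝓢(EuclideanSpace ℝ (Fin d), ℂ),
    Tendsto (fun n => (u n).toLp 2 volume) atTop (𝓝 f) := by
  have h := SchwartzMap.denseRange_toLpCLM (E := EuclideanSpace ℝ (Fin d)) (F := ℂ)
    (p := 2) (μ := volume) (by simp)
  obtain ⟨v, hv, hlim⟩ := mem_closure_iff_seq_limit.1 (h f)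
  choose u hu using hv
  refine ⟨u, hlim.congr fun n => (hu n).symm⟩

theorem eLpNorm_toLp_schwartz (f : 𝓢(EuclideanSpace ℝ (Fin d), ℂ)) :
    eLpNorm f 2 volume = ‖f.toLp 2 volume‖ₑ := by
  rw [← ofReal_norm, SchwartzMap.norm_toLp, ENNReal.ofReal_toReal (f.memLp 2 volume).2.ne]

theorem tendsto_ambig {ι : Type*} {l : Filter ι} {u v : ι → L2 d} {f g : L2 d}
    (hu : Tendsto u l (𝓝 f)) (hv : Tendsto v l (𝓝 g)) (z : PhaseSpace d) :
    Tendsto (fun n => ambig (u n) (v n) z) l (𝓝 (ambig f g z)) :=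
  hv.inner (((rho z).continuous.tendsto f).comp hu)

/-- Fatou along Schwartz approximations gives only an inequality. It is enough to define `ambigLp`
and prove its joint continuity, after which `norm_ambigLp` recovers equality. -/
theorem eLpNorm_ambig_le (f g : L2 d) : eLpNorm (ambig f g) 2 volume ≤ ‖f‖ₑ * ‖g‖ₑ := by
  obtain ⟨u, hu⟩ := exists_schwartz_seq f
  obtain ⟨v, hv⟩ := exists_schwartz_seq g
  have h := Lp.eLpNorm_lim_le_liminf_eLpNorm (p := 2) (μ := (volume : Measure (PhaseSpace d)))
    (fun n => (stronglyMeasurable_ambig ((u n).toLp 2 volume) ((v n).toLp 2 volume)).aestronglyMeasurable)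
    (ambig f g) (Eventually.of_forall fun z => tendsto_ambig hu hv z)
  refine h.trans (le_of_eq (Tendsto.liminf_eq ?_))
  simp only [eLpNorm_ambig_schwartz, eLpNorm_toLp_schwartz]
  exact ENNReal.Tendsto.mul hu.enorm (Or.inr enorm_ne_top) hv.enorm (Or.inr enorm_ne_top)

theorem memLp_ambig (f g : L2 d) : MemLp (ambig f g) 2 (volume : Measure (PhaseSpace d)) :=
  ⟨(stronglyMeasurable_ambig f g).aestronglyMeasurable,
    (eLpNorm_ambig_le f g).trans_lt (ENNReal.mul_lt_top enorm_lt_top enorm_lt_top)⟩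

/-- The ambiguity function as an element of `L²` of phase space. -/
noncomputable def ambigLp (f g : L2 d) : Lp ℂ 2 (volume : Measure (PhaseSpace d)) :=
  (memLp_ambig f g).toLp (ambig f g)

theorem coeFn_ambigLp (f g : L2 d) : ambigLp f g =ᵐ[volume] ambig f g :=
  (memLp_ambig f g).coeFn_toLp

theorem ambigLp_add_left (f f' g : L2 d) :
    ambigLp (f + f') g = ambigLp f g + ambigLp f' g := by
  rw [ambigLp, ambigLp, ambigLp, ← MemLp.toLp_add]
  refine MemLp.toLp_congr _ _ (Eventually.of_forall fun z => ?_)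
  simp [ambig, inner_add_right]

theorem ambigLp_add_right (f g g' : L2 d) :
    ambigLp f (g + g') = ambigLp f g + ambigLp f g' := by
  rw [ambigLp, ambigLp, ambigLp, ← MemLp.toLp_add]
  refine MemLp.toLp_congr _ _ (Eventually.of_forall fun z => ?_)
  simp [ambig, inner_add_left]

theorem ambigLp_smul_left (c : ℂ) (f g : L2 d) : ambigLp (c • f) g = c • ambigLp f g := by
  rw [ambigLp, ambigLp, ← MemLp.toLp_const_smul]
  refine MemLp.toLp_congr _ _ (Eventually.of_forall fun z => ?_)
  simp [ambig, inner_smul_right]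

theorem ambigLp_smul_right (c : ℂ) (f g : L2 d) :
    ambigLp f (c • g) = (starRingEnd ℂ c) • ambigLp f g := by
  rw [ambigLp, ambigLp, ← MemLp.toLp_const_smul]
  refine MemLp.toLp_congr _ _ (Eventually.of_forall fun z => ?_)
  simp [ambig, inner_smul_left]

theorem norm_ambigLp_le (f g : L2 d) : ‖ambigLp f g‖ ≤ ‖f‖ * ‖g‖ := by
  rw [ambigLp, Lp.norm_toLp]
  refine ENNReal.toReal_le_of_le_ofReal (by positivity) ((eLpNorm_ambig_le f g).trans ?_)
  rw [ENNReal.ofReal_mul (norm_nonneg _), ofReal_norm, ofReal_norm]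

theorem norm_ambigLp_schwartz (f g : 𝓢(EuclideanSpace ℝ (Fin d), ℂ)) :
    ‖ambigLp (f.toLp 2 volume) (g.toLp 2 volume)‖ = ‖f.toLp 2 volume‖ * ‖g.toLp 2 volume‖ := by
  rw [ambigLp, Lp.norm_toLp, eLpNorm_ambig_schwartz, ENNReal.toReal_mul, ← SchwartzMap.norm_toLp,
    ← SchwartzMap.norm_toLp]

theorem tendsto_ambigLp {ι : Type*} {l : Filter ι} {u v : ι → L2 d} {f g : L2 d}
    (hu : Tendsto u l (𝓝 f)) (hv : Tendsto v l (𝓝 g)) :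
    Tendsto (fun n => ambigLp (u n) (v n)) l (𝓝 (ambigLp f g)) := by
  rw [tendsto_iff_norm_sub_tendsto_zero]
  have h : ∀ n, ambigLp (u n) (v n) - ambigLp f g =
      ambigLp (u n - f) (v n) + ambigLp f (v n - g) := by
    intro n
    have h1 := ambigLp_add_left (u n - f) f (v n)
    have h2 := ambigLp_add_right f (v n - g) g
    rw [sub_add_cancel] at h1 h2
    rw [h1, h2]
    abel
  refine squeeze_zero (fun _ => norm_nonneg _) (fun n => ?_)
    (g := fun n => ‖u n - f‖ * ‖v n‖ + ‖f‖ * ‖v n - g‖) ?_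
  · rw [h]
    exact (norm_add_le _ _).trans (add_le_add (norm_ambigLp_le _ _) (norm_ambigLp_le _ _))
  · have hu' := tendsto_iff_norm_sub_tendsto_zero.1 hu
    have hv' := tendsto_iff_norm_sub_tendsto_zero.1 hv
    simpa using (hu'.mul hv.norm).add (hv'.const_mul ‖f‖)

theorem norm_ambigLp (f g : L2 d) : ‖ambigLp f g‖ = ‖f‖ * ‖g‖ := by
  obtain ⟨u, hu⟩ := exists_schwartz_seq f
  obtain ⟨v, hv⟩ := exists_schwartz_seq g
  refine tendsto_nhds_unique (tendsto_ambigLp hu hv).norm ?_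
  simp only [norm_ambigLp_schwartz]
  exact hu.norm.mul hv.norm

/-- Polarisation: the vectors `x + y` and `x + i y` give `Q x y + Q y x = 0` and `i Q x y - i Q y x
= 0`. -/
theorem sesquilinear_eq_zero_of_diagonal {E : Type*} [AddCommGroup E] [Module ℂ E]
    (Q : E →ₗ⋆[ℂ] E →ₗ[ℂ] ℂ) (h : ∀ x, Q x x = 0) (x y : E) : Q x y = 0 := by
  have h1 := h (x + y)
  have h2 := h (x + Complex.I • y)
  simp only [map_add, LinearMap.add_apply, h, map_smul, LinearMap.map_smulₛₗ, LinearMap.smul_apply,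
    Complex.conj_I, smul_eq_mul] at h1 h2
  have h3 : Complex.I * Q x y - Complex.I * Q y x = 0 := by linear_combination h2
  have h4 : Complex.I * (2 * Q x y) = 0 := by linear_combination h3 + Complex.I * h1
  simpa using h4

/-- Moyal's identity. -/
theorem inner_ambigLp (f g f' g' : L2 d) :
    ⟪ambigLp f g, ambigLp f' g'⟫_ℂ = ⟪f, f'⟫_ℂ * ⟪g', g⟫_ℂ := by
  have hself : ∀ f g : L2 d, ⟪ambigLp f g, ambigLp f g⟫_ℂ = ⟪f, f⟫_ℂ * ⟪g, g⟫_ℂ := by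
    intro f g
    simp only [inner_self_eq_norm_sq_to_K, norm_ambigLp]
    push_cast
    ring
  -- The norm identity is polarised in the first argument with `g` fixed, then in the second.
  have hdiag : ∀ f f' g : L2 d, ⟪ambigLp f g, ambigLp f' g⟫_ℂ = ⟪f, f'⟫_ℂ * ⟪g, g⟫_ℂ := by
    intro f f' g
    let Q : L2 d →ₗ⋆[ℂ] L2 d →ₗ[ℂ] ℂ := LinearMap.mk₂'ₛₗ (starRingEnd ℂ) (RingHom.id ℂ)
      (fun f f' => ⟪ambigLp f g, ambigLp f' g⟫_ℂ - ⟪f, f'⟫_ℂ * ⟪g, g⟫_ℂ)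
      (fun a b c => by simp only [ambigLp_add_left, inner_add_left]; ring)
      (fun c a b => by simp only [ambigLp_smul_left, inner_smul_left, smul_eq_mul]; ring)
      (fun a b c => by simp only [ambigLp_add_left, inner_add_right]; ring)
      (fun c a b => by
        simp only [ambigLp_smul_left, inner_smul_right, smul_eq_mul, RingHom.id_apply]; ring)
    exact sub_eq_zero.1 (sesquilinear_eq_zero_of_diagonal Q
      (fun x => sub_eq_zero.2 (hself x g)) f f')
  -- Since `ambigLp` is conjugate linear in its second argument, `g'` is now the conjugate linear
  -- variable and comes first.
  let Q : L2 d →ₗ⋆[ℂ] L2 d →ₗ[ℂ] ℂ := LinearMap.mk₂'ₛₗ (starRingEnd ℂ) (RingHom.id ℂ)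
    (fun g' g => ⟪ambigLp f g, ambigLp f' g'⟫_ℂ - ⟪f, f'⟫_ℂ * ⟪g', g⟫_ℂ)
    (fun a b c => by simp only [ambigLp_add_right, inner_add_right, inner_add_left]; ring)
    (fun c a b => by
      simp only [ambigLp_smul_right, inner_smul_left, inner_smul_right, smul_eq_mul]; ring)
    (fun a b c => by simp only [ambigLp_add_right, inner_add_right, inner_add_left]; ring)
    (fun c a b => by
      simp only [ambigLp_smul_right, inner_smul_left, inner_smul_right, smul_eq_mul,
        RingHom.id_apply, Complex.conj_conj]; ring)
  exact sub_eq_zero.1 (sesquilinear_eq_zero_of_diagonal Q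
    (fun x => sub_eq_zero.2 (hdiag f f' x)) g' g)

end TimeFrequencyShifts

/-! ### Totality of ambiguity functions in `L²` of phase space -/

section Totality

variable {d : ℕ}

instance : Nontrivial (L2 d) := by
  have hpos : (volume : Measure (EuclideanSpace ℝ (Fin d))) (Metric.ball 0 1) ≠ 0 :=
    (Metric.measure_ball_pos volume 0 one_pos).ne'
  have hfin : (volume : Measure (EuclideanSpace ℝ (Fin d))) (Metric.ball 0 1) ≠ ∞ :=
    measure_ball_lt_top.ne
  refine ⟨indicatorConstLp 2 measurableSet_ball hfin 1, 0, fun h => ?_⟩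
  have h2 := norm_indicatorConstLp (p := 2) (c := (1 : ℂ)) (hs := measurableSet_ball)
    (hμs := hfin) two_ne_zero ENNReal.ofNat_ne_top
  rw [h, norm_zero, norm_one, one_mul, eq_comm, Real.rpow_eq_zero (by positivity) (by simp),
    measureReal_eq_zero_iff hfin] at h2
  exact hpos h2

/-- Ambiguity functions do not vanish simultaneously on a set of positive measure. -/
theorem ae_of_forall_ambig {P : PhaseSpace d → Prop}
    (h : ∀ f g : L2 d, ∀ᵐ z, ambig f g z ≠ 0 → P z) : ∀ᵐ z, P z := by
  have : Fact ((2 : ℝ≥0∞) ≠ ∞) := ⟨ENNReal.ofNat_ne_top⟩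
  obtain ⟨f, hf⟩ := exists_ne (0 : L2 d)
  -- A countable dense family keeps the union of the exceptional sets null. If all these
  -- coefficients vanish at `z`, then `rho z f = 0`, against `‖rho z f‖ = ‖f‖ ≠ 0`.
  have h1 : ∀ᵐ z, ∀ n, ambig f (TopologicalSpace.denseSeq (L2 d) n) z ≠ 0 → P z :=
    ae_all_iff.2 fun n => h f _
  filter_upwards [h1] with z hz
  by_contra hP
  have h2 : ∀ g : L2 d, ⟪g, rho z f⟫_ℂ = 0 := by
    refine isClosed_property (TopologicalSpace.denseRange_denseSeq (L2 d))
      (isClosed_eq (by fun_prop) continuous_const) fun n => ?_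
    by_contra h0
    exact hP (hz n h0)
  have h3 := h2 (rho z f)
  rw [inner_self_eq_zero, ← norm_eq_zero, norm_rho, norm_eq_zero] at h3
  exact hf h3

theorem fourierChar_ne_one : Real.fourierChar ≠ 1 := by
  intro h
  have h1 : (Real.fourierChar (1 / 2) : ℂ) = 1 := by rw [h]; rfl
  rw [Real.fourierChar_apply] at h1
  have h2 : (((2 * Real.pi * (1 / 2) : ℝ) : ℂ)) * Complex.I = Real.pi * Complex.I := by
    push_cast; ring
  rw [h2, Complex.exp_pi_mul_I] at h1
  norm_num at h1

/-- The characters `z ↦ e^{2π i σ(z, w)}` of phase space. -/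
noncomputable def sympChar (z w : PhaseSpace d) : ℂ :=
  Complex.exp (2 * Real.pi * Complex.I * (symplectic z w : ℝ))

theorem char_eq_sympChar (z w : PhaseSpace d) :
    BoundedContinuousFunction.char Real.continuous_fourierChar continuous_symplectic w z =
      sympChar z w := by
  rw [BoundedContinuousFunction.char_apply, Real.fourierChar_apply, sympChar]
  congr 1
  push_cast
  ring

theorem norm_sympChar (z w : PhaseSpace d) : ‖sympChar z w‖ = 1 := by
  simp [sympChar, Complex.norm_exp]

theorem conj_sympChar (z w : PhaseSpace d) :
    (starRingEnd ℂ) (sympChar z w) = sympChar z (-w) := by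
  rw [sympChar, sympChar, ← Complex.exp_conj]
  congr 1
  simp only [map_mul, Complex.conj_ofReal, Complex.conj_I, map_ofNat, map_neg, Complex.ofReal_neg]
  ring

theorem integrable_sympChar_mul {F : PhaseSpace d → ℂ} (hF : Integrable F) (w : PhaseSpace d) :
    Integrable fun z => sympChar z w * F z := by
  refine hF.bdd_mul (c := 1) ?_ (Eventually.of_forall fun z => (norm_sympChar z w).le)
  refine Continuous.aestronglyMeasurable (Complex.continuous_exp.comp (continuous_const.mul
    (Complex.continuous_ofReal.comp (continuous_symplectic.comp (Continuous.prodMk_left w)))))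

/-- The positive and negative parts of `G` are densities of finite measures with equal
characteristic functions, so the measures, and hence the densities, agree. -/
theorem ae_eq_zero_of_symplectic_fourier_real {G : PhaseSpace d → ℝ} (hG : Integrable G)
    (h : ∀ w, ∫ z, sympChar z w * G z = 0) : G =ᵐ[volume] 0 := by
  have hfin : ∀ {G : PhaseSpace d → ℝ}, Integrable G → ∫⁻ z, ENNReal.ofReal (G z) ≠ ∞ :=
    fun hG => hG.lintegral_lt_top.ne
  have hm1 : AEMeasurable (fun z => ENNReal.ofReal (G z)) := hG.1.aemeasurable.ennreal_ofReal
  have hm2 : AEMeasurable (fun z => ENNReal.ofReal (-G z)) :=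
    hG.neg.1.aemeasurable.ennreal_ofReal
  have hf1 : IsFiniteMeasure ((volume : Measure (PhaseSpace d)).withDensity
      fun z => ENNReal.ofReal (G z)) := isFiniteMeasure_withDensity (hfin hG)
  have hf2 : IsFiniteMeasure ((volume : Measure (PhaseSpace d)).withDensity
      fun z => ENNReal.ofReal (-G z)) := isFiniteMeasure_withDensity (hfin hG.neg)
  have key : (volume : Measure (PhaseSpace d)).withDensity (fun z => ENNReal.ofReal (G z)) =
      volume.withDensity (fun z => ENNReal.ofReal (-G z)) := by
    refine ext_of_integral_char_eq Real.continuous_fourierChar fourierChar_ne_one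
      (fun v hv => symplectic_ne_zero hv) continuous_symplectic fun w => ?_
    rw [integral_withDensity_eq_integral_toReal_smul₀ hm1
        (Eventually.of_forall fun _ => ENNReal.ofReal_lt_top),
      integral_withDensity_eq_integral_toReal_smul₀ hm2
        (Eventually.of_forall fun _ => ENNReal.ofReal_lt_top), ← sub_eq_zero]
    have e1 : ∀ {G : PhaseSpace d → ℝ}, Integrable G → Integrable fun z =>
        (ENNReal.ofReal (G z)).toReal • (BoundedContinuousFunction.char
          Real.continuous_fourierChar continuous_symplectic w z : ℂ) := by
      intro G hG
      have h1 : Integrable fun z => (((ENNReal.ofReal (G z)).toReal : ℝ) : ℂ) :=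
        hG.real_toNNReal.ofReal
      refine (integrable_sympChar_mul h1 w).congr (Eventually.of_forall fun z => ?_)
      simp only [char_eq_sympChar, Complex.real_smul]
      ring
    have e2 := e1 hG.neg
    simp only [Pi.neg_apply] at e2
    rw [← integral_sub (e1 hG) e2, ← h w]
    refine integral_congr_ae (Eventually.of_forall fun z => ?_)
    simp only [char_eq_sympChar, Complex.real_smul, ENNReal.toReal_ofReal',
      ← sub_mul, mul_comm _ (G z : ℂ)]
    congr 1
    rw [← Complex.ofReal_sub]
    congr 1
    rcases le_total 0 (G z) with h0 | h0
    · rw [max_eq_left h0, max_eq_right (by linarith), sub_zero]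
    · rw [max_eq_right h0, max_eq_left (by linarith)]; ring
  rw [withDensity_eq_iff hm1 hm2 (hfin hG)] at key
  filter_upwards [key] with z hz
  have h1 := congrArg ENNReal.toReal hz
  simp only [ENNReal.toReal_ofReal'] at h1
  rcases le_total 0 (G z) with h0 | h0
  · rw [max_eq_left h0, max_eq_right (by linarith)] at h1
    exact h1
  · rw [max_eq_right h0, max_eq_left (by linarith)] at h1
    change G z = 0
    linarith

/-- The transform of the conjugate of `F` at `w` is the conjugate of that of `F` at `-w`, so real
and imaginary parts also have vanishing transform. -/
theorem ae_eq_zero_of_symplectic_fourier {F : PhaseSpace d → ℂ} (hF : Integrable F)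
    (h : ∀ w, ∫ z, sympChar z w * F z = 0) : F =ᵐ[volume] 0 := by
  have hc : ∀ w, ∫ z, sympChar z w * (starRingEnd ℂ) (F z) = 0 := by
    intro w
    have h1 := congrArg (starRingEnd ℂ) (h (-w))
    rw [← integral_conj, map_zero] at h1
    rw [← h1]
    refine integral_congr_ae (Eventually.of_forall fun z => ?_)
    simp only [map_mul, conj_sympChar, neg_neg]
  have hFc : Integrable fun z => (starRingEnd ℂ) (F z) :=
    Complex.conjLIE.toContinuousLinearEquiv.integrable_comp_iff.2 hF
  have hre : (fun z => (F z).re) =ᵐ[volume] 0 := by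
    refine ae_eq_zero_of_symplectic_fourier_real hF.re fun w => ?_
    have h1 : ∫ z, (sympChar z w * F z +
        sympChar z w * (starRingEnd ℂ) (F z)) = 0 := by
      rw [integral_add (integrable_sympChar_mul hF w)
        (integrable_sympChar_mul hFc w), h, hc, add_zero]
    have h2 := congrArg (fun x => (2⁻¹ : ℂ) * x) h1
    simp only [mul_zero] at h2
    rw [← h2, ← integral_const_mul]
    refine integral_congr_ae (Eventually.of_forall fun z => ?_)
    simp only [← mul_add, Complex.add_conj]
    push_cast
    ring
  have him : (fun z => (F z).im) =ᵐ[volume] 0 := by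
    refine ae_eq_zero_of_symplectic_fourier_real hF.im fun w => ?_
    have h1 : ∫ z, (sympChar z w * F z -
        sympChar z w * (starRingEnd ℂ) (F z)) = 0 := by
      rw [integral_sub (integrable_sympChar_mul hF w)
        (integrable_sympChar_mul hFc w), h, hc, sub_zero]
    have h2 := congrArg (fun x => (2 * Complex.I)⁻¹ * x) h1
    simp only [mul_zero] at h2
    rw [← h2, ← integral_const_mul]
    refine integral_congr_ae (Eventually.of_forall fun z => ?_)
    simp only [← mul_sub, Complex.sub_conj]
    have hI := Complex.I_ne_zero
    push_cast
    field_simp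
  filter_upwards [hre, him] with z h1 h2
  exact Complex.ext h1 h2

/-- By the commutation relation, shifting both arguments multiplies the ambiguity function by a
character. Totality thereby reduces to Fourier uniqueness. -/
theorem ambig_rho_rho (w : PhaseSpace d) (f g : L2 d) (z : PhaseSpace d) :
    ambig (rho w f) (rho w g) z =
      sympChar z w * ambig f g z := by
  rw [ambig, rho_rho_comm, inner_smul_right, inner_rho_rho, ambig, sympChar]

/-- Ambiguity functions are total in `L²` of phase space. -/
theorem eq_zero_of_forall_inner_ambigLp {Ψ : Lp ℂ 2 (volume : Measure (PhaseSpace d))}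
    (h : ∀ f g : L2 d, ⟪Ψ, ambigLp f g⟫_ℂ = 0) : Ψ = 0 := by
  refine (Lp.eq_zero_iff_ae_eq_zero).2 (ae_of_forall_ambig fun f g => ?_)
  have hint : ∀ f g : L2 d, Integrable fun z => ambig f g z * (starRingEnd ℂ) (Ψ z) := by
    intro f g
    refine (L2.integrable_inner (𝕜 := ℂ) Ψ (ambigLp f g)).congr ?_
    filter_upwards [coeFn_ambigLp f g] with z hz
    rw [hz, RCLike.inner_apply]
  -- Testing `Ψ` on the shifted pairs `rho w f`, `rho w g` computes the symplectic Fourier transform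
  -- of `ambig f g` times the conjugate of `Ψ`.
  have h0 := ae_eq_zero_of_symplectic_fourier (hint f g) fun w => ?_
  · filter_upwards [h0] with z hz hne
    simpa [hne] using hz
  · rw [← h (rho w f) (rho w g), L2.inner_def]
    refine integral_congr_ae ?_
    filter_upwards [coeFn_ambigLp (rho w f) (rho w g)] with z hz
    rw [hz, RCLike.inner_apply, ambig_rho_rho, mul_assoc]

end Totality

/-- A bounded family in a Hilbert space converges weakly if it does so when tested against a total
set. -/
theorem tendsto_inner_of_total {E : Type*} [NormedAddCommGroup E] [InnerProductSpace ℂ E]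
    [CompleteSpace E] {S : Set E} (hS : ∀ x : E, (∀ y ∈ S, ⟪x, y⟫_ℂ = 0) → x = 0)
    {ι : Type*} {l : Filter ι} {u : ι → E} {C : ℝ} (hu : ∀ n, ‖u n‖ ≤ C) {x : E}
    (h : ∀ y ∈ S, Tendsto (fun n => ⟪u n, y⟫_ℂ) l (𝓝 ⟪x, y⟫_ℂ)) (y : E) :
    Tendsto (fun n => ⟪u n, y⟫_ℂ) l (𝓝 ⟪x, y⟫_ℂ) := by
  have hspan : ∀ y ∈ Submodule.span ℂ S, Tendsto (fun n => ⟪u n, y⟫_ℂ) l (𝓝 ⟪x, y⟫_ℂ) := by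
    intro y hy
    induction hy using Submodule.span_induction with
    | mem y hy => exact h y hy
    | zero => simpa only [inner_zero_right] using tendsto_const_nhds
    | add a b _ _ ha hb => simpa only [inner_add_right] using ha.add hb
    | smul c a _ ha => simpa only [inner_smul_right] using ha.const_mul c
  have hdense : Dense (Submodule.span ℂ S : Set E) := by
    rw [Submodule.dense_iff_topologicalClosure_eq_top, Submodule.topologicalClosure_eq_top_iff,
      Submodule.eq_bot_iff]
    exact fun v hv => hS v fun y hy =>
      Submodule.inner_left_of_mem_orthogonal (Submodule.subset_span hy) hv
  rw [Metric.tendsto_nhds]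
  intro ε hε
  -- `M` bounds every `‖u n - x‖`; the summand `1` keeps it positive.
  set M := |C| + ‖x‖ + 1 with hM
  have hMpos : 0 < M := by positivity
  obtain ⟨y', hy', hd⟩ := Metric.mem_closure_iff.1 (hdense y) (ε / (2 * M)) (by positivity)
  filter_upwards [Metric.tendsto_nhds.1 (hspan y' hy') (ε / 2) (by positivity)] with n hn
  have h1 : ⟪u n, y⟫_ℂ - ⟪x, y⟫_ℂ = ⟪u n - x, y - y'⟫_ℂ + (⟪u n, y'⟫_ℂ - ⟪x, y'⟫_ℂ) := by
    simp only [inner_sub_left, inner_sub_right]; ring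
  rw [dist_eq_norm] at hn hd ⊢
  rw [h1]
  have h2 : ‖⟪u n - x, y - y'⟫_ℂ‖ ≤ M * (ε / (2 * M)) := by
    refine (norm_inner_le_norm _ _).trans (mul_le_mul ?_ hd.le (norm_nonneg _) hMpos.le)
    have := (hu n).trans (le_abs_self C)
    linarith [norm_sub_le (u n) x]
  have h3 : M * (ε / (2 * M)) = ε / 2 := by field_simp
  linarith [norm_add_le ⟪u n - x, y - y'⟫_ℂ (⟪u n, y'⟫_ℂ - ⟪x, y'⟫_ℂ)]

/-! ### Multiplication by bounded symbols on `L²` -/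

section SymbolMultiplication

variable {d : ℕ}

theorem memLp_symbol_mul {m : Symbols d} (hm : m ∈ Lp ℂ ∞ (volume : Measure (PhaseSpace d)))
    {F : PhaseSpace d → ℂ} (hF : MemLp F 2 (volume : Measure (PhaseSpace d))) :
    MemLp (fun z => m z * F z) 2 (volume : Measure (PhaseSpace d)) :=
  hF.mul (Lp.mem_Lp_iff_memLp.1 hm)

/-- Multiplication by a bounded symbol on `L²` of phase space. -/
noncomputable def mulLp (m : Symbols d) (hm : m ∈ Lp ℂ ∞ (volume : Measure (PhaseSpace d)))
    (Φ : Lp ℂ 2 (volume : Measure (PhaseSpace d))) : Lp ℂ 2 (volume : Measure (PhaseSpace d)) :=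
  (memLp_symbol_mul hm (Lp.memLp Φ)).toLp _

theorem coeFn_mulLp {m : Symbols d} (hm : m ∈ Lp ℂ ∞ (volume : Measure (PhaseSpace d)))
    (Φ : Lp ℂ 2 (volume : Measure (PhaseSpace d))) :
    mulLp m hm Φ =ᵐ[volume] fun z => m z * Φ z :=
  (memLp_symbol_mul hm (Lp.memLp Φ)).coeFn_toLp

theorem integrable_mul_mul_conj {m : Symbols d}
    (hm : m ∈ Lp ℂ ∞ (volume : Measure (PhaseSpace d)))
    (Ψ Φ : Lp ℂ 2 (volume : Measure (PhaseSpace d))) :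
    Integrable fun z => m z * (Φ z * (starRingEnd ℂ) (Ψ z)) := by
  refine (L2.integrable_inner (𝕜 := ℂ) Ψ (mulLp m hm Φ)).congr ?_
  filter_upwards [coeFn_mulLp hm Φ] with z hz
  rw [hz, RCLike.inner_apply, mul_assoc]

theorem inner_mulLp {m : Symbols d} (hm : m ∈ Lp ℂ ∞ (volume : Measure (PhaseSpace d)))
    (Ψ Φ : Lp ℂ 2 (volume : Measure (PhaseSpace d))) :
    ⟪Ψ, mulLp m hm Φ⟫_ℂ = ∫ z, m z * (Φ z * (starRingEnd ℂ) (Ψ z)) := by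
  rw [L2.inner_def]
  refine integral_congr_ae ?_
  filter_upwards [coeFn_mulLp hm Φ] with z hz
  rw [hz, RCLike.inner_apply, mul_assoc]

theorem inner_ambigLp_mulLp {m : Symbols d}
    (hm : m ∈ Lp ℂ ∞ (volume : Measure (PhaseSpace d))) (η e f g : L2 d) :
    ⟪ambigLp η e, mulLp m hm (ambigLp f g)⟫_ℂ =
      ∫ z, m z * (ambig f g z * (starRingEnd ℂ) (ambig η e z)) := by
  rw [inner_mulLp]
  refine integral_congr_ae ?_
  filter_upwards [coeFn_ambigLp f g, coeFn_ambigLp η e] with z h1 h2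
  rw [h1, h2]

theorem ae_norm_le_of_mem_Lp {m : Symbols d}
    (hm : m ∈ Lp ℂ ∞ (volume : Measure (PhaseSpace d))) : ∃ C, ∀ᵐ z, ‖m z‖ ≤ C := by
  have h := Lp.mem_Lp_iff_memLp.1 hm
  refine ⟨(eLpNorm m ∞ volume).toReal, ?_⟩
  have h2 := ae_le_eLpNormEssSup (f := m) (μ := volume)
  filter_upwards [h2] with z hz
  rw [← eLpNorm_exponent_top] at hz
  rw [← toReal_enorm]
  exact ENNReal.toReal_mono h.2.ne hz

theorem mem_Lp_of_ae_norm_le {m : Symbols d} {C : ℝ} (h : ∀ᵐ z, ‖m z‖ ≤ C) :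
    m ∈ Lp ℂ ∞ (volume : Measure (PhaseSpace d)) :=
  Lp.mem_Lp_iff_memLp.2 (memLp_top_of_bound m.aestronglyMeasurable C h)

theorem mul_mem_Lp {m₁ m₂ : Symbols d} (h₁ : m₁ ∈ Lp ℂ ∞ (volume : Measure (PhaseSpace d)))
    (h₂ : m₂ ∈ Lp ℂ ∞ (volume : Measure (PhaseSpace d))) :
    m₁ * m₂ ∈ Lp ℂ ∞ (volume : Measure (PhaseSpace d)) := by
  obtain ⟨C₁, hC₁⟩ := ae_norm_le_of_mem_Lp h₁
  obtain ⟨C₂, hC₂⟩ := ae_norm_le_of_mem_Lp h₂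
  refine mem_Lp_of_ae_norm_le (C := C₁ * C₂) ?_
  filter_upwards [hC₁, hC₂, AEEqFun.coeFn_mul m₁ m₂] with z a b c
  rw [c, Pi.mul_apply, norm_mul]
  exact mul_le_mul a b (norm_nonneg _) ((norm_nonneg _).trans a)

/-- The complex conjugate of a symbol. -/
noncomputable def conjSymbol (m : Symbols d) : Symbols d :=
  AEEqFun.comp (starRingEnd ℂ) Complex.continuous_conj m

theorem coeFn_conjSymbol (m : Symbols d) :
    conjSymbol m =ᵐ[volume] fun z => (starRingEnd ℂ) (m z) :=
  AEEqFun.coeFn_comp _ _ _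

theorem conjSymbol_mem_Lp {m : Symbols d} (hm : m ∈ Lp ℂ ∞ (volume : Measure (PhaseSpace d))) :
    conjSymbol m ∈ Lp ℂ ∞ (volume : Measure (PhaseSpace d)) := by
  obtain ⟨C, hC⟩ := ae_norm_le_of_mem_Lp hm
  refine mem_Lp_of_ae_norm_le (C := C) ?_
  filter_upwards [hC, coeFn_conjSymbol m] with z a b
  rwa [b, RCLike.norm_conj]

theorem inner_mulLp_conjSymbol {m : Symbols d}
    (hm : m ∈ Lp ℂ ∞ (volume : Measure (PhaseSpace d)))
    (Ψ Φ : Lp ℂ 2 (volume : Measure (PhaseSpace d))) :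
    ⟪mulLp (conjSymbol m) (conjSymbol_mem_Lp hm) Ψ, Φ⟫_ℂ = ⟪Ψ, mulLp m hm Φ⟫_ℂ := by
  rw [inner_mulLp, L2.inner_def]
  refine integral_congr_ae ?_
  filter_upwards [coeFn_mulLp (conjSymbol_mem_Lp hm) Ψ, coeFn_conjSymbol m] with z h1 h2
  rw [h1, h2, RCLike.inner_apply, map_mul, Complex.conj_conj]
  ring

theorem inner_mulLp_mulLp {m₁ m₂ : Symbols d}
    (h₁ : m₁ ∈ Lp ℂ ∞ (volume : Measure (PhaseSpace d)))
    (h₂ : m₂ ∈ Lp ℂ ∞ (volume : Measure (PhaseSpace d)))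
    (Ψ Φ : Lp ℂ 2 (volume : Measure (PhaseSpace d))) :
    ⟪Ψ, mulLp (m₁ * m₂) (mul_mem_Lp h₁ h₂) Φ⟫_ℂ = ⟪Ψ, mulLp m₂ h₂ (mulLp m₁ h₁ Φ)⟫_ℂ := by
  rw [inner_mulLp, inner_mulLp]
  refine integral_congr_ae ?_
  filter_upwards [coeFn_mulLp h₁ Φ, AEEqFun.coeFn_mul m₁ m₂] with z a b
  rw [a, b, Pi.mul_apply]
  ring

end SymbolMultiplication

/-! ### Operators versus `L²` functions on phase space -/

section FourierWignerTransform

variable {d : ℕ}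

theorem trace_rankOne_comp {H : Type*} [NormedAddCommGroup H] [InnerProductSpace ℂ H]
    [CompleteSpace H] (e η : H) (B : H →L[ℂ] H) :
    trace (rankOne ℂ e η ∘L B) = ⟪η, B e⟫_ℂ := by
  rw [trace, ← ContinuousLinearMap.adjoint_inner_left,
    ← (exists_hilbertBasis ℂ H).choose_spec.choose.tsum_inner_mul_inner]
  refine tsum_congr fun i => ?_
  rw [ContinuousLinearMap.comp_apply, InnerProductSpace.rankOne_apply, inner_smul_right,
    ContinuousLinearMap.adjoint_inner_left]

/-- The trace collapses to a matrix coefficient of `rho (-z)`, the adjoint of `rho z`. This ties the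
trace definition to ambiguity functions. -/
theorem fourierWigner_rankOne (e η : L2 d) (z : PhaseSpace d) :
    fourierWigner (rankOne ℂ e η) z = (starRingEnd ℂ) (ambig η e z) := by
  rw [fourierWigner, trace_rankOne_comp, inner_rho_neg, ambig, inner_conj_symm]

/-- The `L²` functions on phase space whose conjugates are the Fourier–Wigner transforms of the
partial sums of a singular value decomposition. -/
noncomputable def svdAmbig (s : ℕ → ℝ) (e η : ℕ → L2 d) (N : ℕ) :
    Lp ℂ 2 (volume : Measure (PhaseSpace d)) :=
  ∑ k ∈ Finset.range N, (s k : ℂ) • ambigLp (η k) (e k)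

theorem inner_svdAmbig_left (s : ℕ → ℝ) (e η : ℕ → L2 d) (N : ℕ)
    (Φ : Lp ℂ 2 (volume : Measure (PhaseSpace d))) :
    ⟪svdAmbig s e η N, Φ⟫_ℂ = ∑ k ∈ Finset.range N, (s k : ℂ) * ⟪ambigLp (η k) (e k), Φ⟫_ℂ := by
  simp only [svdAmbig, sum_inner, inner_smul_left, Complex.conj_ofReal]

theorem inner_svdAmbig_ambigLp (s : ℕ → ℝ) (e η : ℕ → L2 d) (N : ℕ) (f g : L2 d) :
    ⟪svdAmbig s e η N, ambigLp f g⟫_ℂ = ⟪g, svdSum s e η N f⟫_ℂ := by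
  rw [inner_svdAmbig_left, svdSum_apply, inner_sum]
  refine Finset.sum_congr rfl fun k _ => ?_
  rw [inner_ambigLp, inner_smul_right]
  ring

/-- The Fourier–Wigner transform of a trace class operator is the `L²` limit of those of the partial
sums of its singular value decomposition. -/
theorem exists_fourierWigner_eq {T : L2 d →L[ℂ] L2 d} (hT1 : T ∈ schatten (L2 d) 1)
    {e η : ℕ → L2 d}
    (he : ∀ k l, ⟪e k, e l⟫_ℂ = if k = l ∧ singularValue T k ≠ 0 then 1 else 0)
    (hη : ∀ k l, ⟪η k, η l⟫_ℂ = if k = l ∧ singularValue T k ≠ 0 then 1 else 0)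
    (h : ∀ N m, singularValue (T - svdSum (singularValue T) e η N) m ≤ singularValue T (N + m)) :
    ∃ Θ : Lp ℂ 2 (volume : Measure (PhaseSpace d)),
      Tendsto (svdAmbig (singularValue T) e η) atTop (𝓝 Θ) ∧
      ∀ᵐ z, fourierWigner T z = (starRingEnd ℂ) (Θ z) := by
  have hc := isCompactOperator_of_tendsto_singularValue
    (tendsto_singularValue_of_mem_schatten ENNReal.one_ne_top hT1)
  have hs : Summable (singularValue T) := by
    have := (mem_schatten.1 hT1).summable (by simp)
    simpa [abs_of_nonneg (singularValue_nonneg _ _)] using this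
  have hbound : ∀ k, ‖η k‖ * ‖e k‖ ≤ 1 := fun k =>
    mul_le_one₀ (norm_le_one_of_inner hη k) (norm_nonneg _) (norm_le_one_of_inner he k)
  have hsumm : Summable fun k => (singularValue T k : ℂ) • ambigLp (η k) (e k) := by
    refine Summable.of_norm_bounded hs fun k => ?_
    rw [norm_smul, Complex.norm_real, Real.norm_of_nonneg (singularValue_nonneg _ _), norm_ambigLp]
    exact mul_le_of_le_one_right (singularValue_nonneg _ _) (hbound k)
  refine ⟨_, hsumm.hasSum.tendsto_sum_nat, ?_⟩
  set Θ := ∑' k, (singularValue T k : ℂ) • ambigLp (η k) (e k) with hΘ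
  have hlim : Tendsto (svdAmbig (singularValue T) e η) atTop (𝓝 Θ) := hsumm.hasSum.tendsto_sum_nat
  -- `L²` convergence gives almost everywhere convergence along a subsequence. The series for the
  -- trace converges absolutely at every `z`, so the two limits coincide.
  obtain ⟨φ, hφ, hae⟩ := (tendstoInMeasure_of_tendsto_Lp hlim).exists_seq_tendsto_ae
  have hcoe : ∀ᵐ z, ∀ N, svdAmbig (singularValue T) e η N z =
      ∑ k ∈ Finset.range N, (singularValue T k : ℂ) * ambig (η k) (e k) z := by
    refine ae_all_iff.2 fun N => ?_
    have h1 : ∀ᵐ z, ∀ k, ((singularValue T k : ℂ) • ambigLp (η k) (e k) :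
        Lp ℂ 2 (volume : Measure (PhaseSpace d))) z =
          (singularValue T k : ℂ) * ambig (η k) (e k) z := by
      refine ae_all_iff.2 fun k => ?_
      filter_upwards [Lp.coeFn_smul (singularValue T k : ℂ) (ambigLp (η k) (e k)),
        coeFn_ambigLp (η k) (e k)] with z a b
      rw [a, Pi.smul_apply, b, smul_eq_mul]
    filter_upwards [Lp.coeFn_finsetSum (Finset.range N)
      (fun k => (singularValue T k : ℂ) • ambigLp (η k) (e k)), h1] with z a b
    rw [svdAmbig, a, Finset.sum_apply]
    exact Finset.sum_congr rfl fun k _ => b k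
  filter_upwards [hae, hcoe] with z h1 h2
  have h3 : fourierWigner T z =
      ∑' k, (singularValue T k : ℂ) * (starRingEnd ℂ) (ambig (η k) (e k) z) := by
    rw [fourierWigner, trace_comp_eq_tsum hs (singularValue_nonneg T) (norm_le_one_of_inner he)
      (norm_le_one_of_inner hη) (tendsto_svdSum_apply hc h)]
    refine tsum_congr fun k => ?_
    rw [inner_rho_neg, ambig, inner_conj_symm]
  have h4 : Summable fun k => (singularValue T k : ℂ) * (starRingEnd ℂ) (ambig (η k) (e k) z) := by
    refine Summable.of_norm_bounded hs fun k => ?_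
    rw [norm_mul, Complex.norm_real, Real.norm_of_nonneg (singularValue_nonneg _ _),
      RCLike.norm_conj]
    exact mul_le_of_le_one_right (singularValue_nonneg _ _) ((norm_ambig_le _ _ _).trans (hbound k))
  rw [h3]
  refine tendsto_nhds_unique (h4.hasSum.tendsto_sum_nat.comp hφ.tendsto_atTop) ?_
  refine ((Complex.continuous_conj.tendsto _).comp h1).congr fun n => ?_
  simp only [Function.comp_apply, h2, map_sum, map_mul, Complex.conj_ofReal]

/-- A bounded operator whose matrix coefficients are given by an `L²` function on phase space is
compact. -/
theorem isCompactOperator_of_inner_eq {S : L2 d →L[ℂ] L2 d}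
    {Ψ : Lp ℂ 2 (volume : Measure (PhaseSpace d))}
    (h : ∀ f g, ⟪g, S f⟫_ℂ = ⟪Ψ, ambigLp f g⟫_ℂ) : IsCompactOperator S := by
  set V : Set (Lp ℂ 2 (volume : Measure (PhaseSpace d))) :=
    Set.range fun q : L2 d × L2 d => ambigLp q.1 q.2 with hV
  -- Combinations of ambiguity functions represent compact operators. The operator norm is at most
  -- the `L²` norm of the representing function, so density makes `S` a norm limit of compact
  -- operators.
  have hspan : ∀ Θ ∈ Submodule.span ℂ V, ∃ F : L2 d →L[ℂ] L2 d, IsCompactOperator F ∧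
      ∀ f g, ⟪g, F f⟫_ℂ = ⟪Θ, ambigLp f g⟫_ℂ := by
    intro Θ hΘ
    induction hΘ using Submodule.span_induction with
    | mem Θ hΘ =>
      obtain ⟨⟨η, e⟩, rfl⟩ := hΘ
      refine ⟨rankOne ℂ e η, isCompactOperator_rankOne e η, fun f g => ?_⟩
      rw [InnerProductSpace.rankOne_apply, inner_smul_right, inner_ambigLp]
    | zero => exact ⟨0, isCompactOperator_zero, fun f g => by simp⟩
    | add a b _ _ ha hb =>
      obtain ⟨F, hF, hF'⟩ := ha
      obtain ⟨G, hG, hG'⟩ := hb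
      refine ⟨F + G, hF.add hG, fun f g => ?_⟩
      rw [add_apply, inner_add_right, inner_add_left, hF', hG']
    | smul c a _ ha =>
      obtain ⟨F, hF, hF'⟩ := ha
      refine ⟨(starRingEnd ℂ) c • F, IsCompactOperator.smul hF ((starRingEnd ℂ) c), fun f g => ?_⟩
      rw [smul_apply, inner_smul_right, inner_smul_left, hF']
  have hdense : Dense (Submodule.span ℂ V : Set (Lp ℂ 2 (volume : Measure (PhaseSpace d)))) := by
    rw [Submodule.dense_iff_topologicalClosure_eq_top, Submodule.topologicalClosure_eq_top_iff,
      Submodule.eq_bot_iff]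
    exact fun v hv => eq_zero_of_forall_inner_ambigLp fun f g =>
      Submodule.inner_left_of_mem_orthogonal (Submodule.subset_span (Set.mem_range_self (f, g))) hv
  obtain ⟨u, hu, hlim⟩ := mem_closure_iff_seq_limit.1 (hdense Ψ)
  choose F hFc hF using fun n => hspan (u n) (hu n)
  refine isCompactOperator_of_tendsto (l := atTop) (F := F) ?_ (Eventually.of_forall hFc)
  rw [tendsto_iff_norm_sub_tendsto_zero] at hlim ⊢
  refine squeeze_zero (fun _ => norm_nonneg _) (fun n => ?_) hlim
  have hb : ∀ f g, ‖⟪g, (F n - S) f⟫_ℂ‖ ≤ ‖u n - Ψ‖ * (‖f‖ * ‖g‖) := by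
    intro f g
    rw [sub_apply, inner_sub_right, hF, h, ← inner_sub_left, ← norm_ambigLp]
    exact norm_inner_le_norm _ _
  refine ContinuousLinearMap.opNorm_le_of_re_inner_le (norm_nonneg _) fun f g hf hg => ?_
  rw [inner_re_symm]
  refine (RCLike.re_le_norm _).trans ((hb f g).trans ?_)
  rw [hf, hg, one_mul, mul_one]

end FourierWignerTransform

/-! ### Rank one operators in Schatten classes -/

section RankOne

variable {H : Type*} [NormedAddCommGroup H] [InnerProductSpace ℂ H]
  {p : ℝ≥0∞} [Fact (1 ≤ p)]

variable (p) in
/-- Rank one operators as elements of the Schatten class. -/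
noncomputable def rankOneS (e η : H) : schatten H p :=
  ⟨rankOne ℂ e η, rankOne_mem_schatten e η⟩

/-- Compactness lets `p = ∞` be included: there the decomposition converges in operator norm. -/
theorem tendsto_schattenNorm_svdSum_of_isCompactOperator [CompleteSpace H] (T : schatten H p)
    (hT : IsCompactOperator T.1) {e η : ℕ → H}
    (h : ∀ N m, singularValue (T.1 - svdSum (singularValue T.1) e η N) m ≤
      singularValue T.1 (N + m)) :
    Tendsto (fun N => schattenNorm
      (T - ⟨svdSum (singularValue T.1) e η N, svdSum_mem_schatten _ e η N⟩ : schatten H p))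
      atTop (𝓝 0) := by
  rcases eq_or_ne p ∞ with rfl | hp
  · have := (tendsto_svdSum hT h).const_sub T.1
    rw [sub_self] at this
    simpa only [schattenNorm_top, norm_zero, Submodule.coe_sub] using this.norm
  · exact tendsto_schattenNorm_svdSum hp T h

theorem norm_inner_le_schattenNorm (T : schatten H p) (f g : H) :
    ‖⟪g, T.1 f⟫_ℂ‖ ≤ schattenNorm T * (‖g‖ * ‖f‖) := by
  calc ‖⟪g, T.1 f⟫_ℂ‖ ≤ ‖g‖ * (‖T.1‖ * ‖f‖) :=
        (norm_inner_le_norm _ _).trans (by gcongr; exact T.1.le_opNorm f)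
    _ ≤ ‖g‖ * (schattenNorm T * ‖f‖) := by gcongr; exact norm_le_schattenNorm T
    _ = _ := by ring

theorem apply_svdSum (A : schatten H p →ₗ[ℂ] schatten H p) (s : ℕ → ℝ) (e η : ℕ → H) (N : ℕ) :
    A ⟨svdSum s e η N, svdSum_mem_schatten s e η N⟩ =
      ∑ k ∈ Finset.range N, (s k : ℂ) • A (rankOneS p (e k) (η k)) := by
  rw [← Finset.sum_congr rfl fun k _ => A.map_smul (s k : ℂ) (rankOneS p (e k) (η k)), ← map_sum]
  congr 1
  ext1
  simp only [svdSum, rankOneS, AddSubmonoidClass.coe_finsetSum, Submodule.coe_smul]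

end RankOne

/-! ### Extensions of `𝔗_m`: reduction to rank one operators and composition -/

section Extension

variable {d : ℕ} {p : ℝ≥0∞} [Fact (1 ≤ p)]

theorem tendsto_inner_apply_svdSum {A : schatten (L2 d) p →ₗ[ℂ] schatten (L2 d) p} {C : ℝ}
    (hA : IsSchattenBound A C) (T : schatten (L2 d) p) (hT : IsCompactOperator T.1)
    {e η : ℕ → L2 d}
    (h : ∀ N m, singularValue (T.1 - svdSum (singularValue T.1) e η N) m ≤
      singularValue T.1 (N + m)) (f g : L2 d) :
    Tendsto (fun N => ∑ k ∈ Finset.range N,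
      (singularValue T.1 k : ℂ) * ⟪g, (A (rankOneS p (e k) (η k))).1 f⟫_ℂ)
      atTop (𝓝 ⟪g, (A T).1 f⟫_ℂ) := by
  have hlim := ((tendsto_schattenNorm_svdSum_of_isCompactOperator T hT h).const_mul C).mul_const
    (‖g‖ * ‖f‖)
  rw [mul_zero, zero_mul] at hlim
  rw [tendsto_iff_norm_sub_tendsto_zero]
  refine squeeze_zero (fun _ => norm_nonneg _) (fun N => ?_) hlim
  have hsum : ∑ k ∈ Finset.range N,
      (singularValue T.1 k : ℂ) * ⟪g, (A (rankOneS p (e k) (η k))).1 f⟫_ℂ =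
      ⟪g, (A ⟨svdSum (singularValue T.1) e η N, svdSum_mem_schatten _ e η N⟩).1 f⟫_ℂ := by
    rw [apply_svdSum, AddSubmonoidClass.coe_finsetSum, sum_apply, inner_sum]
    refine Finset.sum_congr rfl fun k _ => ?_
    rw [Submodule.coe_smul, smul_apply, inner_smul_right]
  rw [hsum, norm_sub_rev, ← inner_sub_right, ← sub_apply, ← Submodule.coe_sub, ← map_sub]
  refine (norm_inner_le_schattenNorm _ f g).trans ?_
  gcongr
  exact hA.2 _

/-- The coefficients of a bounded multiplier operator on compact operators are obtained from those
on rank one operators. -/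
theorem tendsto_inner_svdAmbig_mulLp {m : Symbols d}
    (hm : m ∈ Lp ℂ ∞ (volume : Measure (PhaseSpace d)))
    {A : schatten (L2 d) p →ₗ[ℂ] schatten (L2 d) p} {C : ℝ} (hA : IsSchattenBound A C)
    (h : ∀ e η f g, ⟪ambigLp η e, mulLp m hm (ambigLp f g)⟫_ℂ = ⟪g, (A (rankOneS p e η)).1 f⟫_ℂ)
    (T : schatten (L2 d) p) (hT : IsCompactOperator T.1) {e η : ℕ → L2 d}
    (hs : ∀ N m, singularValue (T.1 - svdSum (singularValue T.1) e η N) m ≤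
      singularValue T.1 (N + m)) (f g : L2 d) :
    Tendsto (fun N => ⟪svdAmbig (singularValue T.1) e η N, mulLp m hm (ambigLp f g)⟫_ℂ)
      atTop (𝓝 ⟪g, (A T).1 f⟫_ℂ) := by
  refine (tendsto_inner_apply_svdSum hA T hT hs f g).congr fun N => ?_
  rw [inner_svdAmbig_left]
  exact Finset.sum_congr rfl fun k _ => by rw [h]

/-- A bounded operator extends `𝔗_m` as soon as it does so on rank one operators. -/
theorem extendsMultiplier_iff {m : Symbols d}
    (hm : m ∈ Lp ℂ ∞ (volume : Measure (PhaseSpace d)))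
    {A : schatten (L2 d) p →ₗ[ℂ] schatten (L2 d) p} {C : ℝ} (hA : IsSchattenBound A C) :
    ExtendsMultiplier m A ↔ ∀ e η f g : L2 d,
      ⟪ambigLp η e, mulLp m hm (ambigLp f g)⟫_ℂ = ⟪g, (A (rankOneS p e η)).1 f⟫_ℂ := by
  constructor
  · intro h e η f g
    rw [← (h (rankOneS p e η) (rankOne_mem_schatten e η) f g).2, inner_ambigLp_mulLp]
    refine integral_congr_ae (Eventually.of_forall fun z => ?_)
    simp only [rankOneS, fourierWigner_rankOne, ambig]
    ring
  · intro h T hT1 f g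
    have hc := isCompactOperator_of_tendsto_singularValue
      (tendsto_singularValue_of_mem_schatten ENNReal.one_ne_top hT1)
    obtain ⟨e, η, he, hη, -, hs⟩ := exists_svd hc
    -- Along the partial sums the Fourier–Wigner transforms converge in `L²`, while the values of
    -- `A` converge because the sums converge in `𝒮^p`. The integral and the coefficient of `A T`
    -- are limits of the same sequence.
    obtain ⟨Θ, hΘ, hae⟩ := exists_fourierWigner_eq hT1 he hη hs
    have heq : (fun z => m z * (ambigLp f g z * (starRingEnd ℂ) (Θ z))) =ᵐ[volume]
        fun z => m z * fourierWigner T.1 z * ⟪g, rho z f⟫_ℂ := by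
      filter_upwards [hae, coeFn_ambigLp f g] with z h1 h2
      rw [h1, h2, ambig]
      ring
    refine ⟨(integrable_mul_mul_conj hm Θ (ambigLp f g)).congr heq, ?_⟩
    rw [← integral_congr_ae heq, ← inner_mulLp hm]
    exact tendsto_nhds_unique (hΘ.inner tendsto_const_nhds)
      (tendsto_inner_svdAmbig_mulLp hm hA h T hc hs f g)

theorem IsSchattenBound.comp {A₁ A₂ : schatten (L2 d) p →ₗ[ℂ] schatten (L2 d) p} {C₁ C₂ : ℝ}
    (h₁ : IsSchattenBound A₁ C₁) (h₂ : IsSchattenBound A₂ C₂) :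
    IsSchattenBound (A₁ ∘ₗ A₂) (C₁ * C₂) := by
  refine ⟨mul_nonneg h₁.1 h₂.1, fun T => (h₁.2 _).trans ?_⟩
  rw [mul_assoc]
  exact mul_le_mul_of_nonneg_left (h₂.2 T) h₁.1

theorem IsSchattenBound.add {A₁ A₂ : schatten (L2 d) p →ₗ[ℂ] schatten (L2 d) p} {C₁ C₂ : ℝ}
    (h₁ : IsSchattenBound A₁ C₁) (h₂ : IsSchattenBound A₂ C₂) :
    IsSchattenBound (A₁ + A₂) (C₁ + C₂) := by
  refine ⟨add_nonneg h₁.1 h₂.1, fun T => (schattenNorm_add_le _ _).trans ?_⟩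
  rw [add_mul]
  exact add_le_add (h₁.2 T) (h₂.2 T)

theorem IsSchattenBound.smul {A : schatten (L2 d) p →ₗ[ℂ] schatten (L2 d) p} {C : ℝ}
    (h : IsSchattenBound A C) (c : ℂ) : IsSchattenBound (c • A) (‖c‖ * C) := by
  refine ⟨mul_nonneg (norm_nonneg c) h.1, fun T => ?_⟩
  rw [LinearMap.smul_apply, schattenNorm_smul, mul_assoc]
  exact mul_le_mul_of_nonneg_left (h.2 T) (norm_nonneg c)

theorem isSchattenBound_id :
    IsSchattenBound (LinearMap.id : schatten (L2 d) p →ₗ[ℂ] schatten (L2 d) p) 1 :=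
  ⟨zero_le_one, fun T => by rw [one_mul, LinearMap.id_apply]⟩

/-- `S` and its partial sum agree on `η k` for `k < N`, which gives `⟪Θ, Θ⟫ = ⟪Ψ, Θ⟫`;
Cauchy–Schwarz finishes. The uniform bound is what weak convergence in the composition argument
requires. -/
theorem norm_svdAmbig_le {S : L2 d →L[ℂ] L2 d} {Ψ : Lp ℂ 2 (volume : Measure (PhaseSpace d))}
    (hΨ : ∀ f g, ⟪g, S f⟫_ℂ = ⟪Ψ, ambigLp f g⟫_ℂ) {e η : ℕ → L2 d}
    (hη : ∀ k l, ⟪η k, η l⟫_ℂ = if k = l ∧ singularValue S k ≠ 0 then 1 else 0)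
    (hS : ∀ k, S (η k) = (singularValue S k : ℂ) • e k) (N : ℕ) :
    ‖svdAmbig (singularValue S) e η N‖ ≤ ‖Ψ‖ := by
  set Θ := svdAmbig (singularValue S) e η N with hΘ
  have hk : ∀ k ∈ Finset.range N, svdSum (singularValue S) e η N (η k) = S (η k) := by
    intro k hk
    rw [svdSum_apply, hS, Finset.sum_eq_single_of_mem k hk]
    · rw [hη]
      by_cases h0 : singularValue S k = 0 <;> simp [h0]
    · intro j _ hjk
      rw [hη, if_neg (fun h => hjk h.1), mul_zero, zero_smul]
  have hinner : ⟪Θ, Θ⟫_ℂ = ⟪Ψ, Θ⟫_ℂ := by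
    suffices ⟪Θ, svdAmbig (singularValue S) e η N⟫_ℂ = ⟪Ψ, svdAmbig (singularValue S) e η N⟫_ℂ from
      this
    rw [svdAmbig, inner_sum, inner_sum]
    refine Finset.sum_congr rfl fun k hkN => ?_
    rw [inner_smul_right, inner_smul_right, hΘ, inner_svdAmbig_ambigLp, hk k hkN, hΨ]
  have h2 : ‖Θ‖ * ‖Θ‖ ≤ ‖Ψ‖ * ‖Θ‖ := by
    have h3 : ‖⟪Θ, Θ⟫_ℂ‖ = ‖Θ‖ * ‖Θ‖ := by
      rw [inner_self_eq_norm_sq_to_K]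
      simp [sq]
    rw [← h3, hinner]
    exact norm_inner_le_norm _ _
  rcases (norm_nonneg Θ).eq_or_lt with h0 | h0
  · rw [← h0]; exact norm_nonneg _
  · exact le_of_mul_le_mul_right h2 h0

/-- Composites of bounded extensions of `𝔗_{m₁}` and `𝔗_{m₂}` extend `𝔗_{m₁ m₂}`. -/
theorem ExtendsMultiplier.comp {m₁ m₂ : Symbols d}
    (hm₁ : m₁ ∈ Lp ℂ ∞ (volume : Measure (PhaseSpace d)))
    (hm₂ : m₂ ∈ Lp ℂ ∞ (volume : Measure (PhaseSpace d)))
    {A₁ A₂ : schatten (L2 d) p →ₗ[ℂ] schatten (L2 d) p} {C₁ C₂ : ℝ}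
    (hA₁ : IsSchattenBound A₁ C₁) (hA₂ : IsSchattenBound A₂ C₂)
    (h₁ : ExtendsMultiplier m₁ A₁) (h₂ : ExtendsMultiplier m₂ A₂) :
    ExtendsMultiplier (m₁ * m₂) (A₁ ∘ₗ A₂) := by
  rw [extendsMultiplier_iff hm₁ hA₁] at h₁
  rw [extendsMultiplier_iff hm₂ hA₂] at h₂
  rw [extendsMultiplier_iff (mul_mem_Lp hm₁ hm₂) (hA₁.comp hA₂)]
  intro e η f g
  set S : schatten (L2 d) p := A₂ (rankOneS p e η) with hSdef
  -- `Ψ` is the `L²` function representing `S`; the symbol is conjugated because `Ψ` stands in the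
  -- conjugate linear slot.
  set Ψ := mulLp (conjSymbol m₂) (conjSymbol_mem_Lp hm₂) (ambigLp η e) with hΨdef
  have hΨ : ∀ f g, ⟪g, S.1 f⟫_ℂ = ⟪Ψ, ambigLp f g⟫_ℂ := by
    intro f g
    rw [hΨdef, inner_mulLp_conjSymbol hm₂, h₂]
  -- Compactness holds also for `p = ∞`, so `A₁ S` is determined by the values of `A₁` on rank one
  -- operators.
  have hc := isCompactOperator_of_inner_eq hΨ
  obtain ⟨e', η', he, hη, hS, hs⟩ := exists_svd hc
  -- Boundedness and convergence against ambiguity functions give weak convergence to `Ψ`. This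
  -- allows testing against `m₁` times an ambiguity function, which need not be one itself.
  have hweak := tendsto_inner_of_total
    (S := Set.range fun q : L2 d × L2 d => ambigLp q.1 q.2)
    (fun x hx => eq_zero_of_forall_inner_ambigLp fun f g => hx _ (Set.mem_range_self (f, g)))
    (norm_svdAmbig_le hΨ hη hS) (x := Ψ) (l := atTop) ?_ (mulLp m₁ hm₁ (ambigLp f g))
  · rw [inner_mulLp_mulLp hm₁ hm₂, ← inner_mulLp_conjSymbol hm₂]
    exact tendsto_nhds_unique hweak (tendsto_inner_svdAmbig_mulLp hm₁ hA₁ h₁ S hc hs f g)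
  · rintro _ ⟨⟨f, g⟩, rfl⟩
    simp only [inner_svdAmbig_ambigLp, ← hΨ]
    exact tendsto_const_nhds.inner (tendsto_svdSum_apply hc hs f)

theorem ExtendsMultiplier.add {m₁ m₂ : Symbols d}
    {A₁ A₂ : schatten (L2 d) p →ₗ[ℂ] schatten (L2 d) p}
    (h₁ : ExtendsMultiplier m₁ A₁) (h₂ : ExtendsMultiplier m₂ A₂) :
    ExtendsMultiplier (m₁ + m₂) (A₁ + A₂) := by
  intro T hT f g
  have heq : (fun z => m₁ z * fourierWigner T.1 z * ⟪g, rho z f⟫_ℂ +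
      m₂ z * fourierWigner T.1 z * ⟪g, rho z f⟫_ℂ) =ᵐ[volume]
      fun z => (m₁ + m₂) z * fourierWigner T.1 z * ⟪g, rho z f⟫_ℂ := by
    filter_upwards [AEEqFun.coeFn_add m₁ m₂] with z hz
    rw [hz, Pi.add_apply]
    ring
  refine ⟨((h₁ T hT f g).1.add (h₂ T hT f g).1).congr heq, ?_⟩
  rw [← integral_congr_ae heq, integral_add (h₁ T hT f g).1 (h₂ T hT f g).1, (h₁ T hT f g).2,
    (h₂ T hT f g).2, LinearMap.add_apply, Submodule.coe_add, add_apply, inner_add_right]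

theorem ExtendsMultiplier.smul {m : Symbols d} {A : schatten (L2 d) p →ₗ[ℂ] schatten (L2 d) p}
    (h : ExtendsMultiplier m A) (c : ℂ) : ExtendsMultiplier (c • m) (c • A) := by
  intro T hT f g
  have heq : (fun z => c * (m z * fourierWigner T.1 z * ⟪g, rho z f⟫_ℂ)) =ᵐ[volume]
      fun z => (c • m) z * fourierWigner T.1 z * ⟪g, rho z f⟫_ℂ := by
    filter_upwards [AEEqFun.coeFn_smul c m] with z hz
    rw [hz, Pi.smul_apply, smul_eq_mul]
    ring
  refine ⟨((h T hT f g).1.const_mul c).congr heq, ?_⟩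
  rw [← integral_congr_ae heq, integral_const_mul, (h T hT f g).2, LinearMap.smul_apply,
    Submodule.coe_smul, smul_apply, inner_smul_right]

theorem one_mem_Lp : (1 : Symbols d) ∈ Lp ℂ ∞ (volume : Measure (PhaseSpace d)) := by
  refine mem_Lp_of_ae_norm_le (C := 1) ?_
  filter_upwards [AEEqFun.coeFn_one (α := PhaseSpace d) (β := ℂ) (μ := volume)] with z hz
  exact (congrArg norm hz).trans norm_one |>.le

/-- On rank one operators the criterion for the symbol `1` is exactly Moyal's identity. -/
theorem extendsMultiplier_one :
    ExtendsMultiplier (1 : Symbols d)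
      (LinearMap.id : schatten (L2 d) p →ₗ[ℂ] schatten (L2 d) p) := by
  rw [extendsMultiplier_iff one_mem_Lp isSchattenBound_id]
  intro e η f g
  have h1 : mulLp (1 : Symbols d) one_mem_Lp (ambigLp f g) = ambigLp f g := by
    refine Lp.ext ?_
    filter_upwards [coeFn_mulLp one_mem_Lp (ambigLp f g),
      AEEqFun.coeFn_one (α := PhaseSpace d) (β := ℂ) (μ := volume)] with z h h'
    rw [h]
    exact (congrArg (· * ambigLp f g z) h').trans (one_mul _)
  rw [h1, inner_ambigLp, LinearMap.id_apply, rankOneS, InnerProductSpace.rankOne_apply,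
    inner_smul_right]

end Extension

/-! ### The parity operator and complex conjugation of symbols -/

section Parity

variable {d : ℕ}

/-- The parity operator `f(t) ↦ f(-t)` on `L²(ℝ^d)`. -/
noncomputable def parity (d : ℕ) : L2 d →ₗᵢ[ℂ] L2 d :=
  Lp.compMeasurePreservingₗᵢ ℂ Neg.neg (Measure.measurePreserving_neg volume)

theorem coeFn_parity (f : L2 d) : parity d f =ᵐ[volume] fun t => f (-t) :=
  Lp.coeFn_compMeasurePreserving f (Measure.measurePreserving_neg volume)

theorem parity_parity (f : L2 d) : parity d (parity d f) = f := by
  refine Lp.ext ?_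
  filter_upwards [coeFn_parity (parity d f),
    (Measure.measurePreserving_neg volume).quasiMeasurePreserving.ae (coeFn_parity f)] with t h1 h2
  rw [h1, h2, neg_neg]

theorem inner_parity_left (f g : L2 d) : ⟪parity d f, g⟫_ℂ = ⟪f, parity d g⟫_ℂ := by
  rw [← (parity d).inner_map_map f, parity_parity]

theorem rho_parity (z : PhaseSpace d) (f : L2 d) :
    rho z (parity d f) = parity d (rho (-z) f) := by
  refine Lp.ext ?_
  filter_upwards [coeFn_rho z (parity d f), coeFn_parity (rho (-z) f),
    (Measure.measurePreserving_neg volume).quasiMeasurePreserving.ae (coeFn_rho (-z) f),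
    (measurePreserving_sub_right volume z.1).quasiMeasurePreserving.ae (coeFn_parity f)]
    with t h1 h2 h3 h4
  rw [h1, h2, h3]
  simp only [shiftFun, h4, Prod.fst_neg, Prod.snd_neg, inner_neg_neg]
  congr 2
  abel

/-- Parity intertwines `rho z` with `rho (-z) = (rho z)†`. Consequently `T ↦ P T* P` conjugates
Fourier–Wigner transforms of rank one operators pointwise. -/
theorem ambig_parity (f g : L2 d) (z : PhaseSpace d) :
    ambig (parity d f) (parity d g) z = (starRingEnd ℂ) (ambig g f z) := by
  rw [ambig, rho_parity, (parity d).inner_map_map, inner_rho_neg, ambig, inner_conj_symm]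

end Parity

section Conjugation

variable {d : ℕ} {p : ℝ≥0∞} [Fact (1 ≤ p)]

/-- The operator `P T* P` with the parity operator `P`. -/
noncomputable def parityAdjoint (T : L2 d →L[ℂ] L2 d) : L2 d →L[ℂ] L2 d :=
  (parity d).toContinuousLinearMap ∘L ContinuousLinearMap.adjoint T ∘L
    (parity d).toContinuousLinearMap

theorem inner_parityAdjoint (T : L2 d →L[ℂ] L2 d) (f g : L2 d) :
    ⟪g, parityAdjoint T f⟫_ℂ = (starRingEnd ℂ) ⟪parity d f, T (parity d g)⟫_ℂ := by
  change ⟪g, parity d (ContinuousLinearMap.adjoint T (parity d f))⟫_ℂ = _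
  rw [← inner_parity_left, ContinuousLinearMap.adjoint_inner_right, inner_conj_symm]

theorem singularValue_parityAdjoint_le (T : L2 d →L[ℂ] L2 d) (n : ℕ) :
    singularValue (parityAdjoint T) n ≤ singularValue T n :=
  (singularValue_comp_le_of_norm_le_one (parity d).norm_toContinuousLinearMap_le
    (parity d).norm_toContinuousLinearMap_le n).trans (singularValue_adjoint_le T n)

/-- The conjugate linear isometry `T ↦ P T* P` of the Schatten class. -/
noncomputable def parityStar : schatten (L2 d) p →ₗ⋆[ℂ] schatten (L2 d) p where
  toFun T := ⟨parityAdjoint T.1,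
    mem_schatten_of_singularValue_le T.2 (singularValue_parityAdjoint_le T.1)⟩
  map_add' S T := by
    ext1
    simp only [parityAdjoint, Submodule.coe_add, map_add, ContinuousLinearMap.add_comp,
      ContinuousLinearMap.comp_add]
  map_smul' c T := by
    ext1
    simp only [parityAdjoint, Submodule.coe_smul, map_smulₛₗ, ContinuousLinearMap.smul_comp,
      ContinuousLinearMap.comp_smul]

theorem schattenNorm_parityStar_le (T : schatten (L2 d) p) :
    schattenNorm (parityStar T) ≤ schattenNorm T :=
  schattenNorm_le_of_singularValue_le (singularValue_parityAdjoint_le T.1)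

theorem parityStar_rankOneS (e η : L2 d) :
    parityStar (rankOneS p e η) = rankOneS p (parity d η) (parity d e) := by
  ext1
  refine ContinuousLinearMap.ext fun f => ext_inner_left ℂ fun g => ?_
  change ⟪g, parityAdjoint (rankOne ℂ e η) f⟫_ℂ = ⟪g, rankOne ℂ _ _ f⟫_ℂ
  rw [inner_parityAdjoint, InnerProductSpace.rankOne_apply, InnerProductSpace.rankOne_apply,
    inner_smul_right, inner_smul_right, map_mul, inner_conj_symm, inner_conj_symm,
    inner_parity_left, inner_parity_left, mul_comm]

/-- The conjugate of an operator on the Schatten class by `T ↦ P T* P`. -/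
noncomputable def conjMap (A : schatten (L2 d) p →ₗ[ℂ] schatten (L2 d) p) :
    schatten (L2 d) p →ₗ[ℂ] schatten (L2 d) p :=
  (parityStar.comp A).comp parityStar

theorem IsSchattenBound.conjMap {A : schatten (L2 d) p →ₗ[ℂ] schatten (L2 d) p} {C : ℝ}
    (hA : IsSchattenBound A C) : IsSchattenBound (conjMap A) C := by
  refine ⟨hA.1, fun T => (schattenNorm_parityStar_le _).trans ((hA.2 _).trans ?_)⟩
  exact mul_le_mul_of_nonneg_left (schattenNorm_parityStar_le T) hA.1

/-- The complex conjugate of a multiplier is a multiplier with the same bound. -/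
theorem ExtendsMultiplier.conjSymbol {m : Symbols d}
    (hm : m ∈ Lp ℂ ∞ (volume : Measure (PhaseSpace d)))
    {A : schatten (L2 d) p →ₗ[ℂ] schatten (L2 d) p} {C : ℝ} (hA : IsSchattenBound A C)
    (h : ExtendsMultiplier m A) : ExtendsMultiplier (conjSymbol m) (FourierWigner.conjMap A) := by
  rw [extendsMultiplier_iff hm hA] at h
  rw [extendsMultiplier_iff (conjSymbol_mem_Lp hm) hA.conjMap]
  intro e η f g
  have h1 : (FourierWigner.conjMap A (rankOneS p e η)).1 =
      parityAdjoint (A (rankOneS p (parity d η) (parity d e))).1 := by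
    rw [← parityStar_rankOneS]
    rfl
  rw [h1, inner_parityAdjoint, ← h, inner_ambigLp_mulLp, inner_ambigLp_mulLp, ← integral_conj]
  refine integral_congr_ae ?_
  filter_upwards [coeFn_conjSymbol m] with z hz
  rw [hz, ambig_parity, ambig_parity, map_mul, map_mul, Complex.conj_conj, Complex.conj_conj]

end Conjugation

/-! ### Domination of the essential supremum by the multiplier bound -/

section Domination

variable {d : ℕ} {p : ℝ≥0∞} [Fact (1 ≤ p)]

theorem exists_extendsMultiplier_pow {m : Symbols d}
    (hm : m ∈ Lp ℂ ∞ (volume : Measure (PhaseSpace d)))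
    {A : schatten (L2 d) p →ₗ[ℂ] schatten (L2 d) p} {C : ℝ} (hA : IsSchattenBound A C)
    (h : ExtendsMultiplier m A) (n : ℕ) :
    m ^ n ∈ Lp ℂ ∞ (volume : Measure (PhaseSpace d)) ∧
      ∃ B : schatten (L2 d) p →ₗ[ℂ] schatten (L2 d) p,
        ExtendsMultiplier (m ^ n) B ∧ IsSchattenBound B (C ^ n) := by
  induction n with
  | zero =>
    rw [pow_zero, pow_zero]
    exact ⟨one_mem_Lp, LinearMap.id, extendsMultiplier_one, isSchattenBound_id⟩
  | succ n ih =>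
    obtain ⟨hn, B, hB, hBC⟩ := ih
    rw [pow_succ, pow_succ]
    exact ⟨mul_mem_Lp hn hm, B ∘ₗ A, hB.comp hn hm hBC hA h, hBC.comp hA⟩

/-- The symbol `|m|²` has an extension with bound `C²`, so its `n`-th power has bound `C^(2n)`. The
coefficient at the rank one operator built from `g` and `f` is `∫ |m|^(2n) |ambig f g|²`, and `|m| ≥
K` on the smaller domain. -/
theorem setIntegral_ambig_le {m : Symbols d}
    (hm : m ∈ Lp ℂ ∞ (volume : Measure (PhaseSpace d)))
    {A : schatten (L2 d) p →ₗ[ℂ] schatten (L2 d) p} {C : ℝ} (hA : IsSchattenBound A C)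
    (h : ExtendsMultiplier m A) {K : ℝ} (hK : 0 < K) (f g : L2 d) (n : ℕ) :
    (∫ z in {z | K ≤ ‖m z‖}, ‖ambig f g z‖ ^ 2) * (K * K) ^ n ≤
      (C * C) ^ n * (schattenNorm (rankOneS p g f) * (‖g‖ * ‖f‖)) := by
  obtain ⟨hn, B, hB, hBC⟩ := exists_extendsMultiplier_pow
    (mul_mem_Lp (conjSymbol_mem_Lp hm) hm) (hA.conjMap.comp hA)
    ((h.conjSymbol hm hA).comp (conjSymbol_mem_Lp hm) hm hA.conjMap hA h) n
  have hform := (extendsMultiplier_iff hn hBC).1 hB g f f g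
  have hint := integrable_mul_mul_conj hn (ambigLp f g) (ambigLp f g)
  have hae : (fun z => ((conjSymbol m * m) ^ n) z *
      (ambigLp f g z * (starRingEnd ℂ) (ambigLp f g z))) =ᵐ[volume]
      fun z => (((‖m z‖ * ‖m z‖) ^ n * ‖ambig f g z‖ ^ 2 : ℝ) : ℂ) := by
    filter_upwards [AEEqFun.coeFn_pow (conjSymbol m * m) n, AEEqFun.coeFn_mul (conjSymbol m) m,
      coeFn_conjSymbol m, coeFn_ambigLp f g] with z h1 h2 h3 h4
    have h5 : ((conjSymbol m * m) ^ n : Symbols d) z = ((conjSymbol m * m : Symbols d) z) ^ n := h1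
    rw [h5, h2, Pi.mul_apply, h3, h4, mul_comm _ (m z), Complex.mul_conj', Complex.mul_conj']
    push_cast
    ring
  rw [inner_mulLp, integral_congr_ae hae, integral_complex_ofReal] at hform
  have hint' : Integrable fun z => (‖m z‖ * ‖m z‖) ^ n * ‖ambig f g z‖ ^ 2 := by
    have := (hint.congr hae).re
    simpa only [RCLike.re_to_complex, Complex.ofReal_re] using this
  have hmeas : NullMeasurableSet {z | K ≤ ‖m z‖} (volume : Measure (PhaseSpace d)) :=
    nullMeasurableSet_le aemeasurable_const m.aestronglyMeasurable.norm.aemeasurable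
  have hamb : Integrable fun z => ‖ambig f g z‖ ^ 2 := (memLp_ambig f g).integrable_norm_pow (by simp)
  calc (∫ z in {z | K ≤ ‖m z‖}, ‖ambig f g z‖ ^ 2) * (K * K) ^ n
      = ∫ z in {z | K ≤ ‖m z‖}, ‖ambig f g z‖ ^ 2 * (K * K) ^ n := (integral_mul_const _ _).symm
    _ ≤ ∫ z in {z | K ≤ ‖m z‖}, (‖m z‖ * ‖m z‖) ^ n * ‖ambig f g z‖ ^ 2 := by
        refine setIntegral_mono_on₀ (hamb.mul_const _).integrableOn hint'.integrableOn hmeas ?_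
        intro z hz
        have hz' : K ≤ ‖m z‖ := hz
        rw [mul_comm]
        gcongr
    _ ≤ ∫ z, (‖m z‖ * ‖m z‖) ^ n * ‖ambig f g z‖ ^ 2 :=
        setIntegral_le_integral hint' (Eventually.of_forall fun z => by positivity)
    _ ≤ ‖⟪g, (B (rankOneS p g f)).1 f⟫_ℂ‖ := by
        rw [← hform]
        exact (le_abs_self _).trans (Complex.norm_real _).ge
    _ ≤ schattenNorm (B (rankOneS p g f)) * (‖g‖ * ‖f‖) := norm_inner_le_schattenNorm _ _ _
    _ ≤ _ := by
        rw [← mul_assoc ((C * C) ^ n)]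
        exact mul_le_mul_of_nonneg_right (hBC.2 _) (by positivity)

/-- The bound of a multiplier operator dominates the essential supremum of the symbol. -/
theorem ExtendsMultiplier.ae_norm_le {m : Symbols d}
    (hm : m ∈ Lp ℂ ∞ (volume : Measure (PhaseSpace d)))
    {A : schatten (L2 d) p →ₗ[ℂ] schatten (L2 d) p} {C : ℝ} (hA : IsSchattenBound A C)
    (h : ExtendsMultiplier m A) : ∀ᵐ z, ‖m z‖ ≤ C := by
  have key : ∀ K, C < K → ∀ᵐ z, ‖m z‖ < K := by
    intro K hCK
    have hK : 0 < K := hA.1.trans_lt hCK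
    refine ae_of_forall_ambig fun f g => ?_
    have hmeas : NullMeasurableSet {z | K ≤ ‖m z‖} (volume : Measure (PhaseSpace d)) :=
      nullMeasurableSet_le aemeasurable_const m.aestronglyMeasurable.norm.aemeasurable
    have hamb : Integrable fun z => ‖ambig f g z‖ ^ 2 :=
      (memLp_ambig f g).integrable_norm_pow (by simp)
    -- Dividing the estimate by `K^(2n)` leaves `(C / K)^(2n)` times a constant, which tends to zero
    -- since `C < K`.
    have hzero : ∫ z in {z | K ≤ ‖m z‖}, ‖ambig f g z‖ ^ 2 = 0 := by
      refine le_antisymm ?_ (integral_nonneg fun z => by positivity)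
      have hlim : Tendsto (fun n : ℕ => ((C * C) / (K * K)) ^ n *
          (schattenNorm (rankOneS p g f) * (‖g‖ * ‖f‖))) atTop (𝓝 0) := by
        rw [← zero_mul (schattenNorm (rankOneS p g f) * (‖g‖ * ‖f‖))]
        refine (tendsto_pow_atTop_nhds_zero_of_lt_one ?_ ?_).mul_const _
        · exact div_nonneg (mul_self_nonneg C) (mul_self_nonneg K)
        · rw [div_lt_one (by positivity)]
          exact mul_self_lt_mul_self hA.1 hCK
      refine ge_of_tendsto' hlim fun n => ?_
      have := setIntegral_ambig_le hm hA h hK f g n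
      rw [div_pow, div_mul_eq_mul_div, le_div_iff₀ (by positivity)]
      exact this
    rw [setIntegral_eq_zero_iff_of_nonneg_ae (Eventually.of_forall fun z => by positivity)
      hamb.integrableOn] at hzero
    have h2 := (ae_restrict_iff'₀ hmeas).1 hzero
    filter_upwards [h2] with z hz hne
    by_contra hlt
    exact hne (by simpa using hz (not_lt.1 hlt))
  have h1 : ∀ᵐ z, ∀ n : ℕ, ‖m z‖ < C + 1 / ((n : ℝ) + 1) :=
    ae_all_iff.2 fun n => key _ (lt_add_of_pos_right C (by positivity))
  filter_upwards [h1] with z hz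
  have := tendsto_one_div_add_atTop_nhds_zero_nat (𝕜 := ℝ)
  refine ge_of_tendsto' (by simpa using this.const_add C) fun n => (hz n).le

end Domination

/-! ### Weak limits, compressions and normal functionals -/

section WeakLimits

variable {H : Type*} [NormedAddCommGroup H] [InnerProductSpace ℂ H]

theorem opNorm_le_of_norm_inner_le {T : H →L[ℂ] H} {C : ℝ} (hC : 0 ≤ C)
    (h : ∀ f g, ‖⟪g, T f⟫_ℂ‖ ≤ C * (‖f‖ * ‖g‖)) : ‖T‖ ≤ C := by
  refine ContinuousLinearMap.opNorm_le_of_re_inner_le hC fun f g hf hg => ?_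
  rw [inner_re_symm]
  refine (RCLike.re_le_norm _).trans ((h f g).trans ?_)
  rw [hf, hg, one_mul, mul_one]

/-- A bounded sesquilinear form is represented by a bounded operator. -/
theorem exists_inner_eq_of_bound [CompleteSpace H] (B : H → H → ℂ) {C : ℝ} (hC : 0 ≤ C)
    (add_left : ∀ f f' g, B (f + f') g = B f g + B f' g)
    (smul_left : ∀ (c : ℂ) f g, B (c • f) g = c * B f g)
    (add_right : ∀ f g g', B f (g + g') = B f g + B f g')
    (smul_right : ∀ (c : ℂ) f g, B f (c • g) = (starRingEnd ℂ) c * B f g)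
    (hB : ∀ f g, ‖B f g‖ ≤ C * (‖f‖ * ‖g‖)) :
    ∃ T : H →L[ℂ] H, ‖T‖ ≤ C ∧ ∀ f g, ⟪g, T f⟫_ℂ = B f g := by
  -- Conjugating `B` swaps its linear and conjugate linear slots, as `continuousLinearMapOfBilin`
  -- expects.
  let L : H →ₗ⋆[ℂ] H →ₗ[ℂ] ℂ := LinearMap.mk₂'ₛₗ (starRingEnd ℂ) (RingHom.id ℂ)
    (fun f g => (starRingEnd ℂ) (B f g))
    (fun f f' g => by rw [add_left, map_add])
    (fun c f g => by rw [smul_left, map_mul, smul_eq_mul])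
    (fun f g g' => by rw [add_right, map_add])
    (fun c f g => by rw [smul_right, map_mul, Complex.conj_conj, smul_eq_mul, RingHom.id_apply])
  have hL : ∀ f g, ‖L f g‖ ≤ C * ‖f‖ * ‖g‖ := fun f g => by
    rw [mul_assoc]
    exact (RCLike.norm_conj _).trans_le (hB f g)
  refine ⟨InnerProductSpace.continuousLinearMapOfBilin (L.mkContinuous₂ C hL), ?_, ?_⟩
  all_goals
    have key : ∀ f g, ⟪g, InnerProductSpace.continuousLinearMapOfBilin
        (L.mkContinuous₂ C hL) f⟫_ℂ = B f g := fun f g => by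
      rw [← inner_conj_symm, InnerProductSpace.continuousLinearMapOfBilin_apply]
      exact Complex.conj_conj _
  · exact opNorm_le_of_norm_inner_le hC fun f g => by rw [key]; exact hB f g
  · exact key

theorem exists_weak_limit [CompleteSpace H] {ι : Type*} {l : Filter ι} [l.NeBot] {X : ι → H →L[ℂ] H} {C : ℝ}
    (hC : 0 ≤ C) (hX : ∀ i, ‖X i‖ ≤ C) {B : H → H → ℂ}
    (h : ∀ f g, Tendsto (fun i => ⟪g, X i f⟫_ℂ) l (𝓝 (B f g))) :
    ∃ T : H →L[ℂ] H, ‖T‖ ≤ C ∧ ∀ f g, ⟪g, T f⟫_ℂ = B f g := by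
  refine exists_inner_eq_of_bound B hC (fun f f' g => ?_) (fun c f g => ?_) (fun f g g' => ?_)
    (fun c f g => ?_) (fun f g => ?_)
  · refine tendsto_nhds_unique (h (f + f') g) (((h f g).add (h f' g)).congr fun i => ?_)
    rw [map_add, inner_add_right]
  · refine tendsto_nhds_unique (h (c • f) g) (((h f g).const_mul c).congr fun i => ?_)
    rw [map_smul, inner_smul_right]
  · refine tendsto_nhds_unique (h f (g + g')) (((h f g).add (h f g')).congr fun i => ?_)
    rw [inner_add_left]
  · refine tendsto_nhds_unique (h f (c • g)) (((h f g).const_mul _).congr fun i => ?_)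
    rw [inner_smul_left]
  · refine le_of_tendsto (h f g).norm (Eventually.of_forall fun i => ?_)
    calc ‖⟪g, X i f⟫_ℂ‖ ≤ ‖g‖ * (‖X i‖ * ‖f‖) :=
          (norm_inner_le_norm _ _).trans (by gcongr; exact (X i).le_opNorm f)
      _ ≤ ‖g‖ * (C * ‖f‖) := by gcongr; exact hX i
      _ = _ := by ring

end WeakLimits

section Compression

variable {H : Type*} [NormedAddCommGroup H] [InnerProductSpace ℂ H]

/-- The orthogonal projection onto the span of finitely many vectors of an orthonormal family. -/
noncomputable def finProj {ι : Type*} (b : ι → H) (J : Finset ι) : H →L[ℂ] H :=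
  ∑ i ∈ J, rankOne ℂ (b i) (b i)

theorem finProj_apply {ι : Type*} (b : ι → H) (J : Finset ι) (x : H) :
    finProj b J x = ∑ i ∈ J, ⟪b i, x⟫_ℂ • b i := by
  simp only [finProj, sum_apply, InnerProductSpace.rankOne_apply]

theorem norm_finProj_apply_le {ι : Type*} {b : ι → H} (hb : Orthonormal ℂ b) (J : Finset ι)
    (x : H) : ‖finProj b J x‖ ≤ ‖x‖ := by
  have h1 : ⟪finProj b J x, finProj b J x⟫_ℂ = ⟪x, finProj b J x⟫_ℂ := by
    nth_rewrite 1 [finProj_apply]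
    nth_rewrite 2 [finProj_apply]
    rw [sum_inner, inner_sum]
    refine Finset.sum_congr rfl fun i hi => ?_
    rw [inner_smul_left, inner_smul_right, finProj_apply, hb.inner_right_sum _ hi,
      inner_conj_symm, mul_comm]
  have h2 : ‖finProj b J x‖ * ‖finProj b J x‖ ≤ ‖x‖ * ‖finProj b J x‖ := by
    have h3 : ‖⟪finProj b J x, finProj b J x⟫_ℂ‖ = ‖finProj b J x‖ * ‖finProj b J x‖ := by
      rw [inner_self_eq_norm_sq_to_K]
      simp [sq]
    rw [← h3, h1]
    exact norm_inner_le_norm _ _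
  rcases (norm_nonneg (finProj b J x)).eq_or_lt with h0 | h0
  · rw [← h0]; exact norm_nonneg _
  · exact le_of_mul_le_mul_right h2 h0

theorem tendsto_finProj {ι : Type*} (b : HilbertBasis ι ℂ H) (x : H) :
    Tendsto (fun J => finProj b J x) atTop (𝓝 x) := by
  simp only [finProj_apply]
  simpa only [b.repr_apply_apply, HasSum, SummationFilter.unconditional_filter] using
    b.hasSum_repr x

theorem inner_finProj {ι : Type*} (b : ι → H) (J : Finset ι) (x y : H) :
    ⟪x, finProj b J y⟫_ℂ = ⟪finProj b J x, y⟫_ℂ := by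
  rw [finProj_apply, finProj_apply, sum_inner, inner_sum]
  refine Finset.sum_congr rfl fun i _ => ?_
  rw [inner_smul_left, inner_smul_right, inner_conj_symm, mul_comm]

/-- The compression `T ↦ P T P` to the span of finitely many vectors of an orthonormal family. -/
noncomputable def compress {ι : Type*} (b : ι → H) (J : Finset ι) :
    (H →L[ℂ] H) →ₗ[ℂ] H →L[ℂ] H where
  toFun T := finProj b J ∘L T ∘L finProj b J
  map_add' S T := by rw [ContinuousLinearMap.add_comp, ContinuousLinearMap.comp_add]
  map_smul' c T := by
    rw [ContinuousLinearMap.smul_comp, ContinuousLinearMap.comp_smul, RingHom.id_apply]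

theorem compress_apply {ι : Type*} (b : ι → H) (J : Finset ι) (T : H →L[ℂ] H) :
    compress b J T = finProj b J ∘L T ∘L finProj b J := rfl

/-- Compressions are finite combinations of rank one operators, so the latter determine a linear map
on them. -/
theorem compress_eq_sum {ι : Type*} (b : ι → H) (J : Finset ι) (T : H →L[ℂ] H) :
    compress b J T = ∑ i ∈ J, ∑ j ∈ J, ⟪b i, T (b j)⟫_ℂ • rankOne ℂ (b i) (b j) := by
  refine ContinuousLinearMap.ext fun x => ?_
  simp only [compress_apply, ContinuousLinearMap.comp_apply, finProj_apply, map_sum, map_smul,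
    sum_apply, smul_apply, InnerProductSpace.rankOne_apply, Finset.smul_sum, smul_smul, mul_comm]
  exact Finset.sum_comm

theorem norm_compress_le {ι : Type*} {b : ι → H} (hb : Orthonormal ℂ b) (J : Finset ι)
    (T : H →L[ℂ] H) : ‖compress b J T‖ ≤ ‖T‖ := by
  refine ContinuousLinearMap.opNorm_le_bound _ (norm_nonneg T) fun x => ?_
  refine (norm_finProj_apply_le hb J _).trans ((T.le_opNorm _).trans ?_)
  exact mul_le_mul_of_nonneg_left (norm_finProj_apply_le hb J x) (norm_nonneg T)

theorem tendsto_inner_compress {ι : Type*} (b : HilbertBasis ι ℂ H) (T : H →L[ℂ] H) (f g : H) :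
    Tendsto (fun J => ⟪g, compress b J T f⟫_ℂ) atTop (𝓝 ⟪g, T f⟫_ℂ) := by
  refine ((tendsto_finProj b g).inner ((T.continuous.tendsto f).comp (tendsto_finProj b f))).congr
    fun J => ?_
  rw [compress_apply, ContinuousLinearMap.comp_apply, ContinuousLinearMap.comp_apply,
    inner_finProj]
  rfl

end Compression

section NormalFunctional

variable {H : Type*} [NormedAddCommGroup H] [InnerProductSpace ℂ H] {s : ℕ → ℝ} {e η : ℕ → H}

theorem norm_mul_inner_le (hs0 : ∀ k, 0 ≤ s k) (he : ∀ k, ‖e k‖ ≤ 1) (hη : ∀ k, ‖η k‖ ≤ 1)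
    (T : H →L[ℂ] H) (k : ℕ) : ‖(s k : ℂ) * ⟪e k, T (η k)⟫_ℂ‖ ≤ s k * ‖T‖ := by
  rw [norm_mul, Complex.norm_real, Real.norm_of_nonneg (hs0 k)]
  refine mul_le_mul_of_nonneg_left ((norm_inner_le_norm _ _).trans ?_) (hs0 k)
  refine (mul_le_of_le_one_left (norm_nonneg _) (he k)).trans ((T.le_opNorm _).trans ?_)
  exact mul_le_of_le_one_right (norm_nonneg _) (hη k)

/-- The functional `T ↦ ∑ s_k ⟨e_k, T η_k⟩` on bounded operators. -/
noncomputable def normalFunctional (hs : Summable s) (hs0 : ∀ k, 0 ≤ s k) (he : ∀ k, ‖e k‖ ≤ 1)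
    (hη : ∀ k, ‖η k‖ ≤ 1) : (H →L[ℂ] H) →ₗ[ℂ] ℂ where
  toFun T := ∑' k, (s k : ℂ) * ⟪e k, T (η k)⟫_ℂ
  map_add' S T := by
    have h : ∀ T : H →L[ℂ] H, Summable fun k => (s k : ℂ) * ⟪e k, T (η k)⟫_ℂ := fun T =>
      .of_norm_bounded (hs.mul_right ‖T‖) (norm_mul_inner_le hs0 he hη T)
    rw [← (h S).tsum_add (h T)]
    simp only [add_apply, inner_add_right, mul_add]
  map_smul' c T := by
    rw [RingHom.id_apply, smul_eq_mul, ← tsum_mul_left]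
    simp only [smul_apply, inner_smul_right, mul_left_comm]

/-- Dominated convergence for the series: each term converges by the weak hypothesis and is
dominated by `s k * K`. -/
theorem tendsto_normalFunctional (hs : Summable s) (hs0 : ∀ k, 0 ≤ s k) (he : ∀ k, ‖e k‖ ≤ 1)
    (hη : ∀ k, ‖η k‖ ≤ 1) {ι : Type*} {l : Filter ι} {X : ι → H →L[ℂ] H} {T : H →L[ℂ] H} {K : ℝ}
    (hX : ∀ i, ‖X i‖ ≤ K) (h : ∀ f g, Tendsto (fun i => ⟪g, X i f⟫_ℂ) l (𝓝 ⟪g, T f⟫_ℂ)) :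
    Tendsto (fun i => normalFunctional hs hs0 he hη (X i)) l
      (𝓝 (normalFunctional hs hs0 he hη T)) := by
  refine tendsto_tsum_of_dominated_convergence (hs.mul_right K)
    (fun k => (h (η k) (e k)).const_mul _) (Eventually.of_forall fun i k => ?_)
  exact (norm_mul_inner_le hs0 he hη (X i) k).trans (mul_le_mul_of_nonneg_left (hX i) (hs0 k))

end NormalFunctional

section Bounded

variable {H : Type*} [NormedAddCommGroup H] [InnerProductSpace ℂ H] {p : ℝ≥0∞} [Fact (1 ≤ p)]

theorem mem_schatten_of_eq_top (hp : p = ∞) (T : H →L[ℂ] H) : T ∈ schatten H p := by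
  subst hp
  exact mem_schatten_top T

theorem schattenNorm_of_eq_top (hp : p = ∞) (T : schatten H p) : schattenNorm T = ‖T.1‖ := by
  subst hp
  exact schattenNorm_top T

/-- The sum is a partial isometry. Evaluating a map on it reads off sums of singular values in
`exists_normalFunctional`. -/
theorem norm_svdSum_one_le {s : ℕ → ℝ} {e η : ℕ → H}
    (he : ∀ k l, ⟪e k, e l⟫_ℂ = if k = l ∧ s k ≠ 0 then 1 else 0)
    (hη : ∀ k l, ⟪η k, η l⟫_ℂ = if k = l ∧ s k ≠ 0 then 1 else 0) (N : ℕ) :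
    ‖svdSum (fun _ => 1) e η N‖ ≤ 1 := by
  classical
  refine ContinuousLinearMap.opNorm_le_bound _ zero_le_one fun x => ?_
  rw [one_mul]
  refine le_of_sq_le_sq ?_ (norm_nonneg x)
  have h0 : ∀ k, s k = 0 → e k = 0 := fun k hk => by
    rw [← inner_self_eq_zero (𝕜 := ℂ), he, if_neg fun h => h.2 hk]
  have hsum : svdSum (fun _ => 1) e η N x =
      ∑ k ∈ (Finset.range N).filter (fun k => s k ≠ 0), ⟪η k, x⟫_ℂ • e k := by
    rw [svdSum_apply, Finset.sum_filter]
    refine Finset.sum_congr rfl fun k _ => ?_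
    by_cases hk : s k = 0
    · rw [if_neg (not_not.2 hk), h0 k hk, smul_zero]
    · rw [if_pos hk, Complex.ofReal_one, one_mul]
  rw [hsum, sum_inner_of_inner_eq he _ fun k hk => (Finset.mem_filter.1 hk).2]
  exact sum_norm_inner_sq_le hη _ x

end Bounded

/-! ### Normal extensions for `p = ∞` and canonical extensions -/

section Normal

variable {d : ℕ} {p : ℝ≥0∞} [Fact (1 ≤ p)]

/-- The bounded operator with matrix coefficients given by an `L²` function on phase space. -/
theorem exists_operator_of_Lp (Ψ : Lp ℂ 2 (volume : Measure (PhaseSpace d))) :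
    ∃ S : L2 d →L[ℂ] L2 d, ∀ f g, ⟪g, S f⟫_ℂ = ⟪Ψ, ambigLp f g⟫_ℂ := by
  obtain ⟨S, -, hS⟩ := exists_inner_eq_of_bound (fun f g => ⟪Ψ, ambigLp f g⟫_ℂ) (norm_nonneg Ψ)
    (fun f f' g => by simp only [ambigLp_add_left, inner_add_right])
    (fun c f g => by simp only [ambigLp_smul_left, inner_smul_right])
    (fun f g g' => by simp only [ambigLp_add_right, inner_add_right])
    (fun c f g => by simp only [ambigLp_smul_right, inner_smul_right])
    (fun f g => by rw [← norm_ambigLp]; exact norm_inner_le_norm _ _)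
  exact ⟨S, hS⟩

/-- The matrix coefficients of a multiplier operator on bounded operators are given by a normal
functional. -/
theorem exists_normalFunctional (hp : p = ∞) {m : Symbols d}
    (hm : m ∈ Lp ℂ ∞ (volume : Measure (PhaseSpace d)))
    {A : schatten (L2 d) p →ₗ[ℂ] schatten (L2 d) p} {C : ℝ} (hA : IsSchattenBound A C)
    (h : ExtendsMultiplier m A) (f g : L2 d) :
    ∃ (s : ℕ → ℝ) (e η : ℕ → L2 d) (hs : Summable s) (hs0 : ∀ k, 0 ≤ s k) (he : ∀ k, ‖e k‖ ≤ 1)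
      (hη : ∀ k, ‖η k‖ ≤ 1), ∀ e' η' : L2 d, ⟪g, (A (rankOneS p e' η')).1 f⟫_ℂ =
        normalFunctional hs hs0 he hη (rankOne ℂ e' η') := by
  rw [extendsMultiplier_iff hm hA] at h
  set Ψ := mulLp m hm (ambigLp f g)
  obtain ⟨S, hS⟩ := exists_operator_of_Lp Ψ
  have hc := isCompactOperator_of_inner_eq hS
  obtain ⟨e, η, he, hη, hSη, hrem⟩ := exists_svd hc
  have hkey : ∀ e' η' : L2 d, ⟪g, (A (rankOneS p e' η')).1 f⟫_ℂ = ⟪S η', e'⟫_ℂ := by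
    intro e' η'
    rw [← h, ← inner_conj_symm (S η'), hS, inner_conj_symm]
  -- On the partial isometry formed from the first `N` singular vectors of `S`, the coefficient of
  -- `A` equals this sum. Boundedness of `A` on bounded operators thus forces `S` to be trace class.
  have hsum : ∀ N, ∑ k ∈ Finset.range N, singularValue S k ≤ C * (‖g‖ * ‖f‖) := by
    intro N
    have h1 : ⟪g, (A ⟨svdSum (fun _ => 1) e η N, svdSum_mem_schatten _ e η N⟩).1 f⟫_ℂ =
        ((∑ k ∈ Finset.range N, singularValue S k : ℝ) : ℂ) := by
      rw [apply_svdSum, AddSubmonoidClass.coe_finsetSum, sum_apply, inner_sum, Complex.ofReal_sum]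
      refine Finset.sum_congr rfl fun k _ => ?_
      rw [Submodule.coe_smul, smul_apply, inner_smul_right, hkey, hSη, inner_smul_left, he]
      by_cases h0 : singularValue S k = 0 <;> simp [h0]
    have h2 := norm_inner_le_schattenNorm
      (A ⟨svdSum (fun _ => 1) e η N, svdSum_mem_schatten _ e η N⟩) f g
    rw [h1, Complex.norm_real] at h2
    refine (Real.le_norm_self _).trans (h2.trans ?_)
    refine mul_le_mul_of_nonneg_right ((hA.2 _).trans ?_) (by positivity)
    rw [schattenNorm_of_eq_top hp]
    exact mul_le_of_le_one_right hA.1 (norm_svdSum_one_le he hη N)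
  refine ⟨singularValue S, e, η, summable_of_sum_range_le (singularValue_nonneg S) hsum,
    singularValue_nonneg S, norm_le_one_of_inner he, norm_le_one_of_inner hη, fun e' η' => ?_⟩
  rw [hkey]
  have hsm : Summable fun k => (singularValue S k : ℂ) * ⟪e k, rankOne ℂ e' η' (η k)⟫_ℂ :=
    .of_norm_bounded
      ((summable_of_sum_range_le (singularValue_nonneg S) hsum).mul_right ‖rankOne ℂ e' η'‖)
      (norm_mul_inner_le (singularValue_nonneg S) (norm_le_one_of_inner he)
        (norm_le_one_of_inner hη) _)
  refine tendsto_nhds_unique ((tendsto_svdSum_apply hc hrem η').inner tendsto_const_nhds)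
    (hsm.hasSum.tendsto_sum_nat.congr fun N => ?_)
  rw [svdSum_apply, sum_inner]
  refine Finset.sum_congr rfl fun k _ => ?_
  rw [InnerProductSpace.rankOne_apply, inner_smul_right, inner_smul_left, map_mul,
    Complex.conj_ofReal, inner_conj_symm, mul_assoc]

/-- Continuity of an operator on the Schatten class on bounded sets with respect to the weak operator
topology. -/
def IsNormal (A : schatten (L2 d) p →ₗ[ℂ] schatten (L2 d) p) : Prop :=
  ∀ (ι : Type) (l : Filter ι) (X : ι → schatten (L2 d) p) (T : schatten (L2 d) p) (K : ℝ),
    (∀ i, schattenNorm (X i) ≤ K) →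
    (∀ f g, Tendsto (fun i => ⟪g, (X i).1 f⟫_ℂ) l (𝓝 ⟪g, T.1 f⟫_ℂ)) →
    ∀ f g, Tendsto (fun i => ⟪g, (A (X i)).1 f⟫_ℂ) l (𝓝 ⟪g, (A T).1 f⟫_ℂ)

theorem isNormal_id : IsNormal (LinearMap.id : schatten (L2 d) p →ₗ[ℂ] schatten (L2 d) p) :=
  fun _ _ _ _ _ _ h => h

theorem IsNormal.comp {A₁ A₂ : schatten (L2 d) p →ₗ[ℂ] schatten (L2 d) p} {C : ℝ}
    (h₁ : IsNormal A₁) (h₂ : IsNormal A₂) (hA₂ : IsSchattenBound A₂ C) :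
    IsNormal (A₁ ∘ₗ A₂) := fun ι l X T K hX h =>
  h₁ ι l (fun i => A₂ (X i)) (A₂ T) (C * K)
    (fun i => (hA₂.2 _).trans (mul_le_mul_of_nonneg_left (hX i) hA₂.1)) (h₂ ι l X T K hX h)

theorem IsNormal.add {A₁ A₂ : schatten (L2 d) p →ₗ[ℂ] schatten (L2 d) p}
    (h₁ : IsNormal A₁) (h₂ : IsNormal A₂) : IsNormal (A₁ + A₂) := fun ι l X T K hX h f g => by
  simp only [LinearMap.add_apply, Submodule.coe_add, add_apply, inner_add_right]
  exact (h₁ ι l X T K hX h f g).add (h₂ ι l X T K hX h f g)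

theorem IsNormal.smul {A : schatten (L2 d) p →ₗ[ℂ] schatten (L2 d) p}
    (hA : IsNormal A) (c : ℂ) : IsNormal (c • A) := fun ι l X T K hX h f g => by
  simp only [LinearMap.smul_apply, Submodule.coe_smul, smul_apply, inner_smul_right]
  exact (hA ι l X T K hX h f g).const_mul c

/-- Compression as a map of the Schatten class, for `p = ∞`. -/
noncomputable def compressS (hp : p = ∞) {ι : Type*} (b : ι → L2 d) (J : Finset ι)
    (T : schatten (L2 d) p) : schatten (L2 d) p :=
  ⟨compress b J T.1, mem_schatten_of_eq_top hp _⟩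

theorem apply_compressS (hp : p = ∞) {ι : Type*} (b : ι → L2 d) (J : Finset ι)
    (T : schatten (L2 d) p) (A : schatten (L2 d) p →ₗ[ℂ] schatten (L2 d) p) :
    A (compressS hp b J T) =
      ∑ i ∈ J, ∑ j ∈ J, ⟪b i, T.1 (b j)⟫_ℂ • A (rankOneS p (b i) (b j)) := by
  have : compressS hp b J T = ∑ i ∈ J, ∑ j ∈ J, ⟪b i, T.1 (b j)⟫_ℂ • rankOneS p (b i) (b j) := by
    ext1
    simp only [AddSubmonoidClass.coe_finsetSum, Submodule.coe_smul]
    exact compress_eq_sum b J T.1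
  simp only [this, map_sum, map_smul]

theorem inner_apply_compressS (hp : p = ∞) {ι : Type*} (b : ι → L2 d) (J : Finset ι)
    (T : schatten (L2 d) p) {A : schatten (L2 d) p →ₗ[ℂ] schatten (L2 d) p} {f g : L2 d}
    {φ : (L2 d →L[ℂ] L2 d) →ₗ[ℂ] ℂ}
    (h : ∀ e' η' : L2 d, ⟪g, (A (rankOneS p e' η')).1 f⟫_ℂ = φ (rankOne ℂ e' η')) :
    ⟪g, (A (compressS hp b J T)).1 f⟫_ℂ = φ (compress b J T.1) := by
  rw [apply_compressS, compress_eq_sum]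
  simp only [AddSubmonoidClass.coe_finsetSum, Submodule.coe_smul, sum_apply, smul_apply, inner_sum,
    inner_smul_right, map_sum, map_smul, h, smul_eq_mul]

/-- The given extension is kept on rank one operators only, where its coefficients are normal
functionals; these extend to all bounded operators and define `A'`. -/
theorem exists_isNormal (hp : p = ∞) {m : Symbols d}
    (hm : m ∈ Lp ℂ ∞ (volume : Measure (PhaseSpace d)))
    {A : schatten (L2 d) p →ₗ[ℂ] schatten (L2 d) p} {C : ℝ} (hA : IsSchattenBound A C)
    (h : ExtendsMultiplier m A) :
    ∃ A' : schatten (L2 d) p →ₗ[ℂ] schatten (L2 d) p,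
      ExtendsMultiplier m A' ∧ IsSchattenBound A' C ∧ IsNormal A' := by
  choose s e η hs hs0 he hη hφ using exists_normalFunctional hp hm hA h
  set φ : L2 d → L2 d → (L2 d →L[ℂ] L2 d) →ₗ[ℂ] ℂ := fun f g =>
    normalFunctional (hs f g) (hs0 f g) (he f g) (hη f g) with hφdef
  obtain ⟨w, b, -⟩ := exists_hilbertBasis ℂ (L2 d)
  have hex : ∀ T : schatten (L2 d) p, ∃ Y : L2 d →L[ℂ] L2 d, ‖Y‖ ≤ C * ‖T.1‖ ∧
      ∀ f g, ⟪g, Y f⟫_ℂ = φ f g T.1 := by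
    intro T
    -- `Y` is the weak limit of `A` on finite compressions of `T`; compression does not increase the
    -- norm, so the constant `C` survives.
    refine exists_weak_limit (l := atTop) (X := fun J => (A (compressS hp b J T)).1)
      (mul_nonneg hA.1 (norm_nonneg _)) (fun J => ?_) (fun f g => ?_)
    · refine (norm_le_schattenNorm _).trans ((hA.2 _).trans ?_)
      rw [schattenNorm_of_eq_top hp]
      exact mul_le_mul_of_nonneg_left (norm_compress_le b.orthonormal J T.1) hA.1
    · simp only [fun J => inner_apply_compressS hp b J T (hφ f g)]
      exact tendsto_normalFunctional _ _ _ _ (fun J => norm_compress_le b.orthonormal J T.1)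
        (tendsto_inner_compress b T.1)
  choose Y hYC hY using hex
  let A' : schatten (L2 d) p →ₗ[ℂ] schatten (L2 d) p :=
    { toFun := fun T => ⟨Y T, mem_schatten_of_eq_top hp _⟩
      map_add' := fun S T => by
        ext1
        refine ContinuousLinearMap.ext fun f => ext_inner_left ℂ fun g => ?_
        simp only [Submodule.coe_add, add_apply, inner_add_right, hY, map_add]
      map_smul' := fun c T => by
        ext1
        refine ContinuousLinearMap.ext fun f => ext_inner_left ℂ fun g => ?_
        simp only [Submodule.coe_smul, smul_apply, inner_smul_right, hY, map_smul, smul_eq_mul,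
          RingHom.id_apply] }
  have hA'φ : ∀ T f g, ⟪g, (A' T).1 f⟫_ℂ = φ f g T.1 := hY
  have hA' : IsSchattenBound A' C := by
    refine ⟨hA.1, fun T => ?_⟩
    rw [schattenNorm_of_eq_top hp, schattenNorm_of_eq_top hp]
    exact hYC T
  refine ⟨A', ?_, hA', fun ι l X T K hX hlim f g => ?_⟩
  · rw [extendsMultiplier_iff hm hA] at h
    rw [extendsMultiplier_iff hm hA']
    intro e' η' f g
    rw [h, hA'φ, hφ]
    rfl
  · simp only [hA'φ]
    refine tendsto_normalFunctional _ _ _ _ (K := K) (fun i => ?_) hlim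
    rw [← schattenNorm_of_eq_top hp]
    exact hX i

variable (p) in
/-- The canonical bounded extensions of `𝔗_m`: for `p = ∞` these are the normal ones. -/
structure IsCanonicalExtension (m : Symbols d) (A : schatten (L2 d) p →ₗ[ℂ] schatten (L2 d) p) :
    Prop where
  extends_multiplier : ExtendsMultiplier m A
  bounded : ∃ C, IsSchattenBound A C
  isNormal : p = ∞ → IsNormal A

/-- Passing to a canonical extension keeps the bound `C`. This makes the infimum over all extensions
a statement about the canonical one. -/
theorem exists_isCanonicalExtension {m : Symbols d}
    (hm : m ∈ Lp ℂ ∞ (volume : Measure (PhaseSpace d)))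
    {A : schatten (L2 d) p →ₗ[ℂ] schatten (L2 d) p} {C : ℝ} (hA : IsSchattenBound A C)
    (h : ExtendsMultiplier m A) :
    ∃ A' : schatten (L2 d) p →ₗ[ℂ] schatten (L2 d) p,
      IsCanonicalExtension p m A' ∧ IsSchattenBound A' C := by
  by_cases hp : p = ∞
  · obtain ⟨A', h1, h2, h3⟩ := exists_isNormal hp hm hA h
    exact ⟨A', ⟨h1, ⟨C, h2⟩, fun _ => h3⟩, h2⟩
  · exact ⟨A, ⟨h, ⟨C, hA⟩, fun h => absurd h hp⟩, hA⟩

/-- Both maps agree on rank one operators by `extendsMultiplier_iff`. For `p < ∞` singular value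
decompositions carry this to all of `𝒮^p`; for `p = ∞` normality does so along compressions. -/
theorem IsCanonicalExtension.unique {m : Symbols d}
    (hm : m ∈ Lp ℂ ∞ (volume : Measure (PhaseSpace d)))
    {A B : schatten (L2 d) p →ₗ[ℂ] schatten (L2 d) p} (hA : IsCanonicalExtension p m A)
    (hB : IsCanonicalExtension p m B) : A = B := by
  obtain ⟨C, hC⟩ := hA.bounded
  obtain ⟨D, hD⟩ := hB.bounded
  have hrank : ∀ e η : L2 d, A (rankOneS p e η) = B (rankOneS p e η) := by
    intro e η
    ext1
    refine ContinuousLinearMap.ext fun f => ext_inner_left ℂ fun g => ?_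
    rw [← (extendsMultiplier_iff hm hC).1 hA.extends_multiplier,
      ← (extendsMultiplier_iff hm hD).1 hB.extends_multiplier]
  refine LinearMap.ext fun T => ?_
  ext1
  refine ContinuousLinearMap.ext fun f => ext_inner_left ℂ fun g => ?_
  by_cases hp : p = ∞
  · obtain ⟨w, b, -⟩ := exists_hilbertBasis ℂ (L2 d)
    have hnorm : ∀ J, schattenNorm (compressS hp b J T) ≤ ‖T.1‖ := fun J => by
      rw [schattenNorm_of_eq_top hp]
      exact norm_compress_le b.orthonormal J T.1
    have h1 := hA.isNormal hp _ atTop (fun J => compressS hp b J T) T _ hnorm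
      (tendsto_inner_compress b T.1) f g
    have h2 := hB.isNormal hp _ atTop (fun J => compressS hp b J T) T _ hnorm
      (tendsto_inner_compress b T.1) f g
    simp only [apply_compressS, hrank] at h1 h2
    exact tendsto_nhds_unique h1 h2
  · have hc := isCompactOperator_of_tendsto_singularValue
      (tendsto_singularValue_of_mem_schatten hp T.2)
    obtain ⟨e, η, -, -, -, hs⟩ := exists_svd hc
    have h1 := tendsto_inner_apply_svdSum hC T hc hs f g
    simp only [hrank] at h1
    exact tendsto_nhds_unique h1 (tendsto_inner_apply_svdSum hD T hc hs f g)

theorem IsCanonicalExtension.mul {m₁ m₂ : Symbols d}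
    (hm₁ : m₁ ∈ Lp ℂ ∞ (volume : Measure (PhaseSpace d)))
    (hm₂ : m₂ ∈ Lp ℂ ∞ (volume : Measure (PhaseSpace d)))
    {A₁ A₂ : schatten (L2 d) p →ₗ[ℂ] schatten (L2 d) p} (h₁ : IsCanonicalExtension p m₁ A₁)
    (h₂ : IsCanonicalExtension p m₂ A₂) :
    IsCanonicalExtension p (m₁ * m₂) (A₁ ∘ₗ A₂) := by
  obtain ⟨C₁, hC₁⟩ := h₁.bounded
  obtain ⟨C₂, hC₂⟩ := h₂.bounded
  exact ⟨h₁.extends_multiplier.comp hm₁ hm₂ hC₁ hC₂ h₂.extends_multiplier, ⟨_, hC₁.comp hC₂⟩,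
    fun hp => (h₁.isNormal hp).comp (h₂.isNormal hp) hC₂⟩

theorem IsCanonicalExtension.add {m₁ m₂ : Symbols d}
    {A₁ A₂ : schatten (L2 d) p →ₗ[ℂ] schatten (L2 d) p} (h₁ : IsCanonicalExtension p m₁ A₁)
    (h₂ : IsCanonicalExtension p m₂ A₂) :
    IsCanonicalExtension p (m₁ + m₂) (A₁ + A₂) := by
  obtain ⟨C₁, hC₁⟩ := h₁.bounded
  obtain ⟨C₂, hC₂⟩ := h₂.bounded
  exact ⟨h₁.extends_multiplier.add h₂.extends_multiplier, ⟨_, hC₁.add hC₂⟩,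
    fun hp => (h₁.isNormal hp).add (h₂.isNormal hp)⟩

theorem IsCanonicalExtension.smul {m : Symbols d}
    {A : schatten (L2 d) p →ₗ[ℂ] schatten (L2 d) p} (h : IsCanonicalExtension p m A) (c : ℂ) :
    IsCanonicalExtension p (c • m) (c • A) := by
  obtain ⟨C, hC⟩ := h.bounded
  exact ⟨h.extends_multiplier.smul c, ⟨_, hC.smul c⟩, fun hp => (h.isNormal hp).smul c⟩

theorem isCanonicalExtension_one :
    IsCanonicalExtension p (1 : Symbols d)
      (LinearMap.id : schatten (L2 d) p →ₗ[ℂ] schatten (L2 d) p) :=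
  ⟨extendsMultiplier_one, ⟨1, isSchattenBound_id⟩, fun _ => isNormal_id⟩

end Normal

/-! ### The multiplier algebra and its norm -/

section MultiplierNorm

variable {d : ℕ} {p : ℝ≥0∞} [Fact (1 ≤ p)]

theorem multiplierNorm_le {m : Symbols d} {A : schatten (L2 d) p →ₗ[ℂ] schatten (L2 d) p} {C : ℝ}
    (h : ExtendsMultiplier m A) (hA : IsSchattenBound A C) : multiplierNorm p m ≤ C :=
  csInf_le ⟨0, fun _ ⟨_, _, hB⟩ => hB.1⟩ ⟨A, h, hA⟩

theorem multiplierNorm_nonneg (m : Symbols d) : 0 ≤ multiplierNorm p m :=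
  Real.sInf_nonneg fun _ ⟨_, _, hB⟩ => hB.1

/-- The multiplier norm is the operator norm of the canonical extension. -/
theorem IsCanonicalExtension.isLeast {m : Symbols d}
    (hm : m ∈ Lp ℂ ∞ (volume : Measure (PhaseSpace d)))
    {A : schatten (L2 d) p →ₗ[ℂ] schatten (L2 d) p} (hA : IsCanonicalExtension p m A) :
    IsLeast {C | IsSchattenBound A C} (multiplierNorm p m) := by
  obtain ⟨C, hC⟩ := hA.bounded
  refine ⟨⟨multiplierNorm_nonneg m, fun T => ?_⟩,
    fun D hD => multiplierNorm_le hA.extends_multiplier hD⟩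
  -- An arbitrary extension `B` may be replaced by a canonical one with the same bound, which is `A`
  -- by uniqueness.
  have hle : ∀ D, (∃ B : schatten (L2 d) p →ₗ[ℂ] schatten (L2 d) p,
      ExtendsMultiplier m B ∧ IsSchattenBound B D) →
      schattenNorm (A T) ≤ D * schattenNorm T := by
    rintro D ⟨B, hB, hBD⟩
    obtain ⟨B', hB', hB'D⟩ := exists_isCanonicalExtension hm hBD hB
    rw [hA.unique hm hB']
    exact hB'D.2 T
  rcases (schattenNorm_nonneg T).eq_or_lt with h0 | h0
  · have := hC.2 T
    rw [← h0, mul_zero] at this ⊢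
    exact this
  · rw [← div_le_iff₀ h0]
    refine le_csInf ⟨C, A, hA.extends_multiplier, hC⟩ fun D hD => ?_
    rw [div_le_iff₀ h0]
    exact hle D hD

theorem IsMultiplier.exists_isCanonicalExtension {m : Symbols d} (hm : IsMultiplier p m) :
    ∃ A : schatten (L2 d) p →ₗ[ℂ] schatten (L2 d) p, IsCanonicalExtension p m A := by
  obtain ⟨hmL, A, hA, C, hC⟩ := hm
  obtain ⟨A', hA', -⟩ := FourierWigner.exists_isCanonicalExtension hmL hC hA
  exact ⟨A', hA'⟩

variable (p d) in
/-- The algebra `𝔐_p` of Fourier–Wigner multipliers. -/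
noncomputable def multiplierAlgebra : Subalgebra ℂ (Symbols d) where
  carrier := {m | IsMultiplier p m}
  mul_mem' := by
    rintro m₁ m₂ ⟨h₁, A₁, hA₁, C₁, hC₁⟩ ⟨h₂, A₂, hA₂, C₂, hC₂⟩
    exact ⟨mul_mem_Lp h₁ h₂, _, hA₁.comp h₁ h₂ hC₁ hC₂ hA₂, _, hC₁.comp hC₂⟩
  add_mem' := by
    rintro m₁ m₂ ⟨h₁, A₁, hA₁, C₁, hC₁⟩ ⟨h₂, A₂, hA₂, C₂, hC₂⟩
    exact ⟨AddSubgroup.add_mem _ h₁ h₂, _, hA₁.add hA₂, _, hC₁.add hC₂⟩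
  algebraMap_mem' := by
    intro c
    rw [Algebra.algebraMap_eq_smul_one]
    exact ⟨Lp.const_smul_mem_Lp c ⟨1, one_mem_Lp⟩, _, extendsMultiplier_one.smul c, _,
      isSchattenBound_id.smul c⟩

theorem mem_multiplierAlgebra {m : Symbols d} : m ∈ multiplierAlgebra d p ↔ IsMultiplier p m :=
  Iff.rfl

/-- The canonical bounded extension of `𝔗_m` to `𝒮^p`. -/
noncomputable def canonicalExtension (m : multiplierAlgebra d p) :
    schatten (L2 d) p →ₗ[ℂ] schatten (L2 d) p :=
  (mem_multiplierAlgebra.1 m.2).exists_isCanonicalExtension.choose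

theorem isCanonicalExtension_canonicalExtension (m : multiplierAlgebra d p) :
    IsCanonicalExtension p (m : Symbols d) (canonicalExtension m) :=
  (mem_multiplierAlgebra.1 m.2).exists_isCanonicalExtension.choose_spec

theorem isSchattenBound_canonicalExtension (m : multiplierAlgebra d p) :
    IsSchattenBound (canonicalExtension m) (multiplierNorm p (m : Symbols d)) :=
  ((isCanonicalExtension_canonicalExtension m).isLeast m.2.1).1

theorem canonicalExtension_eq {m : multiplierAlgebra d p}
    {A : schatten (L2 d) p →ₗ[ℂ] schatten (L2 d) p}
    (hA : IsCanonicalExtension p (m : Symbols d) A) : canonicalExtension m = A :=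
  (isCanonicalExtension_canonicalExtension m).unique m.2.1 hA

/-- The homomorphism `m ↦ 𝔗_m` into the operators on the Schatten class. -/
noncomputable def multiplierHom :
    multiplierAlgebra d p →ₐ[ℂ] Module.End ℂ (schatten (L2 d) p) :=
  -- Canonical extensions are closed under sums, multiples and composition, so uniqueness turns each
  -- closure property into a homomorphism identity.
  AlgHom.ofLinearMap
    { toFun := canonicalExtension
      map_add' := fun a b => canonicalExtension_eq
        ((isCanonicalExtension_canonicalExtension a).add (isCanonicalExtension_canonicalExtension b))
      map_smul' := fun c a => canonicalExtension_eq
        ((isCanonicalExtension_canonicalExtension a).smul c) }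
    (canonicalExtension_eq isCanonicalExtension_one)
    (fun a b => canonicalExtension_eq ((isCanonicalExtension_canonicalExtension a).mul a.2.1 b.2.1
      (isCanonicalExtension_canonicalExtension b)))

theorem ae_norm_le_multiplierNorm (m : multiplierAlgebra d p) :
    ∀ᵐ z, ‖(m : Symbols d) z‖ ≤ multiplierNorm p (m : Symbols d) :=
  (isCanonicalExtension_canonicalExtension m).extends_multiplier.ae_norm_le m.2.1
    (isSchattenBound_canonicalExtension m)

theorem multiplierNorm_smul_le (c : ℂ) (m : multiplierAlgebra d p) :
    multiplierNorm p ((c • m : multiplierAlgebra d p) : Symbols d) ≤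
      ‖c‖ * multiplierNorm p (m : Symbols d) :=
  multiplierNorm_le ((isCanonicalExtension_canonicalExtension m).extends_multiplier.smul c)
    ((isSchattenBound_canonicalExtension m).smul c)

theorem multiplierNorm_smul (c : ℂ) (m : multiplierAlgebra d p) :
    multiplierNorm p ((c • m : multiplierAlgebra d p) : Symbols d) =
      ‖c‖ * multiplierNorm p (m : Symbols d) := by
  refine le_antisymm (multiplierNorm_smul_le c m) ?_
  by_cases hc : c = 0
  · rw [hc, norm_zero, zero_mul]
    exact multiplierNorm_nonneg _
  · have h := multiplierNorm_smul_le c⁻¹ (c • m)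
    rw [inv_smul_smul₀ hc, norm_inv] at h
    rwa [← le_inv_mul_iff₀ (norm_pos_iff.2 hc)]

theorem multiplierNorm_add_le (a b : multiplierAlgebra d p) :
    multiplierNorm p ((a + b : multiplierAlgebra d p) : Symbols d) ≤
      multiplierNorm p (a : Symbols d) + multiplierNorm p (b : Symbols d) :=
  multiplierNorm_le ((isCanonicalExtension_canonicalExtension a).extends_multiplier.add
    (isCanonicalExtension_canonicalExtension b).extends_multiplier)
    ((isSchattenBound_canonicalExtension a).add (isSchattenBound_canonicalExtension b))

theorem multiplierNorm_mul_le (a b : multiplierAlgebra d p) :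
    multiplierNorm p ((a * b : multiplierAlgebra d p) : Symbols d) ≤
      multiplierNorm p (a : Symbols d) * multiplierNorm p (b : Symbols d) :=
  multiplierNorm_le ((isCanonicalExtension_canonicalExtension a).mul a.2.1 b.2.1
    (isCanonicalExtension_canonicalExtension b)).extends_multiplier
    ((isSchattenBound_canonicalExtension a).comp (isSchattenBound_canonicalExtension b))

/-- The identity map gives the upper bound; the lower one is the domination of the essential
supremum. -/
theorem multiplierNorm_one :
    multiplierNorm p ((1 : multiplierAlgebra d p) : Symbols d) = 1 := by
  refine le_antisymm (multiplierNorm_le extendsMultiplier_one isSchattenBound_id) ?_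
  have hone : ∀ᵐ z, ((1 : multiplierAlgebra d p) : Symbols d) z = 1 :=
    AEEqFun.coeFn_one (α := PhaseSpace d) (β := ℂ) (μ := volume)
  obtain ⟨z, h1, h2⟩ := ((ae_norm_le_multiplierNorm (1 : multiplierAlgebra d p)).and hone).exists
  rwa [h2, norm_one] at h1

theorem multiplierNorm_eq_zero_iff (m : multiplierAlgebra d p) :
    multiplierNorm p (m : Symbols d) = 0 ↔ m = 0 := by
  constructor
  · intro h
    refine Subtype.ext (AEEqFun.ext ?_)
    have hzero : ∀ᵐ z, ((0 : multiplierAlgebra d p) : Symbols d) z = 0 :=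
      AEEqFun.coeFn_zero (α := PhaseSpace d) (β := ℂ) (μ := volume)
    filter_upwards [ae_norm_le_multiplierNorm m, hzero] with z h1 h2
    rw [h] at h1
    rw [h2]
    exact norm_le_zero_iff.1 h1
  · rintro rfl
    have h := multiplierNorm_smul (0 : ℂ) (0 : multiplierAlgebra d p)
    rwa [zero_smul, norm_zero, zero_mul] at h

end MultiplierNorm

/-! ### Completeness of the multiplier norm -/

section Completeness

theorem cauchySeq_of_norm_sub_le_mul {E : Type*} [SeminormedAddCommGroup E] {a : ℕ → ℕ → ℝ}
    (ha : ∀ ε > 0, ∃ n₀, ∀ j ≥ n₀, ∀ k ≥ n₀, a j k < ε) {x : ℕ → E} {c : ℝ} (hc : 0 ≤ c)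
    (h : ∀ j k, ‖x j - x k‖ ≤ a j k * c) : CauchySeq x := by
  refine Metric.cauchySeq_iff.2 fun ε hε => ?_
  -- Dividing by `c + 1` avoids a case distinction at `c = 0`.
  obtain ⟨n₀, hn₀⟩ := ha (ε / (c + 1)) (by positivity)
  refine ⟨n₀, fun j hj k hk => ?_⟩
  rw [dist_eq_norm]
  calc ‖x j - x k‖ ≤ a j k * c := h j k
    _ ≤ ε / (c + 1) * c := mul_le_mul_of_nonneg_right (hn₀ j hj k hk).le hc
    _ < ε := by
      rw [div_mul_eq_mul_div, div_lt_iff₀ (by positivity)]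
      linarith [mul_add ε c 1]

variable {d : ℕ} {p : ℝ≥0∞} [Fact (1 ≤ p)]

theorem ExtendsMultiplier.sub {m₁ m₂ : Symbols d}
    {A₁ A₂ : schatten (L2 d) p →ₗ[ℂ] schatten (L2 d) p}
    (h₁ : ExtendsMultiplier m₁ A₁) (h₂ : ExtendsMultiplier m₂ A₂) :
    ExtendsMultiplier (m₁ - m₂) (A₁ - A₂) := by
  have h := h₁.add (h₂.smul (-1))
  have hA : A₁ + (-1 : ℂ) • A₂ = A₁ - A₂ := LinearMap.ext fun T => by
    rw [LinearMap.add_apply, LinearMap.smul_apply, LinearMap.sub_apply, neg_one_smul,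
      ← sub_eq_add_neg]
  rwa [neg_one_smul, hA, ← sub_eq_add_neg] at h

/-- A pointwise Cauchy sequence of symbols that is eventually uniformly bounded converges weakly as
a sequence of multiplication operators. -/
theorem exists_symbol_limit {u : ℕ → Symbols d}
    (hu : ∀ j, u j ∈ Lp ℂ ∞ (volume : Measure (PhaseSpace d)))
    (hc : ∀ᵐ z, CauchySeq fun j => u j z) {K : ℝ} (hK : ∀ᶠ j in atTop, ∀ᵐ z, ‖u j z‖ ≤ K) :
    ∃ (m : Symbols d) (hm : m ∈ Lp ℂ ∞ (volume : Measure (PhaseSpace d))),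
      ∀ Ψ Φ, Tendsto (fun j => ⟪Ψ, mulLp (u j) (hu j) Φ⟫_ℂ) atTop (𝓝 ⟪Ψ, mulLp m hm Φ⟫_ℂ) := by
  obtain ⟨F, hF, hlim⟩ := exists_stronglyMeasurable_limit_of_tendsto_ae
    (fun j => (u j).aestronglyMeasurable)
    (by filter_upwards [hc] with z hz using cauchySeq_tendsto_of_complete hz)
  set m : Symbols d := AEEqFun.mk F hF.aestronglyMeasurable with hmdef
  have hm : ∀ᵐ z, Tendsto (fun j => u j z) atTop (𝓝 (m z)) := by
    filter_upwards [hlim, AEEqFun.coeFn_mk F hF.aestronglyMeasurable] with z h1 h2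
    rwa [h2]
  have hbound : ∀ᵐ z, ‖m z‖ ≤ K := by
    obtain ⟨n₀, hn₀⟩ := eventually_atTop.1 hK
    have h1 : ∀ᵐ z, ∀ j, n₀ ≤ j → ‖u j z‖ ≤ K := by
      refine ae_all_iff.2 fun j => ?_
      by_cases hj : n₀ ≤ j
      · filter_upwards [hn₀ j hj] with z hz _ using hz
      · exact Eventually.of_forall fun z h => absurd h hj
    filter_upwards [hm, h1] with z h2 h3
    exact le_of_tendsto h2.norm (eventually_atTop.2 ⟨n₀, fun j hj => h3 j hj⟩)
  refine ⟨m, mem_Lp_of_ae_norm_le hbound, fun Ψ Φ => ?_⟩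
  simp only [inner_mulLp]
  have hint : Integrable fun z => Φ z * (starRingEnd ℂ) (Ψ z) := by
    simpa only [RCLike.inner_apply] using L2.integrable_inner (𝕜 := ℂ) Ψ Φ
  -- The bound `K` holds only for large `j`, which the filter version of dominated convergence
  -- permits.
  refine tendsto_integral_filter_of_dominated_convergence
    (fun z => K * ‖Φ z * (starRingEnd ℂ) (Ψ z)‖)
    (Eventually.of_forall fun j => (integrable_mul_mul_conj (hu j) Ψ Φ).1) ?_
    (hint.norm.const_mul K) ?_
  · filter_upwards [hK] with j hj
    filter_upwards [hj] with z hz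
    rw [norm_mul]
    exact mul_le_mul_of_nonneg_right hz (norm_nonneg _)
  · filter_upwards [hm] with z hz using hz.mul_const _

/-- The limits are taken in operator norm, where completeness is available, and lower semicontinuity
of the Schatten norm returns the `𝒮^p` estimates. -/
theorem exists_operator_limit {A : ℕ → schatten (L2 d) p →ₗ[ℂ] schatten (L2 d) p}
    {a : ℕ → ℕ → ℝ} (ha : ∀ ε > 0, ∃ n₀, ∀ j ≥ n₀, ∀ k ≥ n₀, a j k < ε)
    (hA : ∀ j k, IsSchattenBound (A j - A k) (a j k)) :
    ∃ B : schatten (L2 d) p →ₗ[ℂ] schatten (L2 d) p,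
      (∀ T, Tendsto (fun j => (A j T).1) atTop (𝓝 (B T).1)) ∧
      ∀ ε > 0, ∃ n₀, ∀ j ≥ n₀, IsSchattenBound (A j - B) ε := by
  have hcauchy : ∀ T, CauchySeq fun j => (A j T).1 := fun T =>
    cauchySeq_of_norm_sub_le_mul ha (schattenNorm_nonneg T) fun j k =>
      (norm_le_schattenNorm ((A j - A k) T)).trans ((hA j k).2 T)
  choose Y hY using fun T => cauchySeq_tendsto_of_complete (hcauchy T)
  have hest : ∀ ε > 0, ∃ n₀, ∀ j ≥ n₀, ∀ T, ∃ h : (A j T).1 - Y T ∈ schatten (L2 d) p,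
      schattenNorm (⟨(A j T).1 - Y T, h⟩ : schatten (L2 d) p) ≤ ε * schattenNorm T := by
    intro ε hε
    obtain ⟨n₀, hn₀⟩ := ha ε hε
    refine ⟨n₀, fun j hj T => mem_schatten_and_norm_le_of_tendsto
      (T := fun k => (A j - A (n₀ + k)) T) (fun k => ((hA j (n₀ + k)).2 T).trans ?_) ?_⟩
    · exact mul_le_mul_of_nonneg_right (hn₀ j hj _ (Nat.le_add_right _ _)).le (schattenNorm_nonneg T)
    · have h1 : Tendsto (fun k => n₀ + k) atTop atTop :=
        tendsto_atTop_mono (fun k => Nat.le_add_left k n₀) tendsto_id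
      exact ((hY T).comp h1).const_sub _
  have hmem : ∀ T, Y T ∈ schatten (L2 d) p := by
    intro T
    obtain ⟨n₀, hn₀⟩ := hest 1 one_pos
    obtain ⟨h, -⟩ := hn₀ n₀ le_rfl T
    have := (schatten (L2 d) p).sub_mem (A n₀ T).2 h
    rwa [sub_sub_cancel] at this
  let B : schatten (L2 d) p →ₗ[ℂ] schatten (L2 d) p :=
    { toFun := fun T => ⟨Y T, hmem T⟩
      map_add' := fun S T => by
        ext1
        refine tendsto_nhds_unique (hY (S + T)) (((hY S).add (hY T)).congr fun j => ?_)
        rw [map_add, Submodule.coe_add]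
      map_smul' := fun c T => by
        ext1
        refine tendsto_nhds_unique (hY (c • T)) (((hY T).const_smul c).congr fun j => ?_)
        rw [map_smul, Submodule.coe_smul] }
  refine ⟨B, hY, fun ε hε => ?_⟩
  obtain ⟨n₀, hn₀⟩ := hest ε hε
  refine ⟨n₀, fun j hj => ⟨hε.le, fun T => ?_⟩⟩
  obtain ⟨h, hle⟩ := hn₀ j hj T
  exact hle

/-- A Cauchy sequence has two limits: `B` of the canonical extensions and `m` of the symbols, the
latter because the norm dominates the essential supremum. Comparing coefficients on rank one
operators shows that `B` extends `𝔗_m`. -/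
theorem multiplierAlgebra_complete (u : ℕ → multiplierAlgebra d p)
    (hu : ∀ ε > 0, ∃ n₀, ∀ j ≥ n₀, ∀ k ≥ n₀,
      multiplierNorm p ((u j - u k : multiplierAlgebra d p) : Symbols d) < ε) :
    ∃ a : multiplierAlgebra d p, Tendsto
      (fun j => multiplierNorm p ((u j - a : multiplierAlgebra d p) : Symbols d)) atTop (𝓝 0) := by
  have hsub : ∀ j k, canonicalExtension (u j) - canonicalExtension (u k) =
      canonicalExtension (u j - u k) := fun j k => (map_sub multiplierHom (u j) (u k)).symm
  obtain ⟨B, hB, hBbound⟩ := exists_operator_limit (A := fun j => canonicalExtension (u j)) hu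
    (fun j k => by
      rw [hsub]
      exact isSchattenBound_canonicalExtension _)
  have hae : ∀ᵐ z, ∀ j k, ‖(u j : Symbols d) z - (u k : Symbols d) z‖ ≤
      multiplierNorm p ((u j - u k : multiplierAlgebra d p) : Symbols d) := by
    refine ae_all_iff.2 fun j => ae_all_iff.2 fun k => ?_
    have h1 : ∀ᵐ z, ((u j - u k : multiplierAlgebra d p) : Symbols d) z =
        (u j : Symbols d) z - (u k : Symbols d) z := AEEqFun.coeFn_sub (u j : Symbols d) (u k)
    filter_upwards [ae_norm_le_multiplierNorm (u j - u k), h1] with z h2 h3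
    rwa [h3] at h2
  have hc : ∀ᵐ z, CauchySeq fun j => (u j : Symbols d) z := by
    filter_upwards [hae] with z hz
    exact cauchySeq_of_norm_sub_le_mul hu zero_le_one fun j k => by rw [mul_one]; exact hz j k
  obtain ⟨n₁, hn₁⟩ := hu 1 one_pos
  have hK : ∀ᶠ j in atTop, ∀ᵐ z, ‖(u j : Symbols d) z‖ ≤
      multiplierNorm p (u n₁ : Symbols d) + 1 := by
    filter_upwards [eventually_ge_atTop n₁] with j hj
    filter_upwards [hae, ae_norm_le_multiplierNorm (u n₁)] with z h1 h2
    linarith [h1 j n₁, hn₁ j hj n₁ le_rfl,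
      norm_le_insert' ((u j : Symbols d) z) ((u n₁ : Symbols d) z)]
  obtain ⟨m, hm, hlim⟩ := exists_symbol_limit (fun j => (u j).2.1) hc hK
  obtain ⟨n₂, hn₂⟩ := hBbound 1 one_pos
  -- The constant comes from writing `B` as `A + (-1) • (A - B)`, where `A` extends the multiplier
  -- of `u n₂` and `A - B` has bound `1`.
  have hBC : IsSchattenBound B (multiplierNorm p (u n₂ : Symbols d) + ‖(-1 : ℂ)‖ * 1) := by
    have := (isSchattenBound_canonicalExtension (u n₂)).add ((hn₂ n₂ le_rfl).smul (-1))
    have hsum : canonicalExtension (u n₂) + (-1 : ℂ) • (canonicalExtension (u n₂) - B) = B :=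
      LinearMap.ext fun T => by
        rw [LinearMap.add_apply, LinearMap.smul_apply, LinearMap.sub_apply, neg_one_smul, neg_sub,
          add_sub_cancel]
    rwa [hsum] at this
  have hext : ExtendsMultiplier m B := by
    rw [extendsMultiplier_iff hm hBC]
    intro e η f g
    refine tendsto_nhds_unique (hlim (ambigLp η e) (ambigLp f g)) ?_
    have h1 : Tendsto (fun j => (canonicalExtension (u j) (rankOneS p e η)).1 f) atTop
        (𝓝 ((B (rankOneS p e η)).1 f)) :=
      ((ContinuousLinearMap.apply ℂ (L2 d) f).continuous.tendsto _).comp (hB (rankOneS p e η))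
    refine (tendsto_const_nhds.inner h1).congr fun j => ?_
    rw [(extendsMultiplier_iff (u j).2.1 (isSchattenBound_canonicalExtension (u j))).1
      (isCanonicalExtension_canonicalExtension (u j)).extends_multiplier]
  refine ⟨⟨m, hm, B, hext, _, hBC⟩, ?_⟩
  rw [Metric.tendsto_atTop]
  intro ε hε
  obtain ⟨n₀, hn₀⟩ := hBbound (ε / 2) (half_pos hε)
  refine ⟨n₀, fun j hj => ?_⟩
  rw [Real.dist_0_eq_abs, abs_of_nonneg (multiplierNorm_nonneg _)]
  refine (multiplierNorm_le ?_ (hn₀ j hj)).trans_lt (half_lt_self hε)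
  exact (isCanonicalExtension_canonicalExtension (u j)).extends_multiplier.sub hext

end Completeness

end FourierWigner

theorem mainTheorem6 (d : ℕ) (p : ℝ≥0∞) [Fact (1 ≤ p)] :
    -- the multipliers form a subalgebra of the functions under pointwise multiplication,
    -- and a Banach algebra under the multiplier norm
    (∃ 𝓜 : Subalgebra ℂ (Symbols d),
      (∀ m, m ∈ 𝓜 ↔ IsMultiplier p m) ∧
      IsBanachAlgebraNorm
        (fun m : 𝓜 => multiplierNorm p (m : Symbols d)) ∧
      -- `m ↦ 𝔗_m` is an isometric homomorphism of algebras into the bounded operators on `𝒮^p`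
      ∃ Φ : 𝓜 →ₐ[ℂ] Module.End ℂ (schatten (L2 d) p),
        ∀ m : 𝓜, ExtendsMultiplier (m : Symbols d) (Φ m) ∧
          IsLeast {C | IsSchattenBound (Φ m) C}
            (multiplierNorm p (m : Symbols d))) ∧
    -- composites of multiplier operators are multiplier operators of the product
    (∀ m₁ m₂ : Symbols d,
      IsMultiplier p m₁ → IsMultiplier p m₂ →
      ∀ A₁ A₂ : schatten (L2 d) p →ₗ[ℂ]
          schatten (L2 d) p,
        ExtendsMultiplier m₁ A₁ → (∃ C, IsSchattenBound A₁ C) →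
        ExtendsMultiplier m₂ A₂ → (∃ C, IsSchattenBound A₂ C) →
        ExtendsMultiplier (m₁ * m₂) (A₁ ∘ₗ A₂)) := by
  refine ⟨⟨multiplierAlgebra d p, fun m => mem_multiplierAlgebra, ?_, multiplierHom, fun m => ?_⟩, ?_⟩
  · exact
      { nonneg := fun a => multiplierNorm_nonneg _
        eq_zero_iff := multiplierNorm_eq_zero_iff
        smul := multiplierNorm_smul
        add_le := multiplierNorm_add_le
        mul_le := multiplierNorm_mul_le
        one := multiplierNorm_one
        complete := multiplierAlgebra_complete }
  · exact ⟨(isCanonicalExtension_canonicalExtension m).extends_multiplier,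
      (isCanonicalExtension_canonicalExtension m).isLeast m.2.1⟩
  · rintro m₁ m₂ ⟨hm₁, -⟩ ⟨hm₂, -⟩ A₁ A₂ h₁ ⟨C₁, hC₁⟩ h₂ ⟨C₂, hC₂⟩
    exact h₁.comp hm₁ hm₂ hC₁ hC₂ h₂
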